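/- Let $p,q$ be real numbers with $0\le p<q$ and $p+q=1$, and put $\tau=p/q$. Let $(\eta_t)_{t\ge 0}$ be the asymmetric simple exclusion process on $\mathbb Z$ with hopping rate $p$ to the right and $q$ to the left (a càdlàg process in $\{0,1\}^{\mathbb Z}$ solving the martingale problem for the ASEP generator on functions of finitely many occupation numbers), started from a possibly random configuration $\eta_0$ that almost surely has no particles sufficiently far to the left. Write $n_x(\eta)=\eta(x)$, $N_x=\sum_{j\le x}n_j$, $Q_x=\tau^{N_x}$ and $\tilde Q_x=(Q_x-Q_{x-1})/(\tau-1)=\tau^{N_{x-1}}n_x$ (with $0^0=1$), and let $\langle\cdot\rangle_t$ denote the expectation over $\eta_t$. For a set $\Lambda$ of consecutive sites and finite sets $A,B\subset\Lambda$ let $G_\Lambda(A;t|B;0)=\langle A|e^{-tH_\Lambda}|B\rangle$ be the transition probability of the exclusion process with finitely many particles on $\Lambda$ with reflecting boundaries, where $H_\Lambda$ is its transition rate matrix, and let $G=G_{\mathbb Z}$. Then for all $t\ge 0$, $x\in\mathbb Z$ and integers $n\ge 0$: (i) $N_x(\eta_t)<\infty$ almost surely, and the series $$c_k=\sum_{-\infty<x_1<\dots<x_k\le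 x}\ \sum_{-\infty<y_1<\dots<y_k<\infty}G(\{x_1,\dots,x_k\};t\,|\,\{y_1,\dots,y_k\};0)\,\langle\tilde Q_{y_1}\cdots\tilde Q_{y_k}\rangle_0$$ converges absolutely for every $k\ge 0$; moreover $$\langle Q_x^n\rangle_t=\sum_{k=0}^n(\tau^n-1)(\tau^{n-1}-1)\cdots(\tau^{n-k+1}-1)\,c_k .$$ (ii) $\langle Q_x^n\rangle_t=\lim_{L\to\infty}\langle Q_x^n\rangle_t^{(L)}$, where $\langle\cdot\rangle_t^{(L)}$ is the expectation at time $t$ for the exclusion process on $\{-L,\dots,L\}$ with reflecting boundaries started from the restriction of $\eta_0$ to $\{-L,\dots,L\}$, and $Q_x=\tau^{\sum_{j=-L}^x n_j}$ there. (iii) Let $N_t(x)$ be the integrated current, that is, the number of hops from $x+1$ to $x$ minus the number of hops from $x$ to $x+1$ during $(0,t]$. If almost surely $\eta_0(y)=0$ for all $y\le 0$, then for $x\le 0$ almost surely $N_t(x)=N_x(\eta_t)$, and hence $$\langle\tau^{nN_t(x)}\rangle=\sum_{k=0}^n(\tau^n-1)(\tau^{n-1}-1)\cdots(\tau^{n-k+1}-1)\,c_k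 .$$ -/

import Mathlib

open MeasureTheory ProbabilityTheory Filter Topology
open scoped NNReal

namespace ASEP

/-! ### Finite-particle states, the transition rate matrix and transition probabilities -/

/-- The action of the transition rate matrix `H` of the exclusion process on the basis state
`|A⟩`, where the finite set `A ⊆ ℤ` is the set of positions of the particles.  Particles jump
only between neighbouring sites of `Λ` (reflection at the boundary of `Λ`): a particle hops to
the right with rate `p` and to the left with rate `q`, if the target site is empty. -/
noncomputable def rateMatrixBasis (p q : ℝ) (Λ : Set ℤ) (A : Finset ℤ) : Finset ℤ →₀ ℝ :=
  open Classical in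
  -∑ x ∈ A,
    ((if x ∈ Λ ∧ x + 1 ∈ Λ ∧ x + 1 ∉ A then
        p • (Finsupp.single (insert (x + 1) (A.erase x)) 1 - Finsupp.single A 1) else 0) +
     (if x ∈ Λ ∧ x - 1 ∈ Λ ∧ x - 1 ∉ A then
        q • (Finsupp.single (insert (x - 1) (A.erase x)) 1 - Finsupp.single A 1) else 0))

/-- The transition rate matrix `H` as a linear operator on the space of finite linear
combinations of the states `|A⟩`; the master equation is `d|P⟩/dt = -H|P⟩`. -/
noncomputable def rateMatrix (p q : ℝ) (Λ : Set ℤ) :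
    (Finset ℤ →₀ ℝ) →ₗ[ℝ] (Finset ℤ →₀ ℝ) :=
  Finsupp.linearCombination ℝ (rateMatrixBasis p q Λ)

/-- The transition probability `G(A; t | B; 0) = ⟨A| e^{-tH} |B⟩` of the exclusion process on
`Λ` with finitely many particles, started from the particle positions `B`.  (On states with
`k` particles the matrix `H` is bounded, so that the exponential series converges
absolutely.) -/
noncomputable def transProb (p q : ℝ) (Λ : Set ℤ) (t : ℝ) (A B : Finset ℤ) : ℝ :=
  ∑' m : ℕ, (-t) ^ m / (m.factorial : ℝ) * ((rateMatrix p q Λ ^ m) (Finsupp.single B 1)) A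

/-! ### Configurations on `ℤ` -/

/-- Particle configurations on `ℤ`; `η x = true` means that site `x` is occupied. -/
abbrev Config : Type := ℤ → Bool

/-- The occupation number `n_x ∈ {0, 1}`. -/
def occ (x : ℤ) (η : Config) : ℝ := if η x = true then 1 else 0

/-- The set of occupied sites in `(-∞, x]`. -/
def leftParticles (x : ℤ) (η : Config) : Set ℤ := {j | j ≤ x ∧ η j = true}

/-- `N_x = ∑_{j ≤ x} n_j` (used for configurations for which this is finite). -/
noncomputable def leftCount (x : ℤ) (η : Config) : ℕ := (leftParticles x η).ncard

/-- `Q_x = τ ^ N_x`. -/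
noncomputable def Q (τ : ℝ) (x : ℤ) (η : Config) : ℝ := τ ^ leftCount x η

/-- `Q̃_x = (Q_x - Q_{x-1}) / (τ - 1)`. -/
noncomputable def Qtilde (τ : ℝ) (x : ℤ) (η : Config) : ℝ :=
  (Q τ x η - Q τ (x - 1) η) / (τ - 1)

/-- The form `Q̃_x = τ ^ N_{x-1} n_x`. -/
theorem Qtilde_eq {τ : ℝ} (hτ : τ ≠ 1) (x : ℤ) (η : Config)
    (hfin : (leftParticles x η).Finite) :
    Qtilde τ x η = τ ^ leftCount (x - 1) η * occ x η := by
  have hτ' : τ - 1 ≠ 0 := sub_ne_zero.mpr hτ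
  by_cases h : η x = true
  · have hset : leftParticles x η = insert x (leftParticles (x - 1) η) := by
      ext j
      simp only [leftParticles, Set.mem_ofPred_eq, Set.mem_insert_iff]
      constructor
      · rintro ⟨h1, h2⟩
        rcases eq_or_lt_of_le h1 with h3 | h3
        · exact Or.inl h3
        · exact Or.inr ⟨by omega, h2⟩
      · rintro (rfl | ⟨h1, h2⟩)
        · exact ⟨le_rfl, h⟩
        · exact ⟨by omega, h2⟩
    have hfin' : (leftParticles (x - 1) η).Finite :=
      hfin.subset (by rw [hset]; exact Set.subset_insert _ _)
    have hnot : x ∉ leftParticles (x - 1) η := by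
      simp [leftParticles]
    have hc : leftCount x η = leftCount (x - 1) η + 1 := by
      unfold leftCount
      rw [hset, Set.ncard_insert_of_notMem hnot hfin']
    simp only [Qtilde, Q, occ, hc, h, if_true]
    field_simp
    ring
  · have hset : leftParticles x η = leftParticles (x - 1) η := by
      ext j
      simp only [leftParticles, Set.mem_ofPred_eq]
      constructor
      · rintro ⟨h1, h2⟩
        rcases eq_or_lt_of_le h1 with h3 | h3
        · exact absurd (h3 ▸ h2) h
        · exact ⟨by omega, h2⟩
      · rintro ⟨h1, h2⟩
        exact ⟨by omega, h2⟩
    simp [Qtilde, Q, occ, h, leftCount, hset]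

/-! ### The exclusion process on `ℤ` -/

/-- The rate at which the contents of the sites `x` and `x + 1` are exchanged: `p` if there is a
particle at `x` and none at `x + 1`, `q` if there is one at `x + 1` and none at `x`. -/
def exchangeRate (p q : ℝ) (x : ℤ) (η : Config) : ℝ :=
  if η x = true ∧ η (x + 1) = false then p
  else if η x = false ∧ η (x + 1) = true then q
  else 0

/-- The configuration in which the contents of the sites `x` and `x + 1` are exchanged. -/
def exchange (x : ℤ) (η : Config) : Config := fun y => η (Equiv.swap x (x + 1) y)

/-- The generator of the exclusion process on `ℤ`, applied to a function `f` of finitely many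
occupation numbers (only finitely many terms of the sum are then nonzero). -/
noncomputable def generator (p q : ℝ) (f : Config → ℝ) (η : Config) : ℝ :=
  ∑ᶠ x : ℤ, exchangeRate p q x η * (f (exchange x η) - f η)

/-- `η` is a version of the asymmetric simple exclusion process on `ℤ` with respect to the
filtration `ℱ`: it is adapted, has càdlàg paths in `{0,1}^ℤ` (product topology), and solves the
martingale problem for the generator on the functions of finitely many occupation numbers. -/
structure IsASEP {Ω : Type*} {m : MeasurableSpace Ω} (p q : ℝ) (μ : Measure Ω)
    (ℱ : Filtration ℝ≥0 m) (η : ℝ≥0 → Ω → Config) : Prop where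
  adapted : ∀ t, Measurable[ℱ t] (η t)
  right_continuous : ∀ ω t, ContinuousWithinAt (fun s => η s ω) (Set.Ici t) t
  left_limits : ∀ ω t, ∃ ζ : Config, Tendsto (fun s => η s ω) (𝓝[<] t) (𝓝 ζ)
  martingale : ∀ (f : Config → ℝ) (S : Finset ℤ), DependsOn f (S : Set ℤ) →
    Martingale
      (fun t ω => f (η t ω) - f (η 0 ω) -
        ∫ s in (0 : ℝ)..(t : ℝ), generator p q f (η s.toNNReal ω)) ℱ μ

/-- Along the path `γ`, a particle hops at time `s > 0` from site `a` to site `b`. -/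
def HopsAt (γ : ℝ≥0 → Config) (a b : ℤ) (s : ℝ≥0) : Prop :=
  0 < s ∧ (∀ᶠ r in 𝓝[<] s, γ r a = true ∧ γ r b = false) ∧ γ s a = false ∧ γ s b = true

/-- The integrated current `N_t(x)`: the number of hops from `x + 1` to `x` minus the number of
hops from `x` to `x + 1` during the time interval `(0, t]`. -/
noncomputable def current (γ : ℝ≥0 → Config) (t : ℝ≥0) (x : ℤ) : ℤ :=
  ({s | s ≤ t ∧ HopsAt γ (x + 1) x s}.ncard : ℤ) - ({s | s ≤ t ∧ HopsAt γ x (x + 1) s}.ncard : ℤ)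

/-! ### Reflecting systems on `{-L, …, L}` -/

/-- The sites `{-L, …, L}`. -/
noncomputable def box (L : ℕ) : Finset ℤ := Finset.Icc (-(L : ℤ)) (L : ℤ)

/-- The set of particles of `η` in `{-L, …, L}`. -/
noncomputable def restrict (L : ℕ) (η : Config) : Finset ℤ := (box L).filter (fun x => η x = true)

/-- The probability of the configuration `A` at time `t` in the system on `{-L, …, L}` with
reflecting boundaries, started from the restriction to `{-L, …, L}` of the random configuration
`η₀`. -/
noncomputable def boxProb {Ω : Type*} {m : MeasurableSpace Ω} (p q : ℝ) (μ : Measure Ω)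
    (η₀ : Ω → Config) (L : ℕ) (t : ℝ) (A : Finset ℤ) : ℝ :=
  ∑ B ∈ (box L).powerset,
    transProb p q (box L : Set ℤ) t A B * μ.real {ω | restrict L (η₀ ω) = B}

/-- The moment `⟨Q_x^n⟩_t` in that system, where `Q_x = τ ^ (∑_{j = -L}^x n_j)`. -/
noncomputable def boxMoment {Ω : Type*} {m : MeasurableSpace Ω} (p q : ℝ) (μ : Measure Ω)
    (η₀ : Ω → Config) (L : ℕ) (t : ℝ) (x : ℤ) (n : ℕ) : ℝ :=
  ∑ A ∈ (box L).powerset,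
    ((p / q) ^ (A.filter (fun a => a ≤ x)).card) ^ n * boxProb p q μ η₀ L t A

/-! ### The coefficients `c_k` -/

/-- Positions `x_1 < ⋯ < x_k` of `k` particles on `ℤ`, as a `k`-element subset of `ℤ`. -/
abbrev Positions (k : ℕ) : Type := {A : Finset ℤ // A.card = k}

/-- Positions `x_1 < ⋯ < x_k ≤ x`. -/
abbrev PositionsLE (k : ℕ) (x : ℤ) : Type := {A : Finset ℤ // A.card = k ∧ ∀ a ∈ A, a ≤ x}

/-- `⟨Q̃_{y_1} ⋯ Q̃_{y_k}⟩_0` for `B = {y_1, …, y_k}`. -/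
noncomputable def initialCorr {Ω : Type*} {m : MeasurableSpace Ω} (τ : ℝ) (μ : Measure Ω)
    (η₀ : Ω → Config) (B : Finset ℤ) : ℝ :=
  ∫ ω, ∏ y ∈ B, Qtilde τ y (η₀ ω) ∂μ

/-- `c_k = ∑_{x_1 < ⋯ < x_k ≤ x} ∑_{y_1 < ⋯ < y_k} G({x}; t | {y}; 0) ⟨Q̃_{y_1} ⋯ Q̃_{y_k}⟩_0`. -/
noncomputable def coeff {Ω : Type*} {m : MeasurableSpace Ω} (p q : ℝ) (μ : Measure Ω)
    (η₀ : Ω → Config) (t : ℝ) (x : ℤ) (k : ℕ) : ℝ :=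
  ∑' A : PositionsLE k x, ∑' B : Positions k,
    transProb p q Set.univ t A.1 B.1 * initialCorr (p / q) μ η₀ B.1

/-- `∑_{k=0}^n (τ^n - 1) ⋯ (τ^{n-k+1} - 1) c_k`. -/
noncomputable def dualitySum (τ : ℝ) (n : ℕ) (c : ℕ → ℝ) : ℝ :=
  ∑ k ∈ Finset.range (n + 1), (∏ j ∈ Finset.range k, (τ ^ (n - j) - 1)) * c k

end ASEP

namespace ASEP

/-! ### The backward generator on functions of finite particle configurations -/

/-! Write 𝓛 for the generator and let D be the operator (Df)(η) = ∑_{A ⊆ η} f(A) ∏_{a ∈ A} τ^#{y ∈ η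
: y < a}, whose kernel is ∏_{a ∈ A} Q̃_a(η). Because qτ = p, D commutes with 𝓛 on every Λ; this is
checked bond by bond (`bondOp_dual`, `backward_dual`). A q-binomial expansion writes Q_x^n as Df
with f(A) = ∏_{j < |A|} (τ^(n-j) - 1) for A ⊆ (-∞, x] (`dual_momentKernel`). Formally ⟨Q_x^n⟩_t = ⟨D
e^{t𝓛} f⟩_0, and e^{t𝓛} f(B) = ∑_A f(A) G(A; t | B; 0); sorting by the conserved number k = |A|
gives the formula.

The exponential is handled as a power series. On functions of at most n particles 𝓛 has sup norm at
most 2n and enlarges the support by one site (`BoundedKernel.iterate_backward`), while D is bounded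
by exp(1/(1-τ)) however many particles η has (`abs_dual_le`). The Taylor coefficients are thus
O((2n)^k), uniformly in the box. In a box the moment equals its Taylor series (`boxMoment_eq_tsum`).
On ℤ only the martingale problem is available: Dynkin's formula for a function of the box differs
from the reflecting evolution by a term at the left boundary, where particles are rare because
reaching a site at distance k costs t^k/k! (`IsASEP.setIntegral_occ_le`). A Taylor expansion of
finite order with small errors shows that moment and box series become equal as L → ∞
(`IsASEP.tendsto_moment_sub_tsum`). The box series converge to the sum of the c_k by dominated
convergence (`tendsto_tsum_boxTaylor`); absolute convergence of c_k rests on `summable_triple`.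

For the current, a finite window almost surely changes only by nearest-neighbour exchanges
(`IsASEP.ae_isExchange`), and far to the left there is a site a that stays empty up to time t. The
number of particles in [a, x] then changes only through the bond between x and x + 1, which is
conservation of particles (`current_eq_countIcc`). -/

/-- The generator of the exclusion process on `Λ`, acting on functions of the finite set of
occupied sites: the transpose of `-H`. -/
noncomputable def backward (p q : ℝ) (Λ : Set ℤ) (f : Finset ℤ → ℝ) (A : Finset ℤ) : ℝ :=
  open Classical in
  ∑ x ∈ A,
    ((if x ∈ Λ ∧ x + 1 ∈ Λ ∧ x + 1 ∉ A then
        p * (f (insert (x + 1) (A.erase x)) - f A) else 0) +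
     (if x ∈ Λ ∧ x - 1 ∈ Λ ∧ x - 1 ∉ A then
        q * (f (insert (x - 1) (A.erase x)) - f A) else 0))

theorem linearCombination_rateMatrixBasis (p q : ℝ) (Λ : Set ℤ) (f : Finset ℤ → ℝ)
    (A : Finset ℤ) :
    Finsupp.linearCombination ℝ f (rateMatrixBasis p q Λ A) = -backward p q Λ f A := by
  classical
  unfold rateMatrixBasis backward
  rw [map_neg, map_sum]
  congr 1
  refine Finset.sum_congr rfl fun x _ => ?_
  rw [map_add]
  congr 1 <;> split_ifs <;> simp [Finsupp.linearCombination_single]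

theorem linearCombination_comp_rateMatrix (p q : ℝ) (Λ : Set ℤ) (f : Finset ℤ → ℝ) :
    Finsupp.linearCombination ℝ f ∘ₗ rateMatrix p q Λ =
      -Finsupp.linearCombination ℝ (backward p q Λ f) := by
  ext A
  simp [rateMatrix, Finsupp.linearCombination_single, linearCombination_rateMatrixBasis]

theorem linearCombination_rateMatrix_pow (p q : ℝ) (Λ : Set ℤ) (m : ℕ) (f : Finset ℤ → ℝ)
    (v : Finset ℤ →₀ ℝ) :
    Finsupp.linearCombination ℝ f ((rateMatrix p q Λ ^ m) v) =
      (-1) ^ m * Finsupp.linearCombination ℝ ((backward p q Λ)^[m] f) v := by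
  induction m generalizing f with
  | zero => simp
  | succ m ih =>
    have h := LinearMap.congr_fun (linearCombination_comp_rateMatrix p q Λ f)
      ((rateMatrix p q Λ ^ m) v)
    simp only [LinearMap.comp_apply, LinearMap.neg_apply] at h
    rw [pow_succ', Module.End.mul_apply, h, ih, Function.iterate_succ_apply]
    ring

theorem linearCombination_rateMatrix_pow_single (p q : ℝ) (Λ : Set ℤ) (m : ℕ)
    (f : Finset ℤ → ℝ) (B : Finset ℤ) :
    Finsupp.linearCombination ℝ f ((rateMatrix p q Λ ^ m) (Finsupp.single B 1)) =
      (-1) ^ m * (backward p q Λ)^[m] f B := by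
  rw [linearCombination_rateMatrix_pow, Finsupp.linearCombination_single, one_smul]

/-- The contribution of the bond between `x` and `x + 1` to the generator. -/
noncomputable def bondOp (p q : ℝ) (x : ℤ) (f : Finset ℤ → ℝ) (A : Finset ℤ) : ℝ :=
  (if x ∈ A ∧ x + 1 ∉ A then p * (f (insert (x + 1) (A.erase x)) - f A) else 0) +
  (if x ∉ A ∧ x + 1 ∈ A then q * (f (insert x (A.erase (x + 1))) - f A) else 0)

-- Regrouping by bonds instead of particles: a hop to the left from x + 1 belongs to the bond at x.
-- The set S may be larger than necessary, so that one S can serve a configuration and all its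
-- subsets.
open Classical in
theorem backward_eq_sum_bondOp (p q : ℝ) (Λ : Set ℤ) (f : Finset ℤ → ℝ) (A S : Finset ℤ)
    (hS : ∀ a ∈ A, a ∈ S ∧ a - 1 ∈ S) :
    backward p q Λ f A = ∑ x ∈ S, if x ∈ Λ ∧ x + 1 ∈ Λ then bondOp p q x f A else 0 := by
  have h1 : ∀ x, (if x ∈ Λ ∧ x + 1 ∈ Λ then bondOp p q x f A else 0) =
      (if x ∈ A then if x ∈ Λ ∧ x + 1 ∈ Λ ∧ x + 1 ∉ A then
        p * (f (insert (x + 1) (A.erase x)) - f A) else 0 else 0) +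
      (if x + 1 ∈ A then if x + 1 ∈ Λ ∧ x ∈ Λ ∧ x ∉ A then
        q * (f (insert x (A.erase (x + 1))) - f A) else 0 else 0) := by
    intro x
    unfold bondOp
    by_cases a1 : x ∈ Λ <;> by_cases a2 : x + 1 ∈ Λ <;> by_cases a3 : x ∈ A <;>
      by_cases a4 : x + 1 ∈ A <;> simp [a1, a2, a3, a4]
  simp only [h1, Finset.sum_add_distrib, backward]
  congr 1
  · symm
    rw [← Finset.sum_filter]
    refine Finset.sum_congr ?_ fun _ _ => rfl
    ext x
    simp only [Finset.mem_filter]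
    exact ⟨fun h => h.2, fun h => ⟨(hS x h).1, h⟩⟩
  · symm
    rw [← Finset.sum_filter]
    refine Finset.sum_bij' (fun x _ => x + 1) (fun x _ => x - 1) ?_ ?_ ?_ ?_ ?_
    · intro a ha
      exact (Finset.mem_filter.1 ha).2
    · intro a ha
      simp [(hS a ha).2, ha]
    · intros; ring
    · intros; ring
    · intro a ha
      simp

/-! ### The duality operator -/

/-- The weight `∏_{a ∈ A} τ ^ #{y ∈ η | y < a}`. -/
noncomputable def weight (τ : ℝ) (η A : Finset ℤ) : ℝ :=
  ∏ a ∈ A, τ ^ (η.filter (· < a)).card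

/-- The duality operator, with kernel `∏_{a ∈ A} Q̃_a(η)`. -/
noncomputable def dual (τ : ℝ) (f : Finset ℤ → ℝ) (η : Finset ℤ) : ℝ :=
  ∑ A ∈ η.powerset, f A * weight τ η A

theorem dual_zero (τ : ℝ) (η : Finset ℤ) : dual τ (fun _ => 0) η = 0 := by
  simp [dual]

theorem dual_sum {ι : Type*} (τ : ℝ) (S : Finset ι) (F : ι → Finset ℤ → ℝ) (η : Finset ℤ) :
    dual τ (fun A => ∑ i ∈ S, F i A) η = ∑ i ∈ S, dual τ (F i) η := by
  simp only [dual, Finset.sum_mul]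
  exact Finset.sum_comm

theorem dual_insert (τ : ℝ) (f : Finset ℤ → ℝ) {x : ℤ} {η : Finset ℤ} (hx : x ∉ η) :
    dual τ f (insert x η) = ∑ A ∈ η.powerset, (f A * weight τ (insert x η) A +
      f (insert x A) * weight τ (insert x η) (insert x A)) := by
  rw [dual, Finset.sum_powerset_insert hx, Finset.sum_add_distrib]

theorem weight_insert (τ : ℝ) (η : Finset ℤ) {x : ℤ} {A : Finset ℤ} (hx : x ∉ A) :
    weight τ η (insert x A) = τ ^ (η.filter (· < x)).card * weight τ η A := by
  rw [weight, Finset.prod_insert hx, weight]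

/-- The sites of A lie off the bond, so each of them has both ends of the bond on the same side and
does not notice a hop across it. -/
theorem weight_insert_left_congr (τ : ℝ) {x : ℤ} {η A : Finset ℤ} (h0 : x ∉ η)
    (h1 : x + 1 ∉ η) (hA : A ⊆ η) :
    weight τ (insert (x + 1) η) A = weight τ (insert x η) A := by
  refine Finset.prod_congr rfl fun a ha => ?_
  have ha1 : a ≠ x := fun h => h0 (h ▸ hA ha)
  have ha2 : a ≠ x + 1 := fun h => h1 (h ▸ hA ha)
  congr 1
  rw [Finset.filter_insert, Finset.filter_insert]
  by_cases hxa : x < a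
  · have : x + 1 < a := by omega
    rw [if_pos this, if_pos hxa, Finset.card_insert_of_notMem (by simp [h1]),
      Finset.card_insert_of_notMem (by simp [h0])]
  · have : ¬ x + 1 < a := by omega
    rw [if_neg this, if_neg hxa]

theorem filter_lt_succ {x : ℤ} {η : Finset ℤ} (h0 : x ∉ η) :
    η.filter (· < x + 1) = η.filter (· < x) := by
  ext a
  simp only [Finset.mem_filter]
  refine ⟨fun h => ⟨h.1, ?_⟩, fun h => ⟨h.1, by omega⟩⟩
  have : a ≠ x := fun e => h0 (e ▸ h.1)
  omega

theorem bondOp_of_notMem_notMem (p q : ℝ) {x : ℤ} (f : Finset ℤ → ℝ) {A : Finset ℤ}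
    (h0 : x ∉ A) (h1 : x + 1 ∉ A) : bondOp p q x f A = 0 := by
  simp [bondOp, h0, h1]

theorem bondOp_insert_left (p q : ℝ) {x : ℤ} (f : Finset ℤ → ℝ) {A : Finset ℤ}
    (h0 : x ∉ A) (h1 : x + 1 ∉ A) :
    bondOp p q x f (insert x A) = p * (f (insert (x + 1) A) - f (insert x A)) := by
  simp [bondOp, h0, h1]

theorem bondOp_insert_right (p q : ℝ) {x : ℤ} (f : Finset ℤ → ℝ) {A : Finset ℤ}
    (h0 : x ∉ A) (h1 : x + 1 ∉ A) :
    bondOp p q x f (insert (x + 1) A) = q * (f (insert x A) - f (insert (x + 1) A)) := by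
  simp [bondOp, h0, h1]

theorem bondOp_of_mem_mem (p q : ℝ) {x : ℤ} (f : Finset ℤ → ℝ) {A : Finset ℤ}
    (h0 : x ∈ A) (h1 : x + 1 ∈ A) : bondOp p q x f A = 0 := by
  simp [bondOp, h0, h1]

/-- Self-duality of the exclusion process, for a single bond. -/
theorem bondOp_dual {p q τ : ℝ} (hτ : q * τ = p) (x : ℤ) (f : Finset ℤ → ℝ) (η : Finset ℤ) :
    bondOp p q x (dual τ f) η = dual τ (bondOp p q x f) η := by
  by_cases h0 : x ∈ η <;> by_cases h1 : x + 1 ∈ η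
  · obtain ⟨ζ, hζ0, hζ1, rfl⟩ : ∃ ζ : Finset ℤ, x ∉ ζ ∧ x + 1 ∉ ζ ∧
        η = insert (x + 1) (insert x ζ) := by
      refine ⟨(η.erase (x + 1)).erase x, by simp, by simp, ?_⟩
      rw [Finset.insert_erase (by simp [h0]), Finset.insert_erase h1]
    have hx1 : x + 1 ∉ insert x ζ := by simp [hζ1]
    rw [bondOp_of_mem_mem p q _ h0 h1, dual_insert _ _ hx1, Finset.sum_powerset_insert hζ0,
      ← Finset.sum_add_distrib]
    refine (Finset.sum_eq_zero fun A hA => ?_).symm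
    rw [Finset.mem_powerset] at hA
    have hA0 : x ∉ A := fun h => hζ0 (hA h)
    have hA1 : x + 1 ∉ A := fun h => hζ1 (hA h)
    -- With both ends occupied nothing can move in η, but A may use just one end. The two such terms
    -- carry opposite differences of f, with rates q and p and weights differing by a factor τ; they
    -- cancel because qτ = p. Only this case uses the relation.
    rw [bondOp_of_notMem_notMem p q f hA0 hA1, bondOp_insert_right p q f hA0 hA1,
      bondOp_insert_left p q f hA0 hA1, bondOp_of_mem_mem p q f (by simp) (by simp),
      weight_insert _ _ hA0, weight_insert _ _ hA1, Finset.filter_insert, if_neg (lt_irrefl _),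
      Finset.filter_insert, if_pos (by omega), filter_lt_succ hζ0, Finset.filter_insert,
      if_neg (by omega), Finset.filter_insert, if_neg (lt_irrefl _),
      Finset.card_insert_of_notMem (by simp), pow_succ, ← hτ]
    ring
  · obtain ⟨ζ, hζ0, hζ1, rfl⟩ : ∃ ζ : Finset ℤ, x ∉ ζ ∧ x + 1 ∉ ζ ∧ η = insert x ζ :=
      ⟨η.erase x, by simp, by simp [h1], (Finset.insert_erase h0).symm⟩
    rw [bondOp_insert_left p q _ hζ0 hζ1, dual_insert _ _ hζ1, dual_insert _ _ hζ0,
      dual_insert _ _ hζ0, ← Finset.sum_sub_distrib, Finset.mul_sum]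
    refine Finset.sum_congr rfl fun A hA => ?_
    rw [Finset.mem_powerset] at hA
    have hA0 : x ∉ A := fun h => hζ0 (hA h)
    have hA1 : x + 1 ∉ A := fun h => hζ1 (hA h)
    rw [bondOp_of_notMem_notMem p q f hA0 hA1, bondOp_insert_left p q f hA0 hA1,
      weight_insert _ _ hA0, weight_insert _ _ hA1, weight_insert_left_congr τ hζ0 hζ1 hA,
      Finset.filter_insert, if_neg (lt_irrefl _), Finset.filter_insert, if_neg (lt_irrefl _),
      filter_lt_succ hζ0]
    ring
  · obtain ⟨ζ, hζ0, hζ1, rfl⟩ : ∃ ζ : Finset ℤ, x ∉ ζ ∧ x + 1 ∉ ζ ∧ η = insert (x + 1) ζ :=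
      ⟨η.erase (x + 1), by simp [h0], by simp, (Finset.insert_erase h1).symm⟩
    rw [bondOp_insert_right p q _ hζ0 hζ1, dual_insert _ _ hζ1, dual_insert _ _ hζ0,
      dual_insert _ _ hζ1, ← Finset.sum_sub_distrib, Finset.mul_sum]
    refine Finset.sum_congr rfl fun A hA => ?_
    rw [Finset.mem_powerset] at hA
    have hA0 : x ∉ A := fun h => hζ0 (hA h)
    have hA1 : x + 1 ∉ A := fun h => hζ1 (hA h)
    rw [bondOp_of_notMem_notMem p q f hA0 hA1, bondOp_insert_right p q f hA0 hA1,
      weight_insert _ _ hA0, weight_insert _ _ hA1, weight_insert_left_congr τ hζ0 hζ1 hA,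
      Finset.filter_insert, if_neg (lt_irrefl _), Finset.filter_insert, if_neg (lt_irrefl _),
      filter_lt_succ hζ0]
    ring
  · rw [bondOp_of_notMem_notMem p q _ h0 h1, dual]
    refine (Finset.sum_eq_zero fun A hA => ?_).symm
    rw [Finset.mem_powerset] at hA
    rw [bondOp_of_notMem_notMem p q f (fun h => h0 (hA h)) (fun h => h1 (hA h)), zero_mul]

theorem backward_dual {p q τ : ℝ} (hτ : q * τ = p) (Λ : Set ℤ) (f : Finset ℤ → ℝ) :
    backward p q Λ (dual τ f) = dual τ (backward p q Λ f) := by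
  classical
  funext η
  -- These are the bonds touching η; every A ⊆ η is covered as well, so both sides become sums over
  -- the same bonds.
  set S : Finset ℤ := η ∪ η.image (· - 1) with hSdef
  have hS : ∀ a ∈ η, a ∈ S ∧ a - 1 ∈ S := fun a ha =>
    ⟨Finset.mem_union_left _ ha, Finset.mem_union_right _ (Finset.mem_image_of_mem _ ha)⟩
  rw [backward_eq_sum_bondOp p q Λ _ η S hS]
  have h2 : dual τ (backward p q Λ f) η =
      dual τ (fun A => ∑ x ∈ S, if x ∈ Λ ∧ x + 1 ∈ Λ then bondOp p q x f A else 0) η := by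
    refine Finset.sum_congr rfl fun A hA => ?_
    rw [backward_eq_sum_bondOp p q Λ _ A S fun a ha => hS a (Finset.mem_powerset.1 hA ha)]
  rw [h2, dual_sum]
  refine Finset.sum_congr rfl fun x _ => ?_
  split_ifs
  · exact bondOp_dual hτ x f η
  · exact (dual_zero τ η).symm

theorem iterate_backward_dual {p q τ : ℝ} (hτ : q * τ = p) (Λ : Set ℤ) (m : ℕ)
    (f : Finset ℤ → ℝ) :
    (backward p q Λ)^[m] (dual τ f) = dual τ ((backward p q Λ)^[m] f) := by
  induction m generalizing f with
  | zero => rfl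
  | succ m ih => rw [Function.iterate_succ_apply, Function.iterate_succ_apply,
      backward_dual hτ, ih]

/-! ### The moment identity and bounds for the duality operator -/

theorem weight_insert_of_lt (τ : ℝ) {M : ℤ} {η A : Finset ℤ} (hM : ∀ a ∈ η, a < M)
    (hA : A ⊆ η) : weight τ (insert M η) A = weight τ η A := by
  refine Finset.prod_congr rfl fun a ha => ?_
  rw [Finset.filter_insert, if_neg (not_lt.2 (hM a (hA ha)).le)]

theorem filter_lt_insert_self {M : ℤ} {η : Finset ℤ} (hM : ∀ a ∈ η, a < M) :
    (insert M η).filter (· < M) = η := by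
  rw [Finset.filter_insert, if_neg (lt_irrefl _)]
  exact Finset.filter_true_of_mem hM

theorem prod_pow_sub_one_succ (τ : ℝ) (n k : ℕ) :
    ∏ j ∈ Finset.range (k + 1), (τ ^ (n - j) - 1) =
      (τ ^ n - 1) * ∏ j ∈ Finset.range k, (τ ^ (n - 1 - j) - 1) := by
  rw [Finset.prod_range_succ', mul_comm]
  simp only [Nat.sub_zero]
  congr 1
  refine Finset.prod_congr rfl fun j _ => ?_
  rw [Nat.sub_sub, add_comm 1 j]

/-- The `q`-binomial expansion of `τ ^ (n |η|)`. -/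
theorem sum_prod_mul_weight (τ : ℝ) (η : Finset ℤ) (n : ℕ) :
    dual τ (fun A => ∏ j ∈ Finset.range A.card, (τ ^ (n - j) - 1)) η = (τ ^ η.card) ^ n := by
  induction η using Finset.induction_on_max generalizing n with
  | empty => simp [dual, weight]
  | insert M η hM ih =>
    have hMη : M ∉ η := fun h => lt_irrefl _ (hM M h)
    -- The rightmost particle M does not affect the weights of the others, and its own weight is
    -- τ^|η|. Peeling off its factor τ^n - 1 leaves the product for n - 1.
    have hterm : ∀ A ∈ η.powerset,
        (∏ j ∈ Finset.range A.card, (τ ^ (n - j) - 1)) * weight τ (insert M η) A +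
          (∏ j ∈ Finset.range (insert M A).card, (τ ^ (n - j) - 1)) *
            weight τ (insert M η) (insert M A) =
        (∏ j ∈ Finset.range A.card, (τ ^ (n - j) - 1)) * weight τ η A +
          (τ ^ n - 1) * τ ^ η.card *
            ((∏ j ∈ Finset.range A.card, (τ ^ (n - 1 - j) - 1)) * weight τ η A) := by
      intro A hA
      rw [Finset.mem_powerset] at hA
      have hMA : M ∉ A := fun h => hMη (hA h)
      rw [weight_insert _ _ hMA, weight_insert_of_lt τ hM hA, filter_lt_insert_self hM,
        Finset.card_insert_of_notMem hMA, prod_pow_sub_one_succ]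
      ring
    rw [dual_insert _ _ hMη, Finset.sum_congr rfl hterm, Finset.sum_add_distrib,
      ← Finset.mul_sum]
    have h1 := ih n
    have h2 := ih (n - 1)
    unfold dual at h1 h2
    rw [h1, h2, Finset.card_insert_of_notMem hMη]
    -- For n = 0 the truncated n - 1 is harmless, because it is multiplied by τ^0 - 1 = 0.
    cases n with
    | zero => simp
    | succ n => simp only [Nat.add_sub_cancel]; ring

/-- The kernel of the `n`-th moment of `Q_x`. -/
noncomputable def momentKernel (τ : ℝ) (n : ℕ) (x : ℤ) (A : Finset ℤ) : ℝ :=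
  if ∀ a ∈ A, a ≤ x then ∏ j ∈ Finset.range A.card, (τ ^ (n - j) - 1) else 0

/-- Bounded functions of at most `n` particles located in `(-∞, z]`. -/
structure BoundedKernel (c : ℝ) (n : ℕ) (z : ℤ) (f : Finset ℤ → ℝ) : Prop where
  abs_le : ∀ A, |f A| ≤ c
  eq_zero_of_card : ∀ A : Finset ℤ, n < A.card → f A = 0
  eq_zero_of_lt : ∀ A : Finset ℤ, ∀ a ∈ A, z < a → f A = 0

/-- The weight of a site looks only to its left, so particles to the right of the support of f are
invisible. This makes the right boundary of a box irrelevant. -/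
theorem dual_filter_le {τ : ℝ} {f : Finset ℤ → ℝ} {z z' : ℤ}
    (hf : ∀ A : Finset ℤ, ∀ a ∈ A, z < a → f A = 0) (hz : z ≤ z') (η : Finset ℤ) :
    dual τ f (η.filter (· ≤ z')) = dual τ f η := by
  unfold dual
  rw [← Finset.sum_subset (Finset.powerset_mono.2 (Finset.filter_subset (· ≤ z') η))]
  · refine Finset.sum_congr rfl fun A hA => ?_
    rw [Finset.mem_powerset] at hA
    congr 1
    refine Finset.prod_congr rfl fun a ha => ?_
    have haz : a ≤ z' := (Finset.mem_filter.1 (hA ha)).2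
    congr 2
    ext y
    simp only [Finset.mem_filter]
    exact ⟨fun h => ⟨h.1.1, h.2⟩, fun h => ⟨⟨h.1, by omega⟩, h.2⟩⟩
  · intro A hA hA'
    rw [Finset.mem_powerset] at hA hA'
    obtain ⟨a, ha, ha'⟩ := Finset.not_subset.1 hA'
    have : z < a := by
      by_contra h
      exact ha' (Finset.mem_filter.2 ⟨hA ha, by omega⟩)
    rw [hf A a ha this, zero_mul]

theorem dual_momentKernel (τ : ℝ) (n : ℕ) (x : ℤ) (η : Finset ℤ) :
    dual τ (momentKernel τ n x) η = (τ ^ (η.filter (· ≤ x)).card) ^ n := by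
  rw [← dual_filter_le (z := x) (z' := x) _ le_rfl, ← sum_prod_mul_weight]
  · refine Finset.sum_congr rfl fun A hA => ?_
    rw [momentKernel, if_pos]
    exact fun a ha => (Finset.mem_filter.1 (Finset.mem_powerset.1 hA ha)).2
  · intro A a ha hx
    exact if_neg fun h => absurd (h a ha) (not_le.2 hx)

theorem prod_pow_sub_one_eq_zero (τ : ℝ) {n k : ℕ} (h : n < k) :
    ∏ j ∈ Finset.range k, (τ ^ (n - j) - 1) = 0 :=
  Finset.prod_eq_zero (Finset.mem_range.2 h) (by simp)

theorem abs_prod_pow_sub_one_le {τ : ℝ} (h0 : 0 ≤ τ) (h1 : τ ≤ 1) (n k : ℕ) :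
    |∏ j ∈ Finset.range k, (τ ^ (n - j) - 1)| ≤ 1 := by
  rw [Finset.abs_prod]
  refine Finset.prod_le_one (fun _ _ => abs_nonneg _) fun j _ => ?_
  rw [abs_le]
  have := pow_nonneg h0 (n - j)
  have := pow_le_one₀ (n := n - j) h0 h1
  constructor <;> linarith

theorem momentKernel_boundedKernel {τ : ℝ} (h0 : 0 ≤ τ) (h1 : τ ≤ 1) (n : ℕ) (x : ℤ) :
    BoundedKernel 1 n x (momentKernel τ n x) where
  abs_le A := by
    unfold momentKernel
    split_ifs
    · exact abs_prod_pow_sub_one_le h0 h1 _ _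
    · simp
  eq_zero_of_card A hA := by
    rw [momentKernel, prod_pow_sub_one_eq_zero τ hA, ite_self]
  eq_zero_of_lt A a ha hx := if_neg fun h => absurd (h a ha) (not_le.2 hx)

/-! ### Growth of kernels under the generator -/

/-- Each of at most n particles hops at total rate at most p + q = 1, and a hop changes f by at most
2c. Hops preserve the number of particles and have length one, so the support extends by one site.
-/
theorem BoundedKernel.backward {p q : ℝ} (hp : 0 ≤ p) (hq : 0 ≤ q) (hsum : p + q = 1)
    {c : ℝ} {n : ℕ} {z : ℤ} {f : Finset ℤ → ℝ} (hf : BoundedKernel c n z f) (Λ : Set ℤ) :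
    BoundedKernel (2 * n * c) n (z + 1) (backward p q Λ f) := by
  classical
  have hc : 0 ≤ c := (abs_nonneg _).trans (hf.abs_le ∅)
  have hcard1 : ∀ (A : Finset ℤ) (x y : ℤ), x ∈ A → y ∉ A →
      (insert y (A.erase x)).card = A.card := by
    intro A x y hx hy
    rw [Finset.card_insert_of_notMem (by simp [hy]), Finset.card_erase_of_mem hx]
    have := Finset.card_pos.2 ⟨x, hx⟩
    omega
  have hcard : ∀ A : Finset ℤ, n < A.card → ASEP.backward p q Λ f A = 0 := by
    intro A hA
    refine Finset.sum_eq_zero fun x hx => ?_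
    have e0 := hf.eq_zero_of_card A hA
    have e1 : x + 1 ∉ A → f (insert (x + 1) (A.erase x)) = 0 := fun h =>
      hf.eq_zero_of_card _ (by rwa [hcard1 A x _ hx h])
    have e2 : x - 1 ∉ A → f (insert (x - 1) (A.erase x)) = 0 := fun h =>
      hf.eq_zero_of_card _ (by rwa [hcard1 A x _ hx h])
    split_ifs with h1 h2 h2 <;> simp [*]
  refine ⟨fun A => ?_, hcard, fun A a ha hz => ?_⟩
  · rcases lt_or_ge n A.card with h | h
    · rw [hcard A h, abs_zero]; positivity
    have hd : ∀ B, |f B - f A| ≤ 2 * c := fun B =>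
      (abs_sub _ _).trans (by linarith [hf.abs_le A, hf.abs_le B])
    calc |ASEP.backward p q Λ f A| ≤ ∑ x ∈ A, 2 * c := by
          refine (Finset.abs_sum_le_sum_abs _ _).trans (Finset.sum_le_sum fun x _ => ?_)
          refine (abs_add_le _ _).trans ?_
          have b1 : ∀ (P : Prop) [Decidable P] (r : ℝ) (B), 0 ≤ r →
              |if P then r * (f B - f A) else 0| ≤ r * (2 * c) := by
            intro P _ r B hr
            split_ifs
            · rw [abs_mul, abs_of_nonneg hr]
              exact mul_le_mul_of_nonneg_left (hd B) hr
            · rw [abs_zero]; positivity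
          calc _ ≤ p * (2 * c) + q * (2 * c) := add_le_add (b1 _ _ _ hp) (b1 _ _ _ hq)
            _ = 2 * c := by rw [← add_mul, hsum, one_mul]
      _ = A.card * (2 * c) := by simp
      _ ≤ n * (2 * c) := by gcongr
      _ = 2 * n * c := by ring
  · refine Finset.sum_eq_zero fun x hx => ?_
    have e0 := hf.eq_zero_of_lt A a ha (by omega)
    have e : ∀ y, (y = x + 1 ∨ y = x - 1) → f (insert y (A.erase x)) = 0 := by
      intro y hy
      -- If the particle at a > z + 1 is the one that hops, its new site is still beyond z;
      -- otherwise it stays at a.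
      by_cases hax : a = x
      · exact hf.eq_zero_of_lt _ y (by simp) (by omega)
      · exact hf.eq_zero_of_lt _ a (by simp [hax, ha]) (by omega)
    simp [e0, e]

theorem BoundedKernel.iterate_backward {p q : ℝ} (hp : 0 ≤ p) (hq : 0 ≤ q) (hsum : p + q = 1)
    {c : ℝ} {n : ℕ} {z : ℤ} {f : Finset ℤ → ℝ} (hf : BoundedKernel c n z f) (Λ : Set ℤ) (m : ℕ) :
    BoundedKernel ((2 * n) ^ m * c) n (z + m) ((ASEP.backward p q Λ)^[m] f) := by
  induction m with
  | zero => simpa using hf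
  | succ m ih =>
    rw [Function.iterate_succ_apply']
    convert ih.backward hp hq hsum Λ using 1
    · ring
    · push_cast; ring

/-! ### Bounds on the duality operator, uniform in the configuration -/

theorem sum_pow_card_filter_lt (τ : ℝ) (η : Finset ℤ) :
    ∑ a ∈ η, τ ^ (η.filter (· < a)).card = ∑ i ∈ Finset.range η.card, τ ^ i := by
  induction η using Finset.induction_on_max with
  | empty => simp
  | insert M η hM ih =>
    have hMη : M ∉ η := fun h => lt_irrefl _ (hM M h)
    rw [Finset.sum_insert hMη, filter_lt_insert_self hM, Finset.card_insert_of_notMem hMη,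
      Finset.sum_range_succ, ← ih, add_comm]
    congr 1
    refine Finset.sum_congr rfl fun a ha => ?_
    rw [Finset.filter_insert, if_neg (not_lt.2 (hM a ha).le)]

theorem weight_nonneg {τ : ℝ} (h0 : 0 ≤ τ) (η A : Finset ℤ) : 0 ≤ weight τ η A :=
  Finset.prod_nonneg fun _ _ => pow_nonneg h0 _

/-- The sum over subsets factorises as the product of 1 + τ^i over 0 ≤ i < |η|, which stays bounded
as |η| grows because τ < 1. The asymmetry p < q is what makes D bounded on configurations of any
size. -/
theorem sum_weight_le {τ : ℝ} (h0 : 0 ≤ τ) (h1 : τ < 1) (η : Finset ℤ) :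
    ∑ A ∈ η.powerset, weight τ η A ≤ Real.exp (1 / (1 - τ)) := by
  have h : ∑ A ∈ η.powerset, weight τ η A = ∏ a ∈ η, (1 + τ ^ (η.filter (· < a)).card) :=
    (Finset.prod_one_add _).symm
  rw [h]
  calc ∏ a ∈ η, (1 + τ ^ (η.filter (· < a)).card)
      ≤ ∏ a ∈ η, Real.exp (τ ^ (η.filter (· < a)).card) :=
        Finset.prod_le_prod (fun a _ => by positivity) fun a _ => by
          rw [add_comm]; exact Real.add_one_le_exp _
    _ = Real.exp (∑ i ∈ Finset.range η.card, τ ^ i) := by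
        rw [← Real.exp_sum, sum_pow_card_filter_lt]
    _ ≤ Real.exp (1 / (1 - τ)) := by
        apply Real.exp_le_exp.2
        have h2 := mul_neg_geom_sum τ η.card
        have h3 : 0 < 1 - τ := by linarith
        rw [le_div_iff₀ h3, mul_comm, h2]
        linarith [pow_nonneg h0 η.card]

theorem abs_dual_le {τ : ℝ} (h0 : 0 ≤ τ) (h1 : τ < 1) {c : ℝ} {f : Finset ℤ → ℝ}
    (hf : ∀ A, |f A| ≤ c) (η : Finset ℤ) : |dual τ f η| ≤ c * Real.exp (1 / (1 - τ)) := by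
  have hc : 0 ≤ c := (abs_nonneg _).trans (hf ∅)
  calc |dual τ f η| ≤ ∑ A ∈ η.powerset, c * weight τ η A := by
        refine (Finset.abs_sum_le_sum_abs _ _).trans (Finset.sum_le_sum fun A _ => ?_)
        rw [abs_mul, abs_of_nonneg (weight_nonneg h0 η A)]
        exact mul_le_mul_of_nonneg_right (hf A) (weight_nonneg h0 η A)
    _ ≤ c * Real.exp (1 / (1 - τ)) := by
        rw [← Finset.mul_sum]
        exact mul_le_mul_of_nonneg_left (sum_weight_le h0 h1 η) hc

/-! ### The generators of the boxes converge locally -/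

theorem eventually_mem_box (x : ℤ) : ∀ᶠ L : ℕ in atTop, x ∈ box L := by
  filter_upwards [eventually_ge_atTop x.natAbs] with L hL
  rw [box, Finset.mem_Icc]
  omega

/-- The generator at A reads only A and its finitely many one-hop neighbours, so a large box looks
like ℤ. Letting F depend on L is what allows iteration. -/
theorem eventually_backward_box (p q : ℝ) {F : ℕ → Finset ℤ → ℝ} {G : Finset ℤ → ℝ}
    (h : ∀ A, ∀ᶠ L in atTop, F L A = G A) (A : Finset ℤ) :
    ∀ᶠ L : ℕ in atTop, backward p q (box L : Set ℤ) (F L) A = backward p q Set.univ G A := by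
  classical
  have : ∀ᶠ L : ℕ in atTop, ∀ x ∈ A, x ∈ box L ∧ x + 1 ∈ box L ∧ x - 1 ∈ box L ∧
      F L (insert (x + 1) (A.erase x)) = G (insert (x + 1) (A.erase x)) ∧
      F L (insert (x - 1) (A.erase x)) = G (insert (x - 1) (A.erase x)) := by
    rw [Filter.eventually_all_finset]
    intro x _
    filter_upwards [eventually_mem_box x, eventually_mem_box (x + 1), eventually_mem_box (x - 1),
      h (insert (x + 1) (A.erase x)), h (insert (x - 1) (A.erase x))] with L a b c d e
    exact ⟨a, b, c, d, e⟩
  filter_upwards [this, h A] with L hL hA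
  refine Finset.sum_congr rfl fun x hx => ?_
  obtain ⟨a, b, c, d, e⟩ := hL x hx
  simp [a, b, c, d, e, hA]

theorem eventually_iterate_backward_box (p q : ℝ) (f : Finset ℤ → ℝ) (m : ℕ) (A : Finset ℤ) :
    ∀ᶠ L : ℕ in atTop,
      (backward p q (box L : Set ℤ))^[m] f A = (backward p q Set.univ)^[m] f A := by
  induction m generalizing A with
  | zero => simp
  | succ m ih =>
    simp only [Function.iterate_succ_apply']
    exact eventually_backward_box p q ih A

/-! ### Cylinder functions and the generator -/

theorem DependsOn.exists_comp_restrict {β : Type*} {f : Config → β} {S : Finset ℤ}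
    (hf : DependsOn f (S : Set ℤ)) :
    ∃ g : (S → Bool) → β, ∀ η, f η = g (fun i => η i) := by
  classical
  refine ⟨fun v => f (fun y => if h : y ∈ S then v ⟨y, h⟩ else false), fun η => hf ?_⟩
  intro y hy
  rw [Finset.mem_coe] at hy
  simp [hy]

theorem DependsOn.measurable {f : Config → ℝ} {S : Finset ℤ} (hf : DependsOn f (S : Set ℤ)) :
    Measurable f := by
  obtain ⟨g, hg⟩ := DependsOn.exists_comp_restrict hf
  have : f = g ∘ fun η : Config => fun i : S => η i := funext hg
  rw [this]
  exact (measurable_of_finite g).comp (measurable_pi_lambda _ fun i => measurable_pi_apply _)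

theorem DependsOn.exists_bound {f : Config → ℝ} {S : Finset ℤ} (hf : DependsOn f (S : Set ℤ)) :
    ∃ C, ∀ η, |f η| ≤ C := by
  obtain ⟨g, hg⟩ := DependsOn.exists_comp_restrict hf
  obtain ⟨C, hC⟩ := (Set.finite_range fun v => |g v|).bddAbove
  exact ⟨C, fun η => by rw [hg]; exact hC ⟨_, rfl⟩⟩

/-- The left ends of the bonds with an end in `S`. -/
def bonds (S : Finset ℤ) : Finset ℤ := S ∪ S.image (· - 1)

theorem mem_bonds {S : Finset ℤ} {x : ℤ} : x ∈ bonds S ↔ x ∈ S ∨ x + 1 ∈ S := by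
  simp only [bonds, Finset.mem_union, Finset.mem_image]
  refine or_congr_right ⟨?_, fun h => ⟨x + 1, h, by ring⟩⟩
  rintro ⟨a, ha, rfl⟩
  simpa using ha

theorem exchange_apply_of_ne {x y : ℤ} (h0 : y ≠ x) (h1 : y ≠ x + 1) (η : Config) :
    exchange x η y = η y := by
  rw [exchange, Equiv.swap_apply_of_ne_of_ne h0 h1]

@[simp] theorem exchange_apply_left (x : ℤ) (η : Config) : exchange x η x = η (x + 1) := by
  rw [exchange, Equiv.swap_apply_left]

@[simp] theorem exchange_apply_right (x : ℤ) (η : Config) : exchange x η (x + 1) = η x := by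
  rw [exchange, Equiv.swap_apply_right]

theorem generator_eq_sum (p q : ℝ) {f : Config → ℝ} {S : Finset ℤ}
    (hf : DependsOn f (S : Set ℤ)) (η : Config) :
    generator p q f η = ∑ x ∈ bonds S, exchangeRate p q x η * (f (exchange x η) - f η) := by
  refine finsum_eq_sum_of_support_subset _ fun x hx => ?_
  by_contra hxS
  rw [Finset.mem_coe, mem_bonds, not_or] at hxS
  refine hx ?_
  have : f (exchange x η) = f η := by
    refine hf fun y hy => exchange_apply_of_ne ?_ ?_ η
    · rintro rfl; exact hxS.1 hy
    · rintro rfl; exact hxS.2 hy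
  simp [this]

theorem generator_dependsOn (p q : ℝ) {f : Config → ℝ} {S : Finset ℤ}
    (hf : DependsOn f (S : Set ℤ)) :
    ∃ T : Finset ℤ, DependsOn (generator p q f) (T : Set ℤ) := by
  refine ⟨bonds S ∪ (bonds S).image (· + 1) ∪ S, fun η ζ h => ?_⟩
  rw [generator_eq_sum p q hf, generator_eq_sum p q hf]
  refine Finset.sum_congr rfl fun x hx => ?_
  have e0 : η x = ζ x := h x (by simp [hx])
  have e1 : η (x + 1) = ζ (x + 1) := h (x + 1) (by simp [hx])
  have e2 : f η = f ζ := hf fun y hy => h y (by rw [Finset.mem_coe] at hy; simp [hy])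
  have e3 : f (exchange x η) = f (exchange x ζ) := by
    refine hf fun y hy => ?_
    by_cases h0 : y = x
    · subst h0; simpa using e1
    by_cases h1 : y = x + 1
    · subst h1; simpa using e0
    rw [exchange_apply_of_ne h0 h1, exchange_apply_of_ne h0 h1]
    exact h y (by rw [Finset.mem_coe] at hy; simp [hy])
  simp only [exchangeRate, e0, e1, e2, e3]

/-! ### Measurability of the paths and Dynkin's formula -/

section Trajectories

variable {Ω : Type*} {m : MeasurableSpace Ω} {μ : Measure Ω} {p q : ℝ}
  {ℱ : Filtration ℝ≥0 m} {η : ℝ≥0 → Ω → Config}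

theorem IsASEP.measurable (hη : IsASEP p q μ ℱ η) (t : ℝ≥0) : Measurable (η t) :=
  (hη.adapted t).mono (ℱ.le t) le_rfl

/-- Right continuity makes the path the limit of its values at the next point of the grid of mesh
1/(n + 1), and these approximations are constant in time between grid points. Joint measurability is
needed for Fubini in Dynkin's formula. -/
theorem IsASEP.measurable_uncurry (hη : IsASEP p q μ ℱ η) :
    Measurable fun z : ℝ≥0 × Ω => η z.1 z.2 := by
  let d : ℕ → ℝ≥0 → ℝ≥0 := fun n s => ((⌊(n + 1) * s⌋₊ : ℝ≥0) + 1) / (n + 1)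
  have hd1 : ∀ n s, s ≤ d n s := by
    intro n s
    rw [le_div_iff₀ (by positivity), mul_comm]
    exact (Nat.lt_floor_add_one _).le
  have hd2 : ∀ n s, d n s ≤ s + 1 / (n + 1) := by
    intro n s
    have h : (s + 1 / ((n : ℝ≥0) + 1)) * (n + 1) = (n + 1) * s + 1 := by field_simp
    rw [div_le_iff₀ (by positivity), h]
    gcongr
    exact Nat.floor_le (by positivity)
  refine measurable_of_tendsto_metrizable (f := fun n z => η (d n z.1) z.2) (fun n => ?_) ?_
  · have h1 : Measurable fun z : ℕ × Ω => η (((z.1 : ℝ≥0) + 1) / (n + 1)) z.2 :=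
      measurable_from_prod_countable_right fun k =>
        hη.measurable (((k : ℝ≥0) + 1) / (n + 1))
    have h2 : Measurable fun z : ℝ≥0 × Ω => ((⌊((n : ℝ≥0) + 1) * z.1⌋₊, z.2) : ℕ × Ω) := by
      fun_prop
    have h3 := h1.comp h2
    simp only [Function.comp_def] at h3
    exact h3
  · rw [tendsto_pi_nhds]
    rintro ⟨s, ω⟩
    have hc := hη.right_continuous ω s
    refine hc.tendsto.comp ?_
    rw [tendsto_nhdsWithin_iff]
    refine ⟨?_, Eventually.of_forall fun n => hd1 n s⟩
    refine tendsto_of_tendsto_of_tendsto_of_le_of_le tendsto_const_nhds ?_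
      (fun n => hd1 n s) (fun n => hd2 n s)
    have : Tendsto (fun n : ℕ => 1 / ((n : ℝ≥0) + 1)) atTop (𝓝 0) :=
      tendsto_one_div_add_atTop_nhds_zero_nat
    simpa using this.const_add s

theorem IsASEP.measurable_uncurry_comp (hη : IsASEP p q μ ℱ η) {f : Config → ℝ}
    {S : Finset ℤ} (hf : DependsOn f (S : Set ℤ)) :
    Measurable fun z : ℝ × Ω => f (η z.1.toNNReal z.2) :=
  (DependsOn.measurable hf).comp (hη.measurable_uncurry.comp
    ((measurable_real_toNNReal.comp measurable_fst).prodMk measurable_snd))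

theorem IsASEP.integrable_comp [IsFiniteMeasure μ] (hη : IsASEP p q μ ℱ η) {f : Config → ℝ}
    {S : Finset ℤ} (hf : DependsOn f (S : Set ℤ)) (t : ℝ≥0) :
    Integrable (fun ω => f (η t ω)) μ := by
  obtain ⟨C, hC⟩ := DependsOn.exists_bound hf
  exact Integrable.of_bound ((DependsOn.measurable hf).comp (hη.measurable t)).aestronglyMeasurable
    C (Eventually.of_forall fun ω => hC _)

theorem IsASEP.intervalIntegrable_path (hη : IsASEP p q μ ℱ η) {f : Config → ℝ}
    {S : Finset ℤ} (hf : DependsOn f (S : Set ℤ)) (a b : ℝ) (ω : Ω) :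
    IntervalIntegrable (fun u => f (η u.toNNReal ω)) volume a b := by
  obtain ⟨C, hC⟩ := DependsOn.exists_bound hf
  refine (intervalIntegrable_const (c := C)).mono_fun ?_ (Eventually.of_forall fun u => ?_)
  · exact ((hη.measurable_uncurry_comp hf).comp measurable_prodMk_right).aestronglyMeasurable
  · simp only [Real.norm_eq_abs]
    exact (hC _).trans (le_abs_self C)

theorem IsASEP.intervalIntegrable_setIntegral [IsFiniteMeasure μ] (hη : IsASEP p q μ ℱ η)
    {f : Config → ℝ} {S : Finset ℤ} (hf : DependsOn f (S : Set ℤ)) (a b : ℝ) (F : Set Ω) :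
    IntervalIntegrable (fun u => ∫ ω in F, f (η u.toNNReal ω) ∂μ) volume a b := by
  obtain ⟨C, hC⟩ := DependsOn.exists_bound hf
  refine (intervalIntegrable_const (c := C * μ.real F)).mono_fun ?_
    (Eventually.of_forall fun u => ?_)
  · exact (hη.measurable_uncurry_comp hf).stronglyMeasurable.integral_prod_right'
      |>.aestronglyMeasurable
  · refine (norm_setIntegral_le_of_norm_le_const (measure_lt_top μ F) fun ω _ => hC _).trans ?_
    exact le_abs_self _

/-- Dynkin's formula. -/
theorem IsASEP.setIntegral_sub [IsFiniteMeasure μ] (hη : IsASEP p q μ ℱ η) {f : Config → ℝ}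
    {S : Finset ℤ} (hf : DependsOn f (S : Set ℤ)) {s t : ℝ≥0} (hst : s ≤ t) {F : Set Ω}
    (hF : MeasurableSet[ℱ s] F) :
    ∫ ω in F, f (η t ω) ∂μ - ∫ ω in F, f (η s ω) ∂μ =
      ∫ u in (s : ℝ)..t, ∫ ω in F, generator p q f (η u.toNNReal ω) ∂μ := by
  obtain ⟨T, hT⟩ := generator_dependsOn p q hf
  have hmart := (hη.martingale f S hf).setIntegral_eq hst hF
  have hi : ∀ r, Integrable (fun ω => f (η r ω)) (μ.restrict F) := fun r =>
    (hη.integrable_comp hf r).integrableOn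
  have hI : ∀ r : ℝ≥0, Integrable
      (fun ω => ∫ u in (0 : ℝ)..r, generator p q f (η u.toNNReal ω)) (μ.restrict F) := by
    intro r
    have h1 := ((hη.martingale f S hf).integrable r).integrableOn (s := F)
    refine (((hi r).sub (hi 0)).sub h1).congr (Eventually.of_forall fun ω => ?_)
    simp
  have hsplit : ∀ r : ℝ≥0, ∫ ω in F, (f (η r ω) - f (η 0 ω) -
      ∫ u in (0 : ℝ)..r, generator p q f (η u.toNNReal ω)) ∂μ =
      ∫ ω in F, f (η r ω) ∂μ - ∫ ω in F, f (η 0 ω) ∂μ -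
        ∫ ω in F, (∫ u in (0 : ℝ)..r, generator p q f (η u.toNNReal ω)) ∂μ := fun r => by
    rw [← integral_sub (hi r) (hi 0)]
    exact integral_sub ((hi r).sub (hi 0)) (hI r)
  rw [hsplit, hsplit] at hmart
  have h2 : ∫ ω in F, f (η t ω) ∂μ - ∫ ω in F, f (η s ω) ∂μ =
      ∫ ω in F, ((∫ u in (0 : ℝ)..t, generator p q f (η u.toNNReal ω)) -
        ∫ u in (0 : ℝ)..s, generator p q f (η u.toNNReal ω)) ∂μ := by
    rw [integral_sub (hI t) (hI s)]
    linarith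
  rw [h2, intervalIntegral_integral_swap]
  · refine integral_congr_ae (Eventually.of_forall fun ω => ?_)
    exact intervalIntegral.integral_interval_sub_left (hη.intervalIntegrable_path hT _ _ ω)
      (hη.intervalIntegrable_path hT _ _ ω)
  · obtain ⟨C, hC⟩ := DependsOn.exists_bound hT
    have : IsFiniteMeasure (volume.restrict (Set.uIoc (s : ℝ) t)) :=
      ⟨by rw [Measure.restrict_apply_univ, Set.uIoc]; exact measure_Ioc_lt_top⟩
    exact Integrable.of_bound (hη.measurable_uncurry_comp hT).aestronglyMeasurable
      C (Eventually.of_forall fun z => hC _)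

end Trajectories

section Trajectories

variable {Ω : Type*} {m : MeasurableSpace Ω} {μ : Measure Ω} {p q : ℝ}
  {ℱ : Filtration ℝ≥0 m} {η : ℝ≥0 → Ω → Config}

/-! ### Few particles far to the left -/

theorem occ_dependsOn (a : ℤ) : DependsOn (occ a) (({a} : Finset ℤ) : Set ℤ) := by
  intro η ζ h
  simp only [occ, h a (by simp)]

theorem occ_nonneg (a : ℤ) (η : Config) : 0 ≤ occ a η := by
  unfold occ; split_ifs <;> norm_num

theorem occ_le_one (a : ℤ) (η : Config) : occ a η ≤ 1 := by
  unfold occ; split_ifs <;> norm_num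

/-- Only the two bonds at a act on the occupation number; the loss terms and the exclusion
constraint are dropped. -/
theorem generator_occ_le (hp : 0 ≤ p) (hq : 0 ≤ q) (a : ℤ) (η : Config) :
    generator p q (occ a) η ≤ p * occ (a - 1) η + q * occ (a + 1) η := by
  have hb : bonds {a} = {a, a - 1} := by
    ext x
    simp only [mem_bonds, Finset.mem_singleton, Finset.mem_insert]
    omega
  have e1 : exchange (a - 1) η a = η (a - 1) := by
    have := exchange_apply_right (a - 1) η
    rwa [sub_add_cancel] at this
  rw [generator_eq_sum p q (occ_dependsOn a), hb, Finset.sum_pair (by omega)]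
  simp only [occ, exchangeRate, exchange_apply_left, e1, sub_add_cancel]
  cases η a <;> cases η (a - 1) <;> cases η (a + 1) <;> simp <;> linarith

/-- The site a is k steps away from the initially occupied region, and its neighbours at least k -
1. By `generator_occ_le` every step costs one time integration, and k of them turn the trivial bound
1 into t^k/k!. The event F localises to initial data with a deterministic left edge. -/
theorem IsASEP.setIntegral_occ_le [IsProbabilityMeasure μ] (hη : IsASEP p q μ ℱ η) (hp : 0 ≤ p) (hq : 0 ≤ q)
    (hsum : p + q = 1) {F : Set Ω} (hF : MeasurableSet[ℱ 0] F) {K : ℤ}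
    (hK : ∀ ω ∈ F, ∀ y < K, η 0 ω y = false) (k : ℕ) (a : ℤ) (ha : a + k ≤ K) (t : ℝ≥0) :
    ∫ ω in F, occ a (η t ω) ∂μ ≤ (t : ℝ) ^ k / k.factorial := by
  have hi : ∀ a r, Integrable (fun ω => occ a (η r ω)) (μ.restrict F) := fun a r =>
    (hη.integrable_comp (occ_dependsOn a) r).integrableOn
  induction k generalizing a t with
  | zero =>
    calc ∫ ω in F, occ a (η t ω) ∂μ ≤ ∫ ω in F, 1 ∂μ :=
          integral_mono (hi a t) (integrable_const _) fun ω => occ_le_one a _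
      _ = μ.real F := by simp
      _ ≤ _ := by simp
  | succ k ih =>
    push_cast at ha
    have h0 : ∫ ω in F, occ a (η 0 ω) ∂μ = 0 := by
      rw [setIntegral_congr_fun (g := fun _ => (0 : ℝ)) (ℱ.le 0 F hF)]
      · simp
      · intro ω hω
        simp [occ, hK ω hω a (by omega)]
    have hD := hη.setIntegral_sub (occ_dependsOn a) (zero_le : 0 ≤ t) hF
    rw [h0, sub_zero] at hD
    obtain ⟨T, hT⟩ := generator_dependsOn p q (occ_dependsOn a)
    rw [hD]
    calc ∫ u in ((0 : ℝ≥0) : ℝ)..t, ∫ ω in F, generator p q (occ a) (η u.toNNReal ω) ∂μ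
        ≤ ∫ u in ((0 : ℝ≥0) : ℝ)..t, u ^ k / k.factorial := by
          refine intervalIntegral.integral_mono_on t.2
            (hη.intervalIntegrable_setIntegral hT _ _ F)
            (Continuous.intervalIntegrable (by fun_prop) _ _) fun u hu => ?_
          have hu0 : 0 ≤ u := hu.1
          have i1 := ih (a - 1) (by omega) u.toNNReal
          have i2 := ih (a + 1) (by omega) u.toNNReal
          rw [Real.coe_toNNReal u hu0] at i1 i2
          calc ∫ ω in F, generator p q (occ a) (η u.toNNReal ω) ∂μ
              ≤ ∫ ω in F, (p * occ (a - 1) (η u.toNNReal ω) +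
                  q * occ (a + 1) (η u.toNNReal ω)) ∂μ :=
                integral_mono (hη.integrable_comp hT _).integrableOn
                  (((hi _ _).const_mul p).add ((hi _ _).const_mul q))
                  fun ω => generator_occ_le hp hq a _
            _ = p * ∫ ω in F, occ (a - 1) (η u.toNNReal ω) ∂μ +
                  q * ∫ ω in F, occ (a + 1) (η u.toNNReal ω) ∂μ := by
                rw [integral_add ((hi _ _).const_mul p) ((hi _ _).const_mul q),
                  integral_const_mul, integral_const_mul]
            _ ≤ p * (u ^ k / k.factorial) + q * (u ^ k / k.factorial) :=
                add_le_add (mul_le_mul_of_nonneg_left i1 hp) (mul_le_mul_of_nonneg_left i2 hq)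
            _ = u ^ k / k.factorial := by rw [← add_mul, hsum, one_mul]
      _ = (t : ℝ) ^ (k + 1) / (k + 1).factorial := by
          rw [intervalIntegral.integral_div, integral_pow, Nat.factorial_succ]
          push_cast
          rw [zero_pow (Nat.succ_ne_zero k), sub_zero]
          field_simp

/-- No particles to the left of `-K` at time `0`. -/
def emptyLeft (η₀ : Ω → Config) (K : ℕ) : Set Ω := {ω | ∀ y < -(K : ℤ), η₀ ω y = false}

theorem IsASEP.measurableSet_emptyLeft (hη : IsASEP p q μ ℱ η) (K : ℕ) :
    MeasurableSet[ℱ 0] (emptyLeft (η 0) K) := by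
  have : emptyLeft (η 0) K = ⋂ y : ℤ, ⋂ _ : y < -(K : ℤ), {ω | η 0 ω y = false} := by
    ext ω; simp [emptyLeft]
  rw [this]
  refine MeasurableSet.iInter fun y => MeasurableSet.iInter fun _ => ?_
  exact ((measurable_pi_apply y).comp (hη.adapted 0)) (measurableSet_singleton false)

theorem ae_exists_mem_emptyLeft {η₀ : Ω → Config}
    (h : ∀ᵐ ω ∂μ, ∃ a : ℤ, ∀ y < a, η₀ ω y = false) : ∀ᵐ ω ∂μ, ∃ K, ω ∈ emptyLeft η₀ K := by
  filter_upwards [h] with ω hω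
  obtain ⟨a, ha⟩ := hω
  exact ⟨a.natAbs, fun y hy => ha y (by omega)⟩

/-- Borel–Cantelli on each event of a fixed initial left edge, since ∑ t^k/k! converges. -/
theorem IsASEP.ae_exists_forall_lt [IsProbabilityMeasure μ] (hη : IsASEP p q μ ℱ η)
    (hp : 0 ≤ p) (hq : 0 ≤ q)
    (hsum : p + q = 1) (hleft : ∀ᵐ ω ∂μ, ∃ a : ℤ, ∀ y < a, η 0 ω y = false) (t : ℝ≥0) :
    ∀ᵐ ω ∂μ, ∃ a : ℤ, ∀ y < a, η t ω y = false := by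
  have key : ∀ K : ℕ, ∀ᵐ ω ∂μ, ω ∈ emptyLeft (η 0) K → ∃ a : ℤ, ∀ y < a, η t ω y = false := by
    intro K
    have hF := hη.measurableSet_emptyLeft K
    have hFm := ℱ.le 0 _ hF
    rw [← ae_restrict_iff' hFm]
    have hbound : ∀ k : ℕ, (μ.restrict (emptyLeft (η 0) K)) {ω | η t ω (-(K : ℤ) - k) = true} ≤
        ENNReal.ofReal ((t : ℝ) ^ k / k.factorial) := by
      intro k
      have h1 := hη.setIntegral_occ_le hp hq hsum hF (fun ω hω => hω) k (-(K : ℤ) - k)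
        (by omega) t
      have h2 : (fun ω => occ (-(K : ℤ) - k) (η t ω)) =
          Set.indicator {ω | η t ω (-(K : ℤ) - k) = true} 1 := by
        funext ω
        simp [occ, Set.indicator_apply]
      have hm : MeasurableSet {ω | η t ω (-(K : ℤ) - k) = true} :=
        ((measurable_pi_apply _).comp (hη.measurable t)) (measurableSet_singleton true)
      rw [h2, integral_indicator_one hm] at h1
      rw [← ofReal_measureReal]
      exact ENNReal.ofReal_le_ofReal h1
    have hsm := Real.summable_pow_div_factorial (t : ℝ)
    have hBC := measure_setOfPred_frequently_eq_zero
      (μ := μ.restrict (emptyLeft (η 0) K)) (p := fun (k : ℕ) ω => η t ω (-(K : ℤ) - k) = true)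
      (ne_top_of_le_ne_top hsm.tsum_ofReal_ne_top
        (ENNReal.tsum_le_tsum hbound))
    rw [← compl_mem_ae_iff] at hBC
    filter_upwards [hBC] with ω hω
    simp only [Set.mem_compl_iff, Set.mem_ofPred_eq, not_frequently, Bool.not_eq_true] at hω
    obtain ⟨N, hN⟩ := eventually_atTop.1 hω
    refine ⟨-(K : ℤ) - N, fun y hy => ?_⟩
    have := hN (-(K : ℤ) - y).toNat (by omega)
    rwa [show -(K : ℤ) - ((-(K : ℤ) - y).toNat : ℤ) = y by omega] at this
  filter_upwards [ae_exists_mem_emptyLeft hleft, ae_all_iff.2 key] with ω ⟨K, hK⟩ h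
  exact h K hK

/-- Up to probability ε/2 the initial left edge lies to the right of some -K, and on that event
T^k/k! ≤ ε/2 suffices for all sites k steps beyond it, at all times up to T. -/
theorem IsASEP.eventually_integral_occ_le [IsProbabilityMeasure μ] (hη : IsASEP p q μ ℱ η)
    (hp : 0 ≤ p) (hq : 0 ≤ q)
    (hsum : p + q = 1) (hleft : ∀ᵐ ω ∂μ, ∃ a : ℤ, ∀ y < a, η 0 ω y = false) (T : ℝ≥0)
    {ε : ℝ} (hε : 0 < ε) :
    ∀ᶠ a : ℤ in atBot, ∀ s ≤ T, ∫ ω, occ a (η s ω) ∂μ ≤ ε := by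
  have hmono : Monotone fun K => emptyLeft (η 0) K := by
    intro K K' h ω hω y hy
    exact hω y (by omega)
  have h1 : Tendsto (fun K => μ.real (emptyLeft (η 0) K)) atTop (𝓝 1) := by
    have := tendsto_measure_iUnion_atTop (μ := μ) hmono
    have hU : μ (⋃ K, emptyLeft (η 0) K) = 1 := by
      rw [prob_compl_eq_zero_iff₀ (MeasurableSet.iUnion fun K => ℱ.le 0 _
        (hη.measurableSet_emptyLeft K)).nullMeasurableSet |>.symm]
      have := ae_exists_mem_emptyLeft hleft
      rw [ae_iff] at this
      convert this using 2
      ext ω; simp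
    rw [hU] at this
    have := (ENNReal.tendsto_toReal (by simp)).comp this
    simpa [Function.comp_def, Measure.real] using this
  obtain ⟨K, hK⟩ := (h1.eventually (lt_mem_nhds (show 1 - ε / 2 < 1 by linarith))).exists
  obtain ⟨k, hk⟩ := ((FloorSemiring.tendsto_pow_div_factorial_atTop (T : ℝ)).eventually
    (gt_mem_nhds (show 0 < ε / 2 by linarith))).exists
  have hF := hη.measurableSet_emptyLeft K
  have hFm := ℱ.le 0 _ hF
  filter_upwards [eventually_le_atBot (-(K : ℤ) - k)] with a ha s hs
  have hi := hη.integrable_comp (occ_dependsOn a) s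
  rw [← integral_add_compl hFm hi]
  have b1 : ∫ ω in emptyLeft (η 0) K, occ a (η s ω) ∂μ ≤ ε / 2 := by
    refine (hη.setIntegral_occ_le hp hq hsum hF (fun ω hω => hω) k a (by omega) s).trans
      (le_trans ?_ hk.le)
    gcongr
  have b2 : ∫ ω in (emptyLeft (η 0) K)ᶜ, occ a (η s ω) ∂μ ≤ ε / 2 := by
    calc _ ≤ ∫ ω in (emptyLeft (η 0) K)ᶜ, 1 ∂μ :=
          integral_mono hi.integrableOn (integrable_const _) fun ω => occ_le_one a _
      _ = 1 - μ.real (emptyLeft (η 0) K) := by simp [probReal_compl_eq_one_sub hFm]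
      _ ≤ ε / 2 := by linarith
  linarith

end Trajectories

/-! ### Comparison with the generator of the box -/

theorem mem_box {L : ℕ} {y : ℤ} : y ∈ box L ↔ -(L : ℤ) ≤ y ∧ y ≤ L := by
  rw [box, Finset.mem_Icc]

theorem mem_restrict {L : ℕ} {η : Config} {y : ℤ} :
    y ∈ restrict L η ↔ y ∈ box L ∧ η y = true := by
  rw [restrict, Finset.mem_filter]

theorem restrict_subset (L : ℕ) (η : Config) : restrict L η ⊆ box L := Finset.filter_subset _ _

theorem comp_restrict_dependsOn {β : Type*} (g : Finset ℤ → β) (L : ℕ) :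
    DependsOn (fun η => g (restrict L η)) (box L : Set ℤ) := by
  intro η ζ h
  have : restrict L η = restrict L ζ := by
    ext y
    simp only [mem_restrict]
    refine and_congr_right fun hy => ?_
    rw [h y hy]
  simp only [this]

theorem exchangeRate_mul_sub_eq_bondOp (p q : ℝ) (g : Finset ℤ → ℝ) {L : ℕ} {x : ℤ}
    (h0 : x ∈ box L) (h1 : x + 1 ∈ box L) (η : Config) :
    exchangeRate p q x η * (g (restrict L (exchange x η)) - g (restrict L η)) =
      bondOp p q x g (restrict L η) := by
  have hmem : ∀ y, y ∈ restrict L (exchange x η) ↔ y ∈ box L ∧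
      (if y = x then η (x + 1) else if y = x + 1 then η x else η y) = true := by
    intro y
    rw [mem_restrict]
    refine and_congr_right fun _ => ?_
    split_ifs with e0 e1
    · rw [e0, exchange_apply_left]
    · rw [e1, exchange_apply_right]
    · rw [exchange_apply_of_ne e0 e1]
  unfold exchangeRate bondOp
  simp only [mem_restrict, h0, h1, true_and]
  rcases Bool.eq_false_or_eq_true (η x) with a | a <;>
    rcases Bool.eq_false_or_eq_true (η (x + 1)) with b | b <;> simp only [a, b]
  · simp
  · have : restrict L (exchange x η) = insert (x + 1) ((restrict L η).erase x) := by
      ext y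
      rw [hmem, Finset.mem_insert, Finset.mem_erase, mem_restrict]
      by_cases e0 : y = x
      · subst e0; simp [b]
      · by_cases e1 : y = x + 1
        · subst e1; simp [a, h1]
        · simp [e0, e1]
    simp [this]
  · have : restrict L (exchange x η) = insert x ((restrict L η).erase (x + 1)) := by
      ext y
      rw [hmem, Finset.mem_insert, Finset.mem_erase, mem_restrict]
      by_cases e0 : y = x
      · subst e0; simp [b, h0]
      · by_cases e1 : y = x + 1
        · subst e1; simp [a]
        · simp [e0, e1]
    simp [this]
  · simp

theorem exchangeRate_nonneg {p q : ℝ} (hp : 0 ≤ p) (hq : 0 ≤ q) (x : ℤ) (η : Config) :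
    0 ≤ exchangeRate p q x η := by
  unfold exchangeRate; split_ifs <;> first | assumption | exact le_rfl

theorem exchangeRate_le {p q : ℝ} (hp : p ≤ 1) (hq : q ≤ 1) (x : ℤ) (η : Config) :
    exchangeRate p q x η ≤ occ x η + occ (x + 1) η := by
  unfold exchangeRate occ
  cases η x <;> cases η (x + 1) <;> simp [hp, hq]

/-- Bonds inside the box contribute equally to both generators. The bond leaving the box on the
right changes only the site L > z, which g does not see. There remains the bond at the left edge,
which acts only if one of its ends is occupied. -/
theorem abs_generator_sub_backward_le {p q : ℝ} (hp : 0 ≤ p) (hq : 0 ≤ q) (hsum : p + q = 1)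
    {g : Finset ℤ → ℝ} {c : ℝ} (hc : ∀ A, |g A| ≤ c) {z : ℤ} {L : ℕ} (hz : z < L)
    (hg : ∀ A : Finset ℤ, g (A.filter (· ≤ z)) = g A) (η : Config) :
    |generator p q (fun η => g (restrict L η)) η - backward p q (box L : Set ℤ) g (restrict L η)| ≤
      2 * c * (occ (-(L : ℤ) - 1) η + occ (-(L : ℤ)) η) := by
  classical
  have hc0 : 0 ≤ c := (abs_nonneg _).trans (hc ∅)
  have hS : ∀ a ∈ restrict L η, a ∈ bonds (box L) ∧ a - 1 ∈ bonds (box L) := by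
    intro a ha
    have := restrict_subset L η ha
    simp [mem_bonds, this]
  rw [generator_eq_sum p q (comp_restrict_dependsOn g L), backward_eq_sum_bondOp p q _ g _ _ hS,
    ← Finset.sum_sub_distrib]
  have hmem : -(L : ℤ) - 1 ∈ bonds (box L) := by
    rw [mem_bonds, mem_box, mem_box]; omega
  rw [Finset.sum_eq_single_of_mem _ hmem]
  · have hn : -(L : ℤ) - 1 ∉ box L := by rw [mem_box]; omega
    rw [if_neg (fun h => hn (by simpa using h.1)), sub_zero, abs_mul,
      abs_of_nonneg (exchangeRate_nonneg hp hq _ _), mul_comm]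
    refine mul_le_mul ?_ ?_ (exchangeRate_nonneg hp hq _ _) (by positivity)
    · refine (abs_sub _ _).trans ?_
      linarith [hc (restrict L (exchange (-(L : ℤ) - 1) η)), hc (restrict L η)]
    · have := exchangeRate_le (p := p) (q := q) (by linarith) (by linarith) (-(L : ℤ) - 1) η
      rwa [sub_add_cancel] at this
  · intro x hx hxne
    by_cases hin : x ∈ box L ∧ x + 1 ∈ box L
    · rw [if_pos (by simpa using hin), exchangeRate_mul_sub_eq_bondOp p q g hin.1 hin.2, sub_self]
    · rw [if_neg (by simpa using hin), sub_zero]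
      -- The bonds touching the box start at -L - 1, …, L and those inside it at -L, …, L - 1.
      have hxL : x = L := by
        rw [mem_bonds] at hx
        rw [not_and_or] at hin
        simp only [mem_box] at hx hin
        omega
      have : g (restrict L (exchange x η)) = g (restrict L η) := by
        rw [← hg, ← hg (restrict L η)]
        congr 1
        ext y
        simp only [Finset.mem_filter, mem_restrict]
        refine and_congr_left fun hy => and_congr_right fun _ => ?_
        rw [exchange_apply_of_ne (by omega) (by omega)]
      rw [this, sub_self, mul_zero]

/-! ### Approximate Taylor expansion -/

/-- If φ (k + 1) is the derivative of φ k up to an integrated error ε, iterated integration gives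
Taylor's formula: an error made at order k is integrated k times and contributes ε t^k/k!. The
induction shifts the sequence φ and replaces C by C r. -/
theorem abs_sub_taylor_le {C r ε T : ℝ} (M : ℕ) (φ : ℕ → ℝ → ℝ)
    (hint : ∀ k a b, IntervalIntegrable (φ k) volume a b)
    (hb : ∀ k, ∀ u, 0 ≤ u → |φ k u| ≤ C * r ^ k)
    (hD : ∀ k < M, ∀ t, 0 ≤ t → t ≤ T → |φ k t - φ k 0 - ∫ u in (0 : ℝ)..t, φ (k + 1) u| ≤ ε)
    (t : ℝ) (h0 : 0 ≤ t) (hT : t ≤ T) :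
    |φ 0 t - ∑ k ∈ Finset.range M, t ^ k / k.factorial * φ k 0| ≤
      ε * (∑ k ∈ Finset.range M, t ^ k / k.factorial) +
        C * r ^ M * (t ^ M / M.factorial) := by
  induction M generalizing φ t C with
  | zero => simpa using hb 0 t h0
  | succ M ih =>
    have hpow : ∀ k : ℕ, ∫ u in (0 : ℝ)..t, u ^ k / k.factorial =
        t ^ (k + 1) / (k + 1).factorial := by
      intro k
      rw [intervalIntegral.integral_div, integral_pow, Nat.factorial_succ]
      push_cast
      rw [zero_pow (Nat.succ_ne_zero k), sub_zero]
      field_simp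
    have ci : ∀ k : ℕ, IntervalIntegrable (fun u : ℝ => u ^ k / (k.factorial : ℝ)) volume 0 t :=
      fun k => Continuous.intervalIntegrable (by fun_prop) _ _
    have hS1 : ∫ u in (0 : ℝ)..t, ∑ k ∈ Finset.range M, u ^ k / k.factorial * φ (k + 1) 0 =
        ∑ k ∈ Finset.range M, t ^ (k + 1) / (k + 1).factorial * φ (k + 1) 0 := by
      rw [intervalIntegral.integral_finsetSum fun k _ => (ci k).mul_const _]
      simp only [intervalIntegral.integral_mul_const, hpow]
    have hS2 : ∫ u in (0 : ℝ)..t, (ε * (∑ k ∈ Finset.range M, u ^ k / k.factorial) +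
        C * r * r ^ M * (u ^ M / M.factorial)) =
        ε * (∑ k ∈ Finset.range M, t ^ (k + 1) / (k + 1).factorial) +
          C * r * r ^ M * (t ^ (M + 1) / (M + 1).factorial) := by
      rw [intervalIntegral.integral_add, intervalIntegral.integral_const_mul,
        intervalIntegral.integral_const_mul, hpow,
        intervalIntegral.integral_finsetSum fun k _ => ci k]
      · simp only [hpow]
      · exact Continuous.intervalIntegrable (by fun_prop) _ _
      · exact Continuous.intervalIntegrable (by fun_prop) _ _
    have hsumint : IntervalIntegrable
        (fun u => ∑ k ∈ Finset.range M, u ^ k / k.factorial * φ (k + 1) 0) volume 0 t :=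
      Continuous.intervalIntegrable (by fun_prop) _ _
    have h1 : |∫ u in (0 : ℝ)..t,
        (φ 1 u - ∑ k ∈ Finset.range M, u ^ k / k.factorial * φ (k + 1) 0)| ≤
        ε * (∑ k ∈ Finset.range M, t ^ (k + 1) / (k + 1).factorial) +
          C * r * r ^ M * (t ^ (M + 1) / (M + 1).factorial) := by
      rw [← hS2]
      refine (intervalIntegral.abs_integral_le_integral_abs h0).trans ?_
      refine intervalIntegral.integral_mono_on h0 ((hint 1 0 t).sub hsumint).abs
        (Continuous.intervalIntegrable (by fun_prop) _ _) fun u hu => ?_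
      refine ih (C := C * r) (fun k => φ (k + 1)) (fun k => hint (k + 1)) (fun k v hv => ?_)
        (fun k hk => hD (k + 1) (by omega)) u hu.1 (hu.2.trans hT)
      refine (hb (k + 1) v hv).trans_eq ?_
      ring
    rw [intervalIntegral.integral_sub (hint 1 0 t) hsumint, hS1] at h1
    have h2 := hD 0 (Nat.succ_pos M) t h0 hT
    rw [Finset.sum_range_succ' _ M, Finset.sum_range_succ' _ M]
    simp only [pow_zero, Nat.factorial_zero, Nat.cast_one, div_one, one_mul]
    simp only [zero_add] at h2
    rw [abs_le] at h1 h2 ⊢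
    have e : C * r ^ (M + 1) = C * r * r ^ M := by ring
    rw [e]
    constructor <;> linarith [h1.1, h1.2, h2.1, h2.2]

/-! ### The moment on ℤ compared with the Taylor series of the box -/

section Trajectories

variable {Ω : Type*} {m : MeasurableSpace Ω} {μ : Measure Ω} {p q : ℝ}
  {ℱ : Filtration ℝ≥0 m} {η : ℝ≥0 → Ω → Config}

/-- Dynkin's formula with the generator of the box in place of that of ℤ; the left boundary costs at
most 2c(ε + ε) per unit of time. -/
theorem IsASEP.abs_integral_restrict_sub_le [IsProbabilityMeasure μ] (hη : IsASEP p q μ ℱ η)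
    (hp : 0 ≤ p) (hq : 0 ≤ q) (hsum : p + q = 1)
    {g : Finset ℤ → ℝ} {c : ℝ} (hc : ∀ A, |g A| ≤ c) {z : ℤ} {L : ℕ} (hz : z < L)
    (hg : ∀ A : Finset ℤ, g (A.filter (· ≤ z)) = g A) {ε T : ℝ} (hε : 0 ≤ ε)
    (hocc : ∀ s : ℝ≥0, (s : ℝ) ≤ T → ∫ ω, occ (-(L : ℤ) - 1) (η s ω) ∂μ ≤ ε ∧
      ∫ ω, occ (-(L : ℤ)) (η s ω) ∂μ ≤ ε) (t : ℝ) (h0 : 0 ≤ t) (hT : t ≤ T) :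
    |∫ ω, g (restrict L (η t.toNNReal ω)) ∂μ - ∫ ω, g (restrict L (η (0 : ℝ).toNNReal ω)) ∂μ -
      ∫ u in (0 : ℝ)..t, ∫ ω, backward p q (box L : Set ℤ) g (restrict L (η u.toNNReal ω)) ∂μ| ≤
      4 * c * ε * T := by
  have hc0 : 0 ≤ c := (abs_nonneg _).trans (hc ∅)
  have hD := hη.setIntegral_sub (comp_restrict_dependsOn g L) (zero_le : 0 ≤ t.toNNReal)
    (F := Set.univ) MeasurableSet.univ
  obtain ⟨S, hS⟩ := generator_dependsOn p q (comp_restrict_dependsOn g L)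
  have hB := comp_restrict_dependsOn (backward p q (box L : Set ℤ) g) L
  simp only [setIntegral_univ, Real.coe_toNNReal t h0, NNReal.coe_zero] at hD
  have i1 := hη.intervalIntegrable_setIntegral hS 0 t Set.univ
  have i2 := hη.intervalIntegrable_setIntegral hB 0 t Set.univ
  simp only [setIntegral_univ] at i1 i2
  rw [Real.toNNReal_zero, hD, ← intervalIntegral.integral_sub i1 i2]
  have : 4 * c * ε * T ≥ ∫ u in (0 : ℝ)..t, 4 * c * ε := by
    rw [intervalIntegral.integral_const, smul_eq_mul, sub_zero, mul_comm t]
    gcongr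
  refine le_trans ?_ this
  refine (intervalIntegral.abs_integral_le_integral_abs h0).trans ?_
  refine intervalIntegral.integral_mono_on h0 (i1.sub i2).abs intervalIntegrable_const
    fun u hu => ?_
  have io : ∀ a, Integrable (fun ω => occ a (η u.toNNReal ω)) μ := fun a =>
    hη.integrable_comp (occ_dependsOn a) _
  rw [← integral_sub (hη.integrable_comp hS _) (hη.integrable_comp hB _)]
  have hu' : ((u.toNNReal : ℝ≥0) : ℝ) ≤ T := by
    rw [Real.coe_toNNReal u hu.1]; exact hu.2.trans hT
  calc _ ≤ ∫ ω, 2 * c * (occ (-(L : ℤ) - 1) (η u.toNNReal ω) +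
          occ (-(L : ℤ)) (η u.toNNReal ω)) ∂μ := by
        refine (abs_integral_le_integral_abs).trans (integral_mono ?_ ?_ fun ω => ?_)
        · exact ((hη.integrable_comp hS _).sub (hη.integrable_comp hB _)).abs
        · exact ((io _).add (io _)).const_mul _
        · exact abs_generator_sub_backward_le hp hq hsum hc hz hg _
    _ = 2 * c * (∫ ω, occ (-(L : ℤ) - 1) (η u.toNNReal ω) ∂μ +
          ∫ ω, occ (-(L : ℤ)) (η u.toNNReal ω) ∂μ) := by
        rw [integral_const_mul, integral_add (io _) (io _)]
    _ ≤ 2 * c * (ε + ε) := by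
        have := hocc _ hu'
        gcongr
        exacts [this.1, this.2]
    _ = 4 * c * ε := by ring

/-- The coefficients of the Taylor series of the moment in the box. -/
noncomputable def boxTaylor (p q : ℝ) (μ : Measure Ω) (η₀ : Ω → Config) (L n : ℕ) (x : ℤ)
    (k : ℕ) : ℝ :=
  ∫ ω, dual (p / q) ((backward p q (box L : Set ℤ))^[k] (momentKernel (p / q) n x))
    (restrict L (η₀ ω)) ∂μ

theorem abs_dual_iterate_backward_le (hp : 0 ≤ p) (hpq : p < q) (hsum : p + q = 1)
    (Λ : Set ℤ) {f : Finset ℤ → ℝ} {n : ℕ} {x : ℤ} (hf : BoundedKernel 1 n x f) (k : ℕ)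
    (A : Finset ℤ) :
    |dual (p / q) ((backward p q Λ)^[k] f) A| ≤
      Real.exp (1 / (1 - p / q)) * (2 * n) ^ k := by
  have hq : 0 < q := hp.trans_lt hpq
  have h := abs_dual_le (div_nonneg hp hq.le) ((div_lt_one hq).2 hpq)
    (hf.iterate_backward hp hq.le hsum Λ k).abs_le A
  rwa [mul_one, mul_comm] at h

theorem abs_boxTaylor_le [IsProbabilityMeasure μ] (hp : 0 ≤ p) (hpq : p < q) (hsum : p + q = 1)
    (η₀ : Ω → Config) (L n : ℕ) (x : ℤ) (k : ℕ) :
    |boxTaylor p q μ η₀ L n x k| ≤ Real.exp (1 / (1 - p / q)) * (2 * n) ^ k := by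
  have hq : 0 < q := hp.trans_lt hpq
  have h := norm_integral_le_of_norm_le_const (μ := μ) (f := fun ω => dual (p / q)
    ((backward p q (box L : Set ℤ))^[k] (momentKernel (p / q) n x)) (restrict L (η₀ ω)))
    (Eventually.of_forall fun ω => (Real.norm_eq_abs _).trans_le <| abs_dual_iterate_backward_le hp hpq hsum (box L : Set ℤ)
      (momentKernel_boundedKernel (div_nonneg hp hq.le) ((div_lt_one hq).2 hpq).le n x) k
      (restrict L (η₀ ω)))
  simpa [boxTaylor] using h

theorem summable_pow_div_factorial_mul (C r t : ℝ) :
    Summable fun k : ℕ => t ^ k / k.factorial * (C * r ^ k) := by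
  have := (Real.summable_pow_div_factorial (t * r)).mul_left C
  refine this.congr fun k => ?_
  rw [mul_pow]; ring

theorem summable_boxTaylor [IsProbabilityMeasure μ] (hp : 0 ≤ p) (hpq : p < q) (hsum : p + q = 1)
    (η₀ : Ω → Config) (L n : ℕ) (x : ℤ) (t : ℝ≥0) :
    Summable fun k : ℕ => (t : ℝ) ^ k / k.factorial * boxTaylor p q μ η₀ L n x k := by
  refine Summable.of_norm_bounded
    (summable_pow_div_factorial_mul (Real.exp (1 / (1 - p / q))) (2 * n) t) fun k => ?_
  rw [norm_mul, Real.norm_of_nonneg (by positivity)]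
  exact mul_le_mul_of_nonneg_left (abs_boxTaylor_le hp hpq hsum η₀ L n x k) (by positivity)

/-- The approximate Taylor formula is applied to φ k, the expectation of D 𝓛_box^k f on the
restricted configuration. The order M is fixed first, then the error ε, and only then L; the bounds
C r^k do not depend on L, which makes this order possible. -/
theorem IsASEP.tendsto_moment_sub_tsum [IsProbabilityMeasure μ] (hη : IsASEP p q μ ℱ η)
    (hp : 0 ≤ p) (hpq : p < q) (hsum : p + q = 1)
    (hleft : ∀ᵐ ω ∂μ, ∃ a : ℤ, ∀ y < a, η 0 ω y = false) (n : ℕ) (x : ℤ) (t : ℝ≥0) :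
    Tendsto (fun L : ℕ => ∫ ω, dual (p / q) (momentKernel (p / q) n x) (restrict L (η t ω)) ∂μ -
      ∑' k : ℕ, (t : ℝ) ^ k / k.factorial * boxTaylor p q μ (η 0) L n x k) atTop (𝓝 0) := by
  have hq : 0 < q := hp.trans_lt hpq
  have hτ : q * (p / q) = p := by field_simp
  set τ := p / q with hτdef
  have hτ0 : 0 ≤ τ := div_nonneg hp hq.le
  have hτ1 : τ < 1 := (div_lt_one hq).2 hpq
  set f := momentKernel τ n x with hfdef
  have hf : BoundedKernel 1 n x f := momentKernel_boundedKernel hτ0 hτ1.le n x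
  set C := Real.exp (1 / (1 - τ)) with hC
  set r : ℝ := 2 * n with hr
  have hCr : ∀ k, 0 ≤ C * r ^ k := fun k => by positivity
  have hsm := summable_pow_div_factorial_mul C r t
  rw [Metric.tendsto_atTop']
  intro δ hδ
  -- choose the order of the expansion
  have htail := tendsto_sum_nat_add fun k : ℕ => (t : ℝ) ^ k / k.factorial * (C * r ^ k)
  obtain ⟨M, hM⟩ := ((htail.eventually (gt_mem_nhds (show 0 < δ / 3 by linarith))).and
    (hsm.tendsto_atTop_zero.eventually (gt_mem_nhds (show 0 < δ / 3 by linarith)))).exists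
  -- D dominates C r^k for every k < M, so that a single ε serves all orders.
  set D : ℝ := ∑ k ∈ Finset.range M, C * r ^ k with hDdef
  have hD0 : 0 ≤ D := Finset.sum_nonneg fun k _ => hCr k
  set E : ℝ := ∑ k ∈ Finset.range M, (t : ℝ) ^ k / k.factorial with hEdef
  have hE0 : 0 ≤ E := Finset.sum_nonneg fun k _ => by positivity
  obtain ⟨ε, hε, hεδ⟩ : ∃ ε > 0, 4 * D * ε * t * E < δ / 3 := by
    refine ⟨δ / 3 / (4 * D * t * E + 1), by positivity, ?_⟩
    have : 4 * D * (δ / 3 / (4 * D * t * E + 1)) * t * E =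
        δ / 3 * ((4 * D * t * E) / (4 * D * t * E + 1)) := by ring
    rw [this]
    refine mul_lt_of_lt_one_right (by linarith) ?_
    rw [div_lt_one (by positivity)]
    linarith
  have hev := hη.eventually_integral_occ_le hp hq.le hsum hleft t hε
  have hcast : Tendsto (fun L : ℕ => -(L : ℤ)) atTop atBot :=
    tendsto_neg_atTop_atBot.comp tendsto_natCast_atTop_atTop
  have hev1 := hcast.eventually hev
  have hev2 := (tendsto_atBot_add_const_right atTop (-1 : ℤ) hcast).eventually hev
  -- The last condition keeps the supports, which reach up to x + k with k < M, strictly to the left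
  -- of the edge L.
  obtain ⟨L₀, hL₀⟩ := eventually_atTop.1 (hev1.and (hev2.and
    (eventually_ge_atTop (x + M + 1).toNat)))
  refine ⟨L₀, fun L hL => ?_⟩
  obtain ⟨hL1, hL2, hL3⟩ := hL₀ L hL.le
  rw [dist_zero_right, Real.norm_eq_abs]
  let φ : ℕ → ℝ → ℝ := fun k u =>
    ∫ ω, dual τ ((backward p q (box L : Set ℤ))^[k] f) (restrict L (η u.toNNReal ω)) ∂μ
  have hφb : ∀ k A, |dual τ ((backward p q (box L : Set ℤ))^[k] f) A| ≤ C * r ^ k := fun k A =>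
    abs_dual_iterate_backward_le hp hpq hsum _ hf k A
  have hφ0 : ∀ k, φ k 0 = boxTaylor p q μ (η 0) L n x k := fun k => by
    simp only [φ, Real.toNNReal_zero]; rfl
  have hT := abs_sub_taylor_le (C := C) (r := r) (ε := 4 * D * ε * t) (T := t) M φ
    (fun k a b => by
      have := hη.intervalIntegrable_setIntegral (comp_restrict_dependsOn
        (dual τ ((backward p q (box L : Set ℤ))^[k] f)) L) a b Set.univ
      simpa only [setIntegral_univ] using this)
    (fun k u _ => by
      have h := norm_integral_le_of_norm_le_const (μ := μ)
        (f := fun ω => dual τ ((backward p q (box L : Set ℤ))^[k] f) (restrict L (η u.toNNReal ω)))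
        (Eventually.of_forall fun ω => (Real.norm_eq_abs _).trans_le <|
          hφb k (restrict L (η u.toNNReal ω)))
      simpa using h)
    (fun k hk u h0 hu => by
      have h := hη.abs_integral_restrict_sub_le hp hq.le hsum (hφb k) (z := x + k) (L := L)
        (by omega) (fun A => dual_filter_le
          (hf.iterate_backward hp hq.le hsum _ k).eq_zero_of_lt le_rfl A) hε.le
        (T := t) (fun s hs => ⟨hL2 s (by exact_mod_cast hs), hL1 s (by exact_mod_cast hs)⟩) u h0 hu
      -- Duality enters here: the generator passes through D, so the approximate derivative of φ k
      -- is φ (k + 1).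
      rw [backward_dual hτ] at h
      simp only [← Function.iterate_succ_apply'] at h
      refine h.trans ?_
      gcongr
      exact Finset.single_le_sum (f := fun k => C * r ^ k) (fun k _ => hCr k)
        (Finset.mem_range.2 hk))
    t t.2 le_rfl
  have hφt : φ 0 t = ∫ ω, dual τ f (restrict L (η t ω)) ∂μ := by
    simp only [φ, Real.toNNReal_coe]; rfl
  rw [hφt] at hT
  simp only [hφ0] at hT
  have hsB := summable_boxTaylor (μ := μ) hp hpq hsum (η 0) L n x t
  have htl : |∑' k : ℕ, (t : ℝ) ^ (k + M) / (k + M).factorial *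
      boxTaylor p q μ (η 0) L n x (k + M)| < δ / 3 := by
    refine lt_of_le_of_lt ?_ hM.1
    rw [← Real.norm_eq_abs]
    refine tsum_of_norm_bounded ((summable_nat_add_iff M).2 hsm).hasSum fun k => ?_
    rw [norm_mul, Real.norm_of_nonneg (by positivity)]
    exact mul_le_mul_of_nonneg_left (abs_boxTaylor_le hp hpq hsum (η 0) L n x _) (by positivity)
  rw [← hsB.sum_add_tsum_nat_add M]
  have h3 := hM.2
  rw [abs_lt] at htl ⊢
  rw [abs_le] at hT
  have e : C * r ^ M * ((t : ℝ) ^ M / M.factorial) = (t : ℝ) ^ M / M.factorial * (C * r ^ M) :=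
    mul_comm _ _
  constructor <;> linarith [hT.1, hT.2, htl.1, htl.2]

end Trajectories

/-! ### The moments of the reflecting systems -/

theorem linearCombination_eq_sum {f : Finset ℤ → ℝ} {v : Finset ℤ →₀ ℝ}
    (S : Finset (Finset ℤ)) (h : ∀ A ∉ S, f A * v A = 0) :
    Finsupp.linearCombination ℝ f v = ∑ A ∈ S, f A * v A := by
  classical
  rw [Finsupp.linearCombination_apply, Finsupp.sum]
  have e1 : ∑ A ∈ v.support, v A • f A = ∑ A ∈ v.support ∪ S, f A * v A := by
    simp only [smul_eq_mul, mul_comm (v _)]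
    refine Finset.sum_subset Finset.subset_union_left fun A _ hA => ?_
    rw [Finsupp.notMem_support_iff.1 hA, mul_zero]
  rw [e1]
  exact (Finset.sum_subset Finset.subset_union_right fun A _ hA => h A hA).symm

/-- An ℓ¹ bound by duality with sup norms: H^k|B⟩ is tested against its own sign on S, and the power
is transposed onto this kernel. Finite propagation gives zero unless B lies to the left of z + k. -/
theorem sum_abs_rateMatrix_pow_le {p q : ℝ} (hp : 0 ≤ p) (hq : 0 ≤ q) (hsum : p + q = 1)
    (Λ : Set ℤ) (k : ℕ) {n : ℕ} {z : ℤ} (S : Finset (Finset ℤ))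
    (hS : ∀ A ∈ S, A.card ≤ n ∧ ∀ a ∈ A, a ≤ z) (B : Finset ℤ) :
    ∑ A ∈ S, |((rateMatrix p q Λ ^ k) (Finsupp.single B 1)) A| ≤
      if ∀ b ∈ B, b ≤ z + k then (2 * n : ℝ) ^ k else 0 := by
  classical
  set v := (rateMatrix p q Λ ^ k) (Finsupp.single B 1) with hv
  set f : Finset ℤ → ℝ := fun A => if A ∈ S then (SignType.sign (v A) : ℝ) else 0 with hf
  have hfB : BoundedKernel 1 n z f := by
    refine ⟨fun A => ?_, fun A hA => ?_, fun A a ha hz => ?_⟩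
    · simp only [hf]
      split_ifs
      · rcases SignType.sign (v A) with _ | _ | _ <;> simp
      · simp
    · exact if_neg fun h => absurd (hS A h).1 (not_le.2 hA)
    · exact if_neg fun h => absurd ((hS A h).2 a ha) (not_le.2 hz)
  have h1 : ∑ A ∈ S, |v A| = (-1) ^ k * (backward p q Λ)^[k] f B := by
    rw [← linearCombination_rateMatrix_pow_single, ← hv,
      linearCombination_eq_sum S fun A hA => by simp [hf, hA]]
    refine Finset.sum_congr rfl fun A hA => ?_
    simp only [hf, if_pos hA]
    exact (sign_mul_self _).symm
  have hb := hfB.iterate_backward hp hq hsum Λ k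
  rw [h1]
  refine (le_abs_self _).trans ?_
  rw [abs_mul, abs_pow, abs_neg, abs_one, one_pow, one_mul]
  split_ifs with hB
  · simpa using hb.abs_le B
  · push Not at hB
    obtain ⟨b, hb1, hb2⟩ := hB
    rw [hb.eq_zero_of_lt B b hb1 hb2, abs_zero]

theorem summable_transProb {p q : ℝ} (hp : 0 ≤ p) (hq : 0 ≤ q) (hsum : p + q = 1)
    (Λ : Set ℤ) (t : ℝ) (A B : Finset ℤ) :
    Summable fun k : ℕ =>
      (-t) ^ k / (k.factorial : ℝ) * ((rateMatrix p q Λ ^ k) (Finsupp.single B 1)) A := by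
  obtain ⟨z, hz⟩ := A.bddAbove
  refine Summable.of_norm_bounded (summable_pow_div_factorial_mul 1 (2 * A.card) |t|) fun k => ?_
  have h := sum_abs_rateMatrix_pow_le hp hq hsum Λ k (n := A.card) (z := z) {A}
    (fun A' hA' => by rw [Finset.mem_singleton.1 hA']; exact ⟨le_rfl, fun a ha => hz ha⟩) B
  rw [Finset.sum_singleton] at h
  rw [norm_mul, norm_div, norm_pow, norm_neg, Real.norm_eq_abs, Real.norm_eq_abs,
    Real.norm_eq_abs, Nat.abs_cast, one_mul]
  refine mul_le_mul_of_nonneg_left (h.trans ?_) (by positivity)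
  split_ifs
  · exact le_rfl
  · positivity

theorem rateMatrix_pow_single_apply_eq_zero {p q : ℝ} {S : Finset ℤ} (k : ℕ) {A B : Finset ℤ}
    (hB : B ⊆ S) (hA : ¬ A ⊆ S) :
    ((rateMatrix p q (S : Set ℤ) ^ k) (Finsupp.single B 1)) A = 0 := by
  have hbas : ∀ C : Finset ℤ, C ⊆ S →
      rateMatrixBasis p q (S : Set ℤ) C ∈ Finsupp.supported ℝ ℝ {C | C ⊆ S} := by
    intro C hC
    have hs : ∀ {C : Finset ℤ}, C ⊆ S →
        (Finsupp.single C (1 : ℝ)) ∈ Finsupp.supported ℝ ℝ {C | C ⊆ S} :=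
      fun h => Finsupp.single_mem_supported ℝ _ h
    have hi : ∀ x y, y ∈ S → insert y (C.erase x) ⊆ S := fun x y hy =>
      Finset.insert_subset hy ((Finset.erase_subset _ _).trans hC)
    refine Submodule.neg_mem _ (Submodule.sum_mem _ fun x _ => Submodule.add_mem _ ?_ ?_)
    · split_ifs with h
      · exact Submodule.smul_mem _ _ (Submodule.sub_mem _ (hs (hi _ _ (by simpa using h.2.1))) (hs hC))
      · exact Submodule.zero_mem _
    · split_ifs with h
      · exact Submodule.smul_mem _ _ (Submodule.sub_mem _ (hs (hi _ _ (by simpa using h.2.1))) (hs hC))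
      · exact Submodule.zero_mem _
  have hmap : ∀ v ∈ Finsupp.supported ℝ ℝ {C | C ⊆ S},
      rateMatrix p q (S : Set ℤ) v ∈ Finsupp.supported ℝ ℝ {C : Finset ℤ | C ⊆ S} := by
    intro v hv
    rw [rateMatrix, Finsupp.linearCombination_apply]
    refine Submodule.sum_mem _ fun C hC => Submodule.smul_mem _ _ (hbas C ?_)
    exact hv hC
  have hpow : (rateMatrix p q (S : Set ℤ) ^ k) (Finsupp.single B 1) ∈
      Finsupp.supported ℝ ℝ {C : Finset ℤ | C ⊆ S} := by
    induction k with
    | zero => simpa using Finsupp.single_mem_supported ℝ (1 : ℝ) hB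
    | succ k ih => rw [pow_succ', Module.End.mul_apply]; exact hmap _ ih
  by_contra h
  exact hA (hpow (Finsupp.mem_support_iff.2 h))

/-- The backward equation, as a power series. -/
theorem hasSum_backward_box {p q : ℝ} (hp : 0 ≤ p) (hq : 0 ≤ q) (hsum : p + q = 1)
    (g : Finset ℤ → ℝ) (t : ℝ) (S : Finset ℤ) {B : Finset ℤ} (hB : B ⊆ S) :
    HasSum (fun k : ℕ => t ^ k / k.factorial * (backward p q (S : Set ℤ))^[k] g B)
      (∑ A ∈ S.powerset, g A * transProb p q (S : Set ℤ) t A B) := by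
  have h1 := hasSum_sum fun A (_ : A ∈ S.powerset) =>
    (summable_transProb hp hq hsum (S : Set ℤ) t A B).hasSum.mul_left (g A)
  refine h1.congr_fun fun k => ?_
  have h2 := linearCombination_rateMatrix_pow_single p q (S : Set ℤ) k g B
  -- With reflecting boundaries no particle leaves S, so the pairing involves only subsets of S.
  rw [linearCombination_eq_sum S.powerset fun A hA => by
    rw [rateMatrix_pow_single_apply_eq_zero k hB (fun h => hA (Finset.mem_powerset.2 h)),
      mul_zero]] at h2
  have h3 : (backward p q (S : Set ℤ))^[k] g B = (-1) ^ k *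
      ∑ A ∈ S.powerset, g A * ((rateMatrix p q (S : Set ℤ) ^ k) (Finsupp.single B 1)) A := by
    rw [h2, ← mul_assoc, ← mul_pow]; simp
  rw [h3, ← mul_assoc, Finset.mul_sum]
  refine Finset.sum_congr rfl fun A _ => ?_
  rw [neg_pow t]
  ring

/-! ### The box moment as a power series in time -/

section Trajectories

variable {Ω : Type*} {m : MeasurableSpace Ω} {μ : Measure Ω} {p q : ℝ}
  {ℱ : Filtration ℝ≥0 m} {η : ℝ≥0 → Ω → Config}

theorem sum_mul_measureReal_restrict_eq [IsFiniteMeasure μ] {η₀ : Ω → Config}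
    (hη₀ : Measurable η₀) (L : ℕ) (φ : Finset ℤ → ℝ) :
    ∑ B ∈ (box L).powerset, φ B * μ.real {ω | restrict L (η₀ ω) = B} =
      ∫ ω, φ (restrict L (η₀ ω)) ∂μ := by
  have hm : ∀ B, MeasurableSet {ω | restrict L (η₀ ω) = B} := by
    intro B
    have h := (DependsOn.measurable (comp_restrict_dependsOn
      (fun A => if A = B then (1 : ℝ) else 0) L)).comp hη₀ (measurableSet_singleton 1)
    convert h using 1
    ext ω
    simp
  have h1 : ∀ ω, φ (restrict L (η₀ ω)) = ∑ B ∈ (box L).powerset,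
      Set.indicator {ω | restrict L (η₀ ω) = B} (fun _ => φ B) ω := by
    intro ω
    simp only [Set.indicator_apply, Set.mem_ofPred_eq]
    rw [Finset.sum_ite_eq, if_pos (Finset.mem_powerset.2 (restrict_subset L _))]
  simp only [h1]
  rw [integral_finsetSum _ fun B _ => (integrable_const (φ B)).indicator (hm B)]
  refine Finset.sum_congr rfl fun B _ => ?_
  rw [integral_indicator_const _ (hm B), smul_eq_mul, mul_comm]

/-- The backward series is applied to Df, the n-th moment as a function of the configuration.
Commuting D past the generator identifies its coefficients with those of the approximate expansion
on ℤ. -/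
theorem boxMoment_eq_tsum [IsProbabilityMeasure μ] (hp : 0 ≤ p) (hpq : p < q) (hsum : p + q = 1)
    {η₀ : Ω → Config} (hη₀ : Measurable η₀) (L n : ℕ) (x : ℤ) (t : ℝ≥0) :
    boxMoment p q μ η₀ L t x n =
      ∑' k : ℕ, (t : ℝ) ^ k / k.factorial * boxTaylor p q μ η₀ L n x k := by
  have hq : 0 < q := hp.trans_lt hpq
  have hτ : q * (p / q) = p := by field_simp
  set g := dual (p / q) (momentKernel (p / q) n x) with hg
  have h1 : boxMoment p q μ η₀ L t x n = ∑ B ∈ (box L).powerset,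
      (∑ A ∈ (box L).powerset, g A * transProb p q (box L : Set ℤ) t A B) *
        μ.real {ω | restrict L (η₀ ω) = B} := by
    unfold boxMoment boxProb
    simp only [Finset.mul_sum, Finset.sum_mul]
    rw [Finset.sum_comm]
    refine Finset.sum_congr rfl fun B _ => Finset.sum_congr rfl fun A _ => ?_
    rw [hg, dual_momentKernel, mul_assoc]
  rw [h1]
  symm
  refine HasSum.tsum_eq ?_
  refine (hasSum_sum fun B hB => (hasSum_backward_box hp hq.le hsum g t (box L)
    (Finset.mem_powerset.1 hB)).mul_right (μ.real {ω | restrict L (η₀ ω) = B})).congr_fun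
    fun k => ?_
  simp only [mul_assoc]
  rw [← Finset.mul_sum, sum_mul_measureReal_restrict_eq hη₀, hg, iterate_backward_dual hτ]
  rfl

/-! ### Configurations that are empty far to the left -/

theorem eventually_coe_filter_restrict {ζ : Config} (h : ∃ a : ℤ, ∀ y < a, ζ y = false) (z : ℤ) :
    ∀ᶠ L : ℕ in atTop, (((restrict L ζ).filter (· ≤ z) : Finset ℤ) : Set ℤ) =
      leftParticles z ζ := by
  obtain ⟨a, ha⟩ := h
  filter_upwards [eventually_ge_atTop a.natAbs, eventually_ge_atTop z.natAbs] with L h1 h2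
  ext y
  simp only [Finset.coe_filter, Set.mem_ofPred_eq, mem_restrict, mem_box, leftParticles]
  refine ⟨fun h => ⟨h.2, h.1.2⟩, fun h => ⟨⟨⟨?_, by omega⟩, h.2⟩, h.1⟩⟩
  by_contra hy
  have := ha y (by omega)
  simp [this] at h

theorem finite_leftParticles {ζ : Config} (h : ∃ a : ℤ, ∀ y < a, ζ y = false) (z : ℤ) :
    (leftParticles z ζ).Finite := by
  obtain ⟨L, hL⟩ := (eventually_coe_filter_restrict h z).exists
  rw [← hL]
  exact Finset.finite_toSet _

theorem eventually_card_filter_restrict {ζ : Config} (h : ∃ a : ℤ, ∀ y < a, ζ y = false)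
    (z : ℤ) : ∀ᶠ L : ℕ in atTop, ((restrict L ζ).filter (· ≤ z)).card = leftCount z ζ := by
  filter_upwards [eventually_coe_filter_restrict h z] with L hL
  rw [leftCount, ← hL, Set.ncard_coe_finset]

theorem measurable_comp_restrict {η₀ : Ω → Config} (hη₀ : Measurable η₀) (g : Finset ℤ → ℝ)
    (L : ℕ) : Measurable fun ω => g (restrict L (η₀ ω)) :=
  (DependsOn.measurable (comp_restrict_dependsOn g L)).comp hη₀

/-- N_x is not a cylinder function, and the count of an infinite set defaults to 0. Almost surely,
however, it is the eventual value of the counts in the boxes. -/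
theorem aemeasurable_Q {η₀ : Ω → Config} (hη₀ : Measurable η₀)
    (hleft : ∀ᵐ ω ∂μ, ∃ a : ℤ, ∀ y < a, η₀ ω y = false) (τ : ℝ) (z : ℤ) :
    AEMeasurable (fun ω => Q τ z (η₀ ω)) μ := by
  refine aemeasurable_of_tendsto_metrizable_ae atTop
    (f := fun L ω => τ ^ ((restrict L (η₀ ω)).filter (· ≤ z)).card)
    (fun L => (measurable_comp_restrict hη₀ (fun A => τ ^ (A.filter (· ≤ z)).card) L).aemeasurable)
    ?_
  filter_upwards [hleft] with ω hω
  refine tendsto_const_nhds.congr' ?_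
  filter_upwards [eventually_card_filter_restrict hω z] with L hL
  rw [hL, Q]

theorem abs_Q_pow_le {τ : ℝ} (h0 : 0 ≤ τ) (h1 : τ ≤ 1) (z : ℤ) (ζ : Config) (n : ℕ) :
    |Q τ z ζ ^ n| ≤ 1 := by
  rw [Q, abs_of_nonneg (by positivity)]
  exact pow_le_one₀ (by positivity) (pow_le_one₀ h0 h1)

theorem tendsto_integral_dual_momentKernel [IsProbabilityMeasure μ] {η₀ : Ω → Config}
    (hη₀ : Measurable η₀) (hleft : ∀ᵐ ω ∂μ, ∃ a : ℤ, ∀ y < a, η₀ ω y = false)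
    {τ : ℝ} (h0 : 0 ≤ τ) (h1 : τ ≤ 1) (n : ℕ) (x : ℤ) :
    Tendsto (fun L : ℕ => ∫ ω, dual τ (momentKernel τ n x) (restrict L (η₀ ω)) ∂μ) atTop
      (𝓝 (∫ ω, Q τ x (η₀ ω) ^ n ∂μ)) := by
  refine tendsto_integral_of_dominated_convergence (fun _ => 1)
    (fun L => (measurable_comp_restrict hη₀ _ L).aestronglyMeasurable) (integrable_const _)
    (fun L => Eventually.of_forall fun ω => ?_) ?_
  · rw [dual_momentKernel, Real.norm_eq_abs, abs_of_nonneg (by positivity)]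
    exact pow_le_one₀ (by positivity) (pow_le_one₀ h0 h1)
  · filter_upwards [hleft] with ω hω
    refine tendsto_const_nhds.congr' ?_
    filter_upwards [eventually_card_filter_restrict hω x] with L hL
    rw [dual_momentKernel, hL, Q]

end Trajectories

/-! ### Linearity and conservation of the number of particles -/

theorem backward_sum {ι : Type*} (p q : ℝ) (Λ : Set ℤ) (S : Finset ι) (c : ι → ℝ)
    (F : ι → Finset ℤ → ℝ) :
    backward p q Λ (fun A => ∑ i ∈ S, c i * F i A) =
      fun A => ∑ i ∈ S, c i * backward p q Λ (F i) A := by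
  classical
  funext A
  have h : (fun A => ∑ i ∈ S, c i * F i A) = ∑ i ∈ S, c i • F i := by
    funext A; simp
  have key : ∀ f, backward p q Λ f A =
      -Finsupp.linearCombination ℝ f (rateMatrixBasis p q Λ A) := fun f => by
    rw [linearCombination_rateMatrixBasis, neg_neg]
  simp only [key, Finsupp.linearCombination_apply, Finsupp.sum, smul_eq_mul, mul_neg,
    Finset.mul_sum, Finset.sum_neg_distrib]
  rw [Finset.sum_comm]
  congr 1
  refine Finset.sum_congr rfl fun i _ => Finset.sum_congr rfl fun B _ => ?_
  ring

theorem iterate_backward_sum {ι : Type*} (p q : ℝ) (Λ : Set ℤ) (S : Finset ι) (c : ι → ℝ)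
    (F : ι → Finset ℤ → ℝ) (k : ℕ) :
    (backward p q Λ)^[k] (fun A => ∑ i ∈ S, c i * F i A) =
      fun A => ∑ i ∈ S, c i * (backward p q Λ)^[k] (F i) A := by
  induction k generalizing F with
  | zero => rfl
  | succ k ih => simp only [Function.iterate_succ_apply, backward_sum, ih]

theorem backward_eq_zero_of_card_ne (p q : ℝ) (Λ : Set ℤ) {k : ℕ} {f : Finset ℤ → ℝ}
    (hf : ∀ A : Finset ℤ, A.card ≠ k → f A = 0) (A : Finset ℤ) (hA : A.card ≠ k) :
    backward p q Λ f A = 0 := by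
  classical
  have hcard : ∀ x y : ℤ, x ∈ A → y ∉ A → f (insert y (A.erase x)) = 0 := by
    intro x y hx hy
    apply hf
    rw [Finset.card_insert_of_notMem (by simp [hy]), Finset.card_erase_of_mem hx]
    have := Finset.card_pos.2 ⟨x, hx⟩
    omega
  refine Finset.sum_eq_zero fun x hx => ?_
  have e0 := hf A hA
  split_ifs with h1 h2 h2 <;> simp [*]

theorem iterate_backward_eq_zero_of_card_ne (p q : ℝ) (Λ : Set ℤ) {k : ℕ} {f : Finset ℤ → ℝ}
    (hf : ∀ A : Finset ℤ, A.card ≠ k → f A = 0) (j : ℕ) (A : Finset ℤ) (hA : A.card ≠ k) :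
    (backward p q Λ)^[j] f A = 0 := by
  induction j generalizing A with
  | zero => exact hf A hA
  | succ j ih =>
    rw [Function.iterate_succ_apply']
    exact backward_eq_zero_of_card_ne p q Λ ih A hA

/-- The indicator function of the sets of `k` particles in `(-∞, x]`. -/
noncomputable def posKernel (k : ℕ) (x : ℤ) (A : Finset ℤ) : ℝ :=
  if A.card = k ∧ ∀ a ∈ A, a ≤ x then 1 else 0

theorem posKernel_boundedKernel (k : ℕ) (x : ℤ) : BoundedKernel 1 k x (posKernel k x) where
  abs_le A := by unfold posKernel; split_ifs <;> simp
  eq_zero_of_card A hA := if_neg fun h => by omega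
  eq_zero_of_lt A a ha hx := if_neg fun h => absurd (h.2 a ha) (not_le.2 hx)

theorem posKernel_eq_zero_of_card_ne (k : ℕ) (x : ℤ) (A : Finset ℤ) (hA : A.card ≠ k) :
    posKernel k x A = 0 := if_neg fun h => hA h.1

/-- The prefactor depends only on the number of particles, which is conserved, so each layer k
evolves separately and produces c_k. Layers with k > n vanish through the factor τ^0 - 1. -/
theorem momentKernel_eq_sum (τ : ℝ) (n : ℕ) (x : ℤ) :
    momentKernel τ n x = fun A => ∑ k ∈ Finset.range (n + 1),
      (∏ j ∈ Finset.range k, (τ ^ (n - j) - 1)) * posKernel k x A := by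
  funext A
  unfold momentKernel posKernel
  split_ifs with h
  · simp only [and_iff_left h, mul_ite, mul_one, mul_zero]
    rw [Finset.sum_ite_eq]
    split_ifs with hA
    · rfl
    · exact prod_pow_sub_one_eq_zero τ (by simpa using hA)
  · simp [h]

/-! ### Correlations of `Q̃` -/

/-- This identifies the kernel of D with the product of the Q̃: the factors n_y force B to be
occupied, and the powers of τ form the weight. -/
theorem prod_Qtilde_eq {τ : ℝ} (hτ : τ ≠ 1) {ζ : Config} {z : ℤ} {E : Finset ℤ}
    (hE : (E : Set ℤ) = leftParticles z ζ) {B : Finset ℤ} (hB : ∀ b ∈ B, b ≤ z) :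
    ∏ y ∈ B, Qtilde τ y ζ = if B ⊆ E then weight τ E B else 0 := by
  have hmem : ∀ y, y ∈ E ↔ y ≤ z ∧ ζ y = true := fun y => by
    rw [← Finset.mem_coe, hE]; rfl
  have hQ : ∀ y ∈ B, Qtilde τ y ζ = τ ^ (E.filter (· < y)).card * occ y ζ := by
    intro y hy
    have hyz := hB y hy
    rw [Qtilde_eq hτ y ζ]
    · congr 2
      rw [leftCount, ← Set.ncard_coe_finset]
      congr 1
      ext j
      simp only [leftParticles, Set.mem_ofPred_eq, Finset.coe_filter, hmem]
      exact ⟨fun h => ⟨⟨by omega, h.2⟩, by omega⟩, fun h => ⟨by omega, h.1.2⟩⟩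
    · refine (E.finite_toSet).subset ?_
      rw [hE]
      exact fun j hj => ⟨hj.1.trans hyz, hj.2⟩
  rw [Finset.prod_congr rfl hQ]
  split_ifs with h
  · refine Finset.prod_congr rfl fun y hy => ?_
    simp [occ, ((hmem y).1 (h hy)).2]
  · obtain ⟨y, hy, hyE⟩ := Finset.not_subset.1 h
    refine Finset.prod_eq_zero hy ?_
    have : ζ y ≠ true := fun h' => hyE ((hmem y).2 ⟨hB y hy, h'⟩)
    simp [occ, this]

theorem prod_Qtilde_mem_Icc {τ : ℝ} (h0 : 0 ≤ τ) (h1 : τ < 1) {ζ : Config}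
    (h : ∃ a : ℤ, ∀ y < a, ζ y = false) (B : Finset ℤ) :
    0 ≤ ∏ y ∈ B, Qtilde τ y ζ ∧ ∏ y ∈ B, Qtilde τ y ζ ≤ 1 := by
  obtain ⟨z, hz⟩ := B.bddAbove
  obtain ⟨L, hL⟩ := (eventually_coe_filter_restrict h z).exists
  rw [prod_Qtilde_eq h1.ne hL fun b hb => hz hb]
  split_ifs
  · exact ⟨weight_nonneg h0 _ _, Finset.prod_le_one (fun _ _ => by positivity)
      fun _ _ => pow_le_one₀ h0 h1.le⟩
  · simp

theorem sum_prod_Qtilde_le {τ : ℝ} (h0 : 0 ≤ τ) (h1 : τ < 1) {ζ : Config}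
    (h : ∃ a : ℤ, ∀ y < a, ζ y = false) {z : ℤ} (S : Finset (Finset ℤ))
    (hS : ∀ B ∈ S, ∀ b ∈ B, b ≤ z) :
    ∑ B ∈ S, ∏ y ∈ B, Qtilde τ y ζ ≤ Real.exp (1 / (1 - τ)) := by
  classical
  obtain ⟨L, hL⟩ := (eventually_coe_filter_restrict h z).exists
  set E := (restrict L ζ).filter (· ≤ z)
  calc ∑ B ∈ S, ∏ y ∈ B, Qtilde τ y ζ = ∑ B ∈ S, if B ∈ E.powerset then weight τ E B else 0 :=
        Finset.sum_congr rfl fun B hB => by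
          rw [prod_Qtilde_eq h1.ne hL (hS B hB)]; simp only [Finset.mem_powerset]
    _ ≤ ∑ B ∈ E.powerset, weight τ E B := by
        rw [← Finset.sum_filter]
        refine Finset.sum_le_sum_of_subset_of_nonneg (fun B hB => (Finset.mem_filter.1 hB).2)
          fun B _ _ => weight_nonneg h0 E B
    _ ≤ _ := sum_weight_le h0 h1 E

theorem hasSum_mul_prod_Qtilde {τ : ℝ} (hτ : τ ≠ 1) {ζ : Config} {z : ℤ} {E : Finset ℤ}
    (hE : (E : Set ℤ) = leftParticles z ζ) {h : Finset ℤ → ℝ}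
    (hz : ∀ A : Finset ℤ, ∀ a ∈ A, z < a → h A = 0) {k : ℕ}
    (hk : ∀ A : Finset ℤ, A.card ≠ k → h A = 0) :
    HasSum (fun B : Positions k => h B.1 * ∏ y ∈ B.1, Qtilde τ y ζ) (dual τ h E) := by
  have h1 : HasSum (fun B : Finset ℤ => h B * ∏ y ∈ B, Qtilde τ y ζ) (dual τ h E) := by
    have h2 : dual τ h E = ∑ B ∈ E.powerset, h B * ∏ y ∈ B, Qtilde τ y ζ := by
      refine Finset.sum_congr rfl fun B hB => ?_
      rw [Finset.mem_powerset] at hB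
      rw [prod_Qtilde_eq hτ hE, if_pos hB]
      intro b hb
      have := Finset.mem_coe.2 (hB hb)
      rw [hE] at this
      exact this.1
    rw [h2]
    refine hasSum_sum_of_ne_finset_zero fun B hB => ?_
    by_cases hBz : ∀ b ∈ B, b ≤ z
    · rw [prod_Qtilde_eq hτ hE hBz, if_neg (by simpa using hB), mul_zero]
    · push Not at hBz
      obtain ⟨b, hb, hbz⟩ := hBz
      rw [hz B b hb hbz, zero_mul]
  refine (hasSum_subtype_iff_of_support_subset (s := {A : Finset ℤ | A.card = k}) ?_).2 h1
  intro B hB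
  by_contra hne
  exact hB (by simp only [hk B hne, zero_mul])

/-- Only subsets of the finite set E matter, and on each of these the iterates of box and lattice
eventually agree. -/
theorem eventually_dual_iterate_backward (p q τ : ℝ) {ζ : Config}
    (h : ∃ a : ℤ, ∀ y < a, ζ y = false) {z : ℤ} {E : Finset ℤ}
    (hE : (E : Set ℤ) = leftParticles z ζ) {f : Finset ℤ → ℝ} {j : ℕ}
    (hz : ∀ (Λ : Set ℤ) (A : Finset ℤ), ∀ a ∈ A, z < a → (backward p q Λ)^[j] f A = 0) :
    ∀ᶠ L : ℕ in atTop, dual τ ((backward p q (box L : Set ℤ))^[j] f) (restrict L ζ) =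
      dual τ ((backward p q Set.univ)^[j] f) E := by
  filter_upwards [eventually_coe_filter_restrict h z, (Filter.eventually_all_finset E.powerset).2
    fun A _ => eventually_iterate_backward_box p q f j A] with L hL hA
  have hLE : (restrict L ζ).filter (· ≤ z) = E := Finset.coe_injective (hL.trans hE.symm)
  rw [← dual_filter_le (hz _) le_rfl, hLE]
  exact Finset.sum_congr rfl fun A hA' => by rw [hA A hA']

/-! ### Sums of initial correlations -/

section Trajectories

variable {Ω : Type*} {m : MeasurableSpace Ω} {μ : Measure Ω} {p q : ℝ}
  {ℱ : Filtration ℝ≥0 m} {η : ℝ≥0 → Ω → Config}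

theorem integrable_prod_Qtilde [IsFiniteMeasure μ] {η₀ : Ω → Config}
    (hη₀ : Measurable η₀) (hleft : ∀ᵐ ω ∂μ, ∃ a : ℤ, ∀ y < a, η₀ ω y = false)
    {τ : ℝ} (h0 : 0 ≤ τ) (h1 : τ < 1) (B : Finset ℤ) :
    Integrable (fun ω => ∏ y ∈ B, Qtilde τ y (η₀ ω)) μ := by
  refine Integrable.of_bound (AEMeasurable.aestronglyMeasurable ?_) 1 ?_
  · refine Finset.aemeasurable_fun_prod _ fun y _ => ?_
    exact ((aemeasurable_Q hη₀ hleft τ y).sub (aemeasurable_Q hη₀ hleft τ (y - 1))).div_const _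
  · filter_upwards [hleft] with ω hω
    have := prod_Qtilde_mem_Icc h0 h1 hω B
    rw [Real.norm_eq_abs, abs_of_nonneg this.1]
    exact this.2

theorem initialCorr_nonneg {η₀ : Ω → Config}
    (hleft : ∀ᵐ ω ∂μ, ∃ a : ℤ, ∀ y < a, η₀ ω y = false)
    {τ : ℝ} (h0 : 0 ≤ τ) (h1 : τ < 1) (B : Finset ℤ) : 0 ≤ initialCorr τ μ η₀ B := by
  refine integral_nonneg_of_ae ?_
  filter_upwards [hleft] with ω hω using (prod_Qtilde_mem_Icc h0 h1 hω B).1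

theorem sum_initialCorr_le [IsProbabilityMeasure μ] {η₀ : Ω → Config}
    (hη₀ : Measurable η₀) (hleft : ∀ᵐ ω ∂μ, ∃ a : ℤ, ∀ y < a, η₀ ω y = false)
    {τ : ℝ} (h0 : 0 ≤ τ) (h1 : τ < 1) {z : ℤ} (S : Finset (Finset ℤ))
    (hS : ∀ B ∈ S, ∀ b ∈ B, b ≤ z) :
    ∑ B ∈ S, initialCorr τ μ η₀ B ≤ Real.exp (1 / (1 - τ)) := by
  unfold initialCorr
  have hi := fun B (_ : B ∈ S) => integrable_prod_Qtilde hη₀ hleft h0 h1 B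
  rw [← integral_finsetSum _ hi]
  calc _ ≤ ∫ ω, Real.exp (1 / (1 - τ)) ∂μ := by
        refine integral_mono_ae (integrable_finsetSum _ hi) (integrable_const _) ?_
        filter_upwards [hleft] with ω hω using sum_prod_Qtilde_le h0 h1 hω S hS
    _ = _ := by simp

theorem sum_positions_initialCorr_le [IsProbabilityMeasure μ] {η₀ : Ω → Config}
    (hη₀ : Measurable η₀) (hleft : ∀ᵐ ω ∂μ, ∃ a : ℤ, ∀ y < a, η₀ ω y = false)
    {τ : ℝ} (h0 : 0 ≤ τ) (h1 : τ < 1) {k : ℕ} (z : ℤ) {c : ℝ} (hc : 0 ≤ c)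
    (S : Finset (Positions k)) :
    ∑ B ∈ S, (if ∀ b ∈ B.1, b ≤ z then c else 0) * initialCorr τ μ η₀ B.1 ≤
      c * Real.exp (1 / (1 - τ)) := by
  classical
  have h := sum_initialCorr_le hη₀ hleft h0 h1 (z := z)
    ((S.map (Function.Embedding.subtype _)).filter fun B => ∀ b ∈ B, b ≤ z)
    fun B hB => (Finset.mem_filter.1 hB).2
  rw [Finset.sum_filter, Finset.sum_map] at h
  refine le_trans (le_of_eq ?_) (mul_le_mul_of_nonneg_left h hc)
  rw [Finset.mul_sum]
  refine Finset.sum_congr rfl fun B _ => ?_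
  by_cases hB : ∀ b ∈ Function.Embedding.subtype (fun A : Finset ℤ => A.card = k) B, b ≤ z
  · rw [if_pos hB, if_pos (show ∀ b ∈ B.1, b ≤ z from hB)]
    rfl
  · rw [if_neg hB, if_neg (show ¬∀ b ∈ B.1, b ≤ z from hB), zero_mul, mul_zero]

/-- Sum and expectation are interchanged: the support of h in (-∞, z] and the uniform bound on the
summed weights make the sum of the integrated absolute values at most c exp(1/(1-τ)). -/
theorem hasSum_mul_initialCorr [IsProbabilityMeasure μ] {η₀ : Ω → Config}
    (hη₀ : Measurable η₀) (hleft : ∀ᵐ ω ∂μ, ∃ a : ℤ, ∀ y < a, η₀ ω y = false)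
    {τ : ℝ} (h0 : 0 ≤ τ) (h1 : τ < 1) {k : ℕ} {z : ℤ} {c : ℝ} {h : Finset ℤ → ℝ}
    (hb : BoundedKernel c k z h) :
    HasSum (fun B : Positions k => h B.1 * initialCorr τ μ η₀ B.1)
      (∫ ω, ∑' B : Positions k, h B.1 * ∏ y ∈ B.1, Qtilde τ y (η₀ ω) ∂μ) := by
  have hc : 0 ≤ c := (abs_nonneg _).trans (hb.abs_le ∅)
  have hi : ∀ B : Positions k,
      Integrable (fun ω => h B.1 * ∏ y ∈ B.1, Qtilde τ y (η₀ ω)) μ := fun B =>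
    (integrable_prod_Qtilde hη₀ hleft h0 h1 B.1).const_mul _
  have hn : ∀ B : Positions k, ∫ ω, ‖h B.1 * ∏ y ∈ B.1, Qtilde τ y (η₀ ω)‖ ∂μ =
      |h B.1| * initialCorr τ μ η₀ B.1 := by
    intro B
    rw [initialCorr, ← integral_const_mul]
    refine integral_congr_ae ?_
    filter_upwards [hleft] with ω hω
    rw [norm_mul, Real.norm_eq_abs, Real.norm_of_nonneg (prod_Qtilde_mem_Icc h0 h1 hω B.1).1]
  have hs := hasSum_integral_of_summable_integral_norm hi (by
    simp only [hn]
    refine summable_of_sum_le (c := c * Real.exp (1 / (1 - τ)))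
      (fun B => mul_nonneg (abs_nonneg _) (initialCorr_nonneg hleft h0 h1 _)) fun S => ?_
    refine le_trans (Finset.sum_le_sum fun B _ => ?_)
      (sum_positions_initialCorr_le hη₀ hleft h0 h1 z hc S)
    refine mul_le_mul_of_nonneg_right ?_ (initialCorr_nonneg hleft h0 h1 _)
    split_ifs with hB
    · exact hb.abs_le _
    · push Not at hB
      obtain ⟨b, hb1, hb2⟩ := hB
      rw [hb.eq_zero_of_lt _ b hb1 hb2, abs_zero])
  simpa only [integral_const_mul, initialCorr] using hs

/-- Convergence of the Taylor coefficients in the boxes. -/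
theorem tendsto_integral_dual_iterate_backward [IsProbabilityMeasure μ] {η₀ : Ω → Config}
    (hη₀ : Measurable η₀) (hleft : ∀ᵐ ω ∂μ, ∃ a : ℤ, ∀ y < a, η₀ ω y = false)
    (hp : 0 ≤ p) (hpq : p < q) (hsum : p + q = 1) (k : ℕ) (x : ℤ) (j : ℕ) :
    Tendsto (fun L : ℕ => ∫ ω, dual (p / q) ((backward p q (box L : Set ℤ))^[j] (posKernel k x))
      (restrict L (η₀ ω)) ∂μ) atTop
      (𝓝 (∑' B : Positions k, (backward p q Set.univ)^[j] (posKernel k x) B.1 *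
        initialCorr (p / q) μ η₀ B.1)) := by
  have hq : 0 < q := hp.trans_lt hpq
  have h0 : 0 ≤ p / q := div_nonneg hp hq.le
  have h1 : p / q < 1 := (div_lt_one hq).2 hpq
  have hb := posKernel_boundedKernel k x
  have hbΛ := fun Λ : Set ℤ => hb.iterate_backward hp hq.le hsum Λ j
  rw [(hasSum_mul_initialCorr hη₀ hleft h0 h1 (hbΛ Set.univ)).tsum_eq]
  refine tendsto_integral_of_dominated_convergence
    (fun _ => Real.exp (1 / (1 - p / q)) * (2 * k) ^ j)
    (fun L => (measurable_comp_restrict hη₀ _ L).aestronglyMeasurable) (integrable_const _)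
    (fun L => Eventually.of_forall fun ω =>
      (Real.norm_eq_abs _).trans_le (abs_dual_iterate_backward_le hp hpq hsum _ hb j _)) ?_
  filter_upwards [hleft] with ω hω
  obtain ⟨L, hL⟩ := (eventually_coe_filter_restrict hω (x + j)).exists
  rw [(hasSum_mul_prod_Qtilde h1.ne hL (hbΛ Set.univ).eq_zero_of_lt
    (iterate_backward_eq_zero_of_card_ne p q _ (posKernel_eq_zero_of_card_ne k x) j)).tsum_eq]
  exact tendsto_const_nhds.congr' ((eventually_dual_iterate_backward p q (p / q) hω hL
    fun Λ => (hbΛ Λ).eq_zero_of_lt).mono fun _ h => h.symm)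

/-! ### The coefficients as power series -/

theorem hasSum_rateMatrix_pow_positionsLE (p q : ℝ) (Λ : Set ℤ) (k : ℕ) (x : ℤ) (j : ℕ)
    (B : Finset ℤ) :
    HasSum (fun A : PositionsLE k x => ((rateMatrix p q Λ ^ j) (Finsupp.single B 1)) A.1)
      ((-1) ^ j * (backward p q Λ)^[j] (posKernel k x) B) := by
  classical
  set v := (rateMatrix p q Λ ^ j) (Finsupp.single B 1) with hv
  rw [← linearCombination_rateMatrix_pow_single, ← hv,
    linearCombination_eq_sum v.support fun A hA => by rw [Finsupp.notMem_support_iff.1 hA, mul_zero]]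
  have h1 : HasSum (fun A => posKernel k x A * v A) (∑ A ∈ v.support, posKernel k x A * v A) :=
    hasSum_sum_of_ne_finset_zero fun A hA => by rw [Finsupp.notMem_support_iff.1 hA, mul_zero]
  have h2 := (hasSum_subtype_iff_of_support_subset
    (s := {A : Finset ℤ | A.card = k ∧ ∀ a ∈ A, a ≤ x}) fun A hA => by
      by_contra h
      exact hA (by simp only [posKernel, if_neg (show ¬(A.card = k ∧ ∀ a ∈ A, a ≤ x) from h),
        zero_mul])).2 h1
  refine h2.congr_fun fun A => ?_
  change v A.1 = posKernel k x A.1 * v A.1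
  rw [posKernel, if_pos (show A.1.card = k ∧ ∀ a ∈ A.1, a ≤ x from A.2), one_mul]

/-- The order of summation matters for the estimate. Summing over A first gives (2k)^j and restricts
B to (-∞, x + j]; the correlations over such B have sum at most exp(1/(1-τ)) whatever j is; the
factorial then handles j. -/
theorem summable_triple [IsProbabilityMeasure μ] {η₀ : Ω → Config}
    (hη₀ : Measurable η₀) (hleft : ∀ᵐ ω ∂μ, ∃ a : ℤ, ∀ y < a, η₀ ω y = false)
    (hp : 0 ≤ p) (hpq : p < q) (hsum : p + q = 1) (k : ℕ) (x : ℤ) (t : ℝ) :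
    Summable fun z : (ℕ × Positions k) × PositionsLE k x =>
      (-t) ^ z.1.1 / (z.1.1.factorial : ℝ) *
        ((rateMatrix p q Set.univ ^ z.1.1) (Finsupp.single z.1.2.1 1)) z.2.1 *
          initialCorr (p / q) μ η₀ z.1.2.1 := by
  classical
  have hq : 0 < q := hp.trans_lt hpq
  have h0 : 0 ≤ p / q := div_nonneg hp hq.le
  have h1 : p / q < 1 := (div_lt_one hq).2 hpq
  have hM := fun B => initialCorr_nonneg (μ := μ) hleft h0 h1 B
  let b : ℕ × Positions k → ℝ := fun z => |t| ^ z.1 / z.1.factorial *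
    ((if ∀ y ∈ z.2.1, y ≤ x + z.1 then (2 * k : ℝ) ^ z.1 else 0) *
      initialCorr (p / q) μ η₀ z.2.1)
  have hb0 : ∀ z, 0 ≤ b z := fun z => by
    have := hM z.2.1
    simp only [b]
    split_ifs <;> positivity
  have hbs : Summable b := by
    have hsum1 : ∀ j, ∀ S : Finset (Positions k), ∑ B ∈ S, b (j, B) ≤
        |t| ^ j / j.factorial * (Real.exp (1 / (1 - p / q)) * (2 * k) ^ j) := by
      intro j S
      simp only [b]
      rw [← Finset.mul_sum, mul_comm (Real.exp _)]
      exact mul_le_mul_of_nonneg_left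
        (sum_positions_initialCorr_le hη₀ hleft h0 h1 (x + j) (by positivity) S) (by positivity)
    have hs : ∀ j, Summable fun B => b (j, B) := fun j =>
      summable_of_sum_le (fun B => hb0 _) (hsum1 j)
    rw [summable_prod_of_nonneg hb0]
    refine ⟨hs, Summable.of_nonneg_of_le (fun j => tsum_nonneg fun B => hb0 _) (fun j => ?_)
      (summable_pow_div_factorial_mul (Real.exp (1 / (1 - p / q))) (2 * k) |t|)⟩
    exact (hs j).tsum_le_of_sum_le (hsum1 j)
  rw [← summable_norm_iff, summable_prod_of_nonneg fun z => norm_nonneg _]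
  have hsum2 : ∀ z : ℕ × Positions k, ∀ S : Finset (PositionsLE k x),
      ∑ A ∈ S, ‖(-t) ^ z.1 / (z.1.factorial : ℝ) *
        ((rateMatrix p q Set.univ ^ z.1) (Finsupp.single z.2.1 1)) A.1 *
          initialCorr (p / q) μ η₀ z.2.1‖ ≤ b z := by
    intro z S
    have h := sum_abs_rateMatrix_pow_le hp hq.le hsum Set.univ z.1 (n := k) (z := x)
      (S.map (Function.Embedding.subtype _)) (fun A hA => by
        obtain ⟨A', -, rfl⟩ := Finset.mem_map.1 hA
        exact ⟨A'.2.1.le, A'.2.2⟩) z.2.1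
    rw [Finset.sum_map] at h
    simp only [Function.Embedding.subtype_apply] at h
    simp only [norm_mul, norm_div, norm_pow, norm_neg, Real.norm_eq_abs, Nat.abs_cast,
      abs_of_nonneg (hM _), b]
    rw [← Finset.sum_mul, ← Finset.mul_sum, mul_assoc]
    exact mul_le_mul_of_nonneg_left (mul_le_mul_of_nonneg_right h (hM _)) (by positivity)
  have hs2 := fun z => summable_of_sum_le (fun A => norm_nonneg _) (hsum2 z)
  exact ⟨hs2, Summable.of_nonneg_of_le (fun z => tsum_nonneg fun A => norm_nonneg _)
    (fun z => (hs2 z).tsum_le_of_sum_le (hsum2 z)) hbs⟩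

/-- Absolute convergence of the triple series permits summing over j first, which gives the
transition probabilities, or last, which gives a power series in t to compare with the boxes. -/
theorem summable_coeff_and_eq_tsum [IsProbabilityMeasure μ] {η₀ : Ω → Config}
    (hη₀ : Measurable η₀) (hleft : ∀ᵐ ω ∂μ, ∃ a : ℤ, ∀ y < a, η₀ ω y = false)
    (hp : 0 ≤ p) (hpq : p < q) (hsum : p + q = 1) (k : ℕ) (x : ℤ) (t : ℝ) :
    (Summable fun AB : PositionsLE k x × Positions k =>
      transProb p q Set.univ t AB.1.1 AB.2.1 * initialCorr (p / q) μ η₀ AB.2.1) ∧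
    coeff p q μ η₀ t x k = ∑' j : ℕ, t ^ j / j.factorial *
      ∑' B : Positions k, (backward p q Set.univ)^[j] (posKernel k x) B.1 *
        initialCorr (p / q) μ η₀ B.1 := by
  let F : (ℕ × Positions k) × PositionsLE k x → ℝ := fun z =>
    (-t) ^ z.1.1 / (z.1.1.factorial : ℝ) *
      ((rateMatrix p q Set.univ ^ z.1.1) (Finsupp.single z.1.2.1 1)) z.2.1 *
        initialCorr (p / q) μ η₀ z.1.2.1
  have hT : Summable F := summable_triple (μ := μ) hη₀ hleft hp hpq hsum k x t
  let e : (PositionsLE k x × Positions k) × ℕ ≃ (ℕ × Positions k) × PositionsLE k x :=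
    { toFun := fun z => ((z.2, z.1.2), z.1.1)
      invFun := fun z => ((z.2, z.1.2), z.1.1)
      left_inv := fun _ => rfl
      right_inv := fun _ => rfl }
  have hT' := e.summable_iff.2 hT
  have hS : Summable fun AB : PositionsLE k x × Positions k =>
      transProb p q Set.univ t AB.1.1 AB.2.1 * initialCorr (p / q) μ η₀ AB.2.1 := by
    refine hT'.prod.congr fun AB => ?_
    rw [transProb, ← tsum_mul_right]
    rfl
  refine ⟨hS, ?_⟩
  have h1 : coeff p q μ η₀ t x k = ∑' AB : PositionsLE k x × Positions k,
      transProb p q Set.univ t AB.1.1 AB.2.1 * initialCorr (p / q) μ η₀ AB.2.1 :=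
    hS.tsum_prod.symm
  have h2 : ∑' AB : PositionsLE k x × Positions k,
      transProb p q Set.univ t AB.1.1 AB.2.1 * initialCorr (p / q) μ η₀ AB.2.1 =
      ∑' z, (F ∘ e) z := (tsum_congr fun AB => by
        rw [transProb, ← tsum_mul_right]; rfl).trans hT'.tsum_prod.symm
  rw [h1, h2]
  refine (e.tsum_eq F).trans ?_
  rw [hT.tsum_prod, hT.prod.tsum_prod]
  refine tsum_congr fun j => ?_
  rw [← tsum_mul_left]
  refine tsum_congr fun B => ?_
  simp only [F]
  rw [tsum_mul_right, tsum_mul_left, (hasSum_rateMatrix_pow_positionsLE p q _ k x j B.1).tsum_eq,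
    neg_pow t]
  have : ((-1 : ℝ) ^ j) * (-1) ^ j = 1 := by rw [← mul_pow]; simp
  linear_combination (t ^ j / j.factorial * (backward p q Set.univ)^[j] (posKernel k x) B.1 *
    initialCorr (p / q) μ η₀ B.1) * this

/-- The moment kernel is split into its layers, and in each layer the Taylor series converges
termwise, dominated by t^j/j! · exp(1/(1-τ)) (2k)^j for every L. -/
theorem tendsto_tsum_boxTaylor [IsProbabilityMeasure μ] {η₀ : Ω → Config}
    (hη₀ : Measurable η₀) (hleft : ∀ᵐ ω ∂μ, ∃ a : ℤ, ∀ y < a, η₀ ω y = false)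
    (hp : 0 ≤ p) (hpq : p < q) (hsum : p + q = 1) (n : ℕ) (x : ℤ) (t : ℝ≥0) :
    Tendsto (fun L : ℕ => ∑' j : ℕ, (t : ℝ) ^ j / j.factorial * boxTaylor p q μ η₀ L n x j) atTop
      (𝓝 (dualitySum (p / q) n (coeff p q μ η₀ t x))) := by
  have hq : 0 < q := hp.trans_lt hpq
  have h0 : 0 ≤ p / q := div_nonneg hp hq.le
  have h1 : p / q < 1 := (div_lt_one hq).2 hpq
  set w : ℕ → ℝ := fun k => ∏ j ∈ Finset.range k, ((p / q) ^ (n - j) - 1) with hw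
  let J : ℕ → ℕ → ℝ := fun k j => ∑' B : Positions k,
    (backward p q Set.univ)^[j] (posKernel k x) B.1 * initialCorr (p / q) μ η₀ B.1
  let JL : ℕ → ℕ → ℕ → ℝ := fun L k j => ∫ ω, dual (p / q)
    ((backward p q (box L : Set ℤ))^[j] (posKernel k x)) (restrict L (η₀ ω)) ∂μ
  have hJb : ∀ L k j, |JL L k j| ≤ Real.exp (1 / (1 - p / q)) * (2 * k) ^ j := by
    intro L k j
    have h := norm_integral_le_of_norm_le_const (μ := μ) (f := fun ω => dual (p / q)
      ((backward p q (box L : Set ℤ))^[j] (posKernel k x)) (restrict L (η₀ ω)))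
      (Eventually.of_forall fun ω => (Real.norm_eq_abs _).trans_le <|
        abs_dual_iterate_backward_le hp hpq hsum (box L : Set ℤ) (posKernel_boundedKernel k x) j
        (restrict L (η₀ ω)))
    simpa [JL] using h
  have hbox : ∀ L j, boxTaylor p q μ η₀ L n x j = ∑ k ∈ Finset.range (n + 1), w k * JL L k j := by
    intro L j
    unfold boxTaylor
    rw [momentKernel_eq_sum, iterate_backward_sum]
    simp only [dual_sum, JL, ← integral_const_mul]
    rw [← integral_finsetSum]
    · refine integral_congr_ae (Eventually.of_forall fun ω => Finset.sum_congr rfl fun k _ => ?_)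
      simp only [dual, Finset.mul_sum, mul_assoc, hw]
    · intro k _
      refine (Integrable.of_bound (measurable_comp_restrict hη₀ _ L).aestronglyMeasurable
        (Real.exp (1 / (1 - p / q)) * (2 * k) ^ j) (Eventually.of_forall fun ω => ?_)).const_mul _
      exact (Real.norm_eq_abs _).trans_le (abs_dual_iterate_backward_le hp hpq hsum _
        (posKernel_boundedKernel k x) j _)
  have hsL : ∀ L k, Summable fun j : ℕ => (t : ℝ) ^ j / j.factorial * JL L k j := fun L k => by
    refine Summable.of_norm_bounded
      (summable_pow_div_factorial_mul (Real.exp (1 / (1 - p / q))) (2 * k) t) fun j => ?_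
    rw [norm_mul, Real.norm_of_nonneg (by positivity)]
    exact mul_le_mul_of_nonneg_left (hJb L k j) (by positivity)
  have hsplit : ∀ L, ∑' j : ℕ, (t : ℝ) ^ j / j.factorial * boxTaylor p q μ η₀ L n x j =
      ∑ k ∈ Finset.range (n + 1), w k * ∑' j : ℕ, (t : ℝ) ^ j / j.factorial * JL L k j := by
    intro L
    simp only [← tsum_mul_left]
    rw [← Summable.tsum_finsetSum fun k _ => (hsL L k).mul_left _]
    refine tsum_congr fun j => ?_
    rw [hbox, Finset.mul_sum]
    exact Finset.sum_congr rfl fun k _ => by ring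
  simp only [hsplit]
  refine tendsto_finsetSum _ fun k _ => Tendsto.const_mul _ ?_
  rw [(summable_coeff_and_eq_tsum hη₀ hleft hp hpq hsum k x t).2]
  refine tendsto_tsum_of_dominated_convergence
    (summable_pow_div_factorial_mul (Real.exp (1 / (1 - p / q))) (2 * k) t) (fun j => ?_)
    (Eventually.of_forall fun L j => ?_)
  · exact (tendsto_integral_dual_iterate_backward hη₀ hleft hp hpq hsum k x j).const_mul _
  · rw [norm_mul, Real.norm_of_nonneg (by positivity)]
    exact mul_le_mul_of_nonneg_left (hJb L k j) (by positivity)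

end Trajectories

/-! ### Jumps of càdlàg paths -/

theorem eventually_forall_mem_eq {α : Type*} {l : Filter α} {γ : α → Config} {ζ : Config}
    (h : Tendsto γ l (𝓝 ζ)) (S : Finset ℤ) : ∀ᶠ r in l, ∀ y ∈ S, γ r y = ζ y := by
  rw [Filter.eventually_all_finset]
  intro y _
  have h1 : Tendsto (fun r => γ r y) l (𝓝 (ζ y)) := (tendsto_pi_nhds.1 h) y
  rw [nhds_discrete, tendsto_pure] at h1
  exact h1

theorem exists_lt_forall_Ioo {γ : ℝ≥0 → Config} {ζ : Config} {s : ℝ≥0} (hs : 0 < s)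
    (h : Tendsto γ (𝓝[<] s) (𝓝 ζ)) (S : Finset ℤ) :
    ∃ l < s, ∀ u ∈ Set.Ioo l s, ∀ y ∈ S, γ u y = ζ y := by
  obtain ⟨l, hl, hl'⟩ := (mem_nhdsLT_iff_exists_Ioo_subset' hs).1 (eventually_forall_mem_eq h S)
  exact ⟨l, hl, fun u hu => hl' hu⟩

theorem exists_gt_forall_Ico {γ : ℝ≥0 → Config} {s : ℝ≥0}
    (h : ContinuousWithinAt γ (Set.Ici s) s) (S : Finset ℤ) :
    ∃ r > s, ∀ u ∈ Set.Ico s r, ∀ y ∈ S, γ u y = γ s y := by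
  obtain ⟨r, hr, hr'⟩ := (mem_nhdsGE_iff_exists_Ico_subset' (show s < s + 1 by simp)).1
    (eventually_forall_mem_eq h S)
  exact ⟨r, hr, fun u hu => hr' hu⟩

/-- At time `s` the path jumps from `v` to `v'`, as seen on the sites in `S`. -/
def JumpsAt (γ : ℝ≥0 → Config) (S : Finset ℤ) (v v' : S → Bool) (s : ℝ≥0) : Prop :=
  0 < s ∧ (∃ ζ, Tendsto γ (𝓝[<] s) (𝓝 ζ) ∧ ∀ y : S, ζ y = v y) ∧ ∀ y : S, γ s y = v' y

/-- A jump is seen on every sufficiently fine grid. -/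
theorem JumpsAt.eventually_exists {γ : ℝ≥0 → Config} {S : Finset ℤ} {v v' : S → Bool}
    {s t : ℝ≥0} (hs : JumpsAt γ S v v' s) (hst : s ≤ t)
    (hrc : ContinuousWithinAt γ (Set.Ici s) s) :
    ∀ᶠ N : ℕ in atTop, ∃ i < N, (∀ y : S, γ (t * i / N) y = v y) ∧
      ∀ y : S, γ (t * (i + 1) / N) y = v' y := by
  obtain ⟨h0, ⟨ζ, hζ, hv⟩, hv'⟩ := hs
  obtain ⟨l, hl, hl'⟩ := exists_lt_forall_Ioo h0 hζ S
  obtain ⟨r, hr, hr'⟩ := exists_gt_forall_Ico hrc S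
  have ht : 0 < t := h0.trans_le hst
  have htR : (0 : ℝ) < t := ht
  have hlim : Tendsto (fun N : ℕ => (t : ℝ) / N) atTop (𝓝 0) := tendsto_const_div_atTop_nhds_zero_nat _
  have hls : (0 : ℝ) < s - l := sub_pos.2 (by exact_mod_cast hl)
  have hrs : (0 : ℝ) < r - s := sub_pos.2 (by exact_mod_cast hr)
  filter_upwards [hlim.eventually (gt_mem_nhds hls), hlim.eventually (gt_mem_nhds hrs),
    eventually_gt_atTop 0] with N hN1 hN2 hN0
  have hNR : (0 : ℝ) < N := by exact_mod_cast hN0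
  -- c is the position of s in units of the mesh t/N. Rounding up gives t i/N < s ≤ t(i + 1)/N:
  -- strict on the left, where the left limit is read, and weak on the right, where right continuity
  -- is used.
  set c : ℝ := s * N / t with hc
  have hcpos : 0 < c := by
    have : (0 : ℝ) < s := h0
    positivity
  have hcN : c ≤ N := by
    rw [hc, div_le_iff₀ htR, mul_comm]
    exact mul_le_mul_of_nonneg_left (by exact_mod_cast hst) hNR.le
  obtain ⟨i, hi⟩ : ∃ i : ℕ, ⌈c⌉₊ = i + 1 :=
    Nat.exists_eq_succ_of_ne_zero (Nat.ceil_pos.2 hcpos).ne'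
  have hi1 : (i : ℝ) < c := by
    have := Nat.ceil_lt_add_one hcpos.le
    rw [hi] at this
    push_cast at this
    linarith
  have hi2 : c ≤ i + 1 := by
    have := Nat.le_ceil c
    rw [hi] at this
    exact_mod_cast this
  have e1 : (t : ℝ) * i / N < s := by
    rw [div_lt_iff₀ hNR]
    rw [hc, lt_div_iff₀ htR] at hi1
    linarith
  have e2 : (s : ℝ) ≤ t * (i + 1) / N := by
    rw [le_div_iff₀ hNR]
    rw [hc, div_le_iff₀ htR] at hi2
    linarith
  have e3 : (t : ℝ) * (i + 1) / N = t * i / N + t / N := by ring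
  refine ⟨i, ?_, fun y => ?_, fun y => ?_⟩
  · have : ⌈c⌉₊ ≤ N := Nat.ceil_le.2 hcN
    omega
  · rw [← hv y]
    refine hl' _ ⟨?_, ?_⟩ y y.2
    · rw [← NNReal.coe_lt_coe]; push_cast; linarith
    · rw [← NNReal.coe_lt_coe]; push_cast; exact e1
  · rw [← hv' y]
    refine hr' _ ⟨?_, ?_⟩ y y.2
    · rw [← NNReal.coe_le_coe]; push_cast; exact e2
    · rw [← NNReal.coe_lt_coe]; push_cast; linarith

/-- Continuity from below holds for arbitrary increasing sets, so no measurability of E is required.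
-/
theorem measure_eventually_le {Ω : Type*} {m : MeasurableSpace Ω} (μ : Measure Ω)
    (E : ℕ → Set Ω) {b : ℕ → ENNReal} {b' : ENNReal} (hb : ∀ᶠ N in atTop, μ (E N) ≤ b N)
    (hlim : Tendsto b atTop (𝓝 b')) : μ {ω | ∀ᶠ N in atTop, ω ∈ E N} ≤ b' := by
  have hmono : Monotone fun M => ⋂ N ≥ M, E N := by
    intro M M' h ω hω
    simp only [Set.mem_iInter] at hω ⊢
    exact fun N hN => hω N (h.trans hN)
  have hU : {ω | ∀ᶠ N in atTop, ω ∈ E N} = ⋃ M, ⋂ N ≥ M, E N := by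
    ext ω
    simp [eventually_atTop]
  rw [hU]
  refine le_of_tendsto_of_tendsto (tendsto_measure_iUnion_atTop hmono) hlim ?_
  filter_upwards [hb] with M hM
  exact (measure_mono (Set.iInter₂_subset M le_rfl)).trans hM

/-- The indicator function of a pattern on the sites in `S`. -/
def pattern (S : Finset ℤ) (v : S → Bool) (ζ : Config) : ℝ :=
  if ∀ y : S, ζ y = v y then 1 else 0

theorem pattern_dependsOn (S : Finset ℤ) (v : S → Bool) :
    DependsOn (pattern S v) (S : Set ℤ) := by
  intro ζ ζ' h
  have : (∀ y : S, ζ y = v y) ↔ ∀ y : S, ζ' y = v y :=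
    forall_congr' fun y => by rw [h y y.2]
  simp only [pattern, this]

/-! ### Probabilities of jumps in a finite window -/

section Trajectories

variable {Ω : Type*} {m : MeasurableSpace Ω} {μ : Measure Ω} {p q : ℝ}
  {ℱ : Filtration ℝ≥0 m} {η : ℝ≥0 → Ω → Config}

theorem measurableSet_pattern (S : Finset ℤ) (v : S → Bool) :
    MeasurableSet {ζ : Config | ∀ y : S, ζ y = v y} := by
  have h := DependsOn.measurable (pattern_dependsOn S v) (measurableSet_singleton 1)
  convert h using 1
  ext ζ
  simp [pattern]

theorem IsASEP.measureReal_pattern_pattern (hη : IsASEP p q μ ℱ η) (S : Finset ℤ)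
    (v v' : S → Bool) (s u : ℝ≥0) :
    μ.real {ω | (∀ y : S, η s ω y = v y) ∧ ∀ y : S, η u ω y = v' y} =
      ∫ ω in {ω | ∀ y : S, η s ω y = v y}, pattern S v' (η u ω) ∂μ := by
  have hm := hη.measurable u (measurableSet_pattern S v')
  have h2 : (fun ω => pattern S v' (η u ω)) =
      Set.indicator (η u ⁻¹' {ζ : Config | ∀ y : S, ζ y = v' y}) 1 := by
    funext ω
    simp [pattern, Set.indicator_apply]
  rw [h2, integral_indicator_one hm, measureReal_restrict_apply hm, Set.inter_comm]
  rfl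

/-- If the transition rate between two patterns is controlled by `ε` then so is the probability
that a jump between them occurs. -/
theorem IsASEP.measure_exists_jumpsAt_le [IsProbabilityMeasure μ] (hη : IsASEP p q μ ℱ η)
    (S : Finset ℤ) (v v' : S → Bool) (t : ℝ≥0) {b : ℕ → ℝ} {b' : ℝ}
    (hlim : Tendsto b atTop (𝓝 b'))
    (hb : ∀ s u : ℝ≥0, s ≤ u → u ≤ t → ∀ N : ℕ, 0 < N → (u : ℝ) - s = t / N →
      μ.real {ω | (∀ y : S, η s ω y = v y) ∧ ∀ y : S, η u ω y = v' y} ≤ b N / N) :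
    μ {ω | ∃ s ≤ t, JumpsAt (fun r => η r ω) S v v' s} ≤ ENNReal.ofReal b' := by
  let E : ℕ → Set Ω := fun N => ⋃ i ∈ Finset.range N,
    {ω | (∀ y : S, η (t * i / N) ω y = v y) ∧ ∀ y : S, η (t * (i + 1) / N) ω y = v' y}
  have hsub : {ω | ∃ s ≤ t, JumpsAt (fun r => η r ω) S v v' s} ⊆
      {ω | ∀ᶠ N in atTop, ω ∈ E N} := by
    rintro ω ⟨s, hst, hs⟩
    filter_upwards [hs.eventually_exists hst (hη.right_continuous ω s)] with N hN
    obtain ⟨i, hi, h1, h2⟩ := hN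
    simp only [E, Set.mem_iUnion]
    exact ⟨i, Finset.mem_range.2 hi, h1, h2⟩
  refine (measure_mono hsub).trans (measure_eventually_le μ E (b := fun N => ENNReal.ofReal (b N))
    ?_ (ENNReal.tendsto_ofReal hlim))
  filter_upwards [eventually_gt_atTop 0] with N hN
  have hNR : (0 : ℝ) < N := by exact_mod_cast hN
  have hreal : μ.real (E N) ≤ b N := by
    calc μ.real (E N) ≤ ∑ i ∈ Finset.range N, b N / N := by
          refine (measureReal_biUnion_finset_le _ _).trans (Finset.sum_le_sum fun i hi => ?_)
          refine hb _ _ ?_ ?_ N hN ?_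
          · gcongr
            simp
          · rw [← NNReal.coe_le_coe]
            push_cast
            rw [div_le_iff₀ hNR]
            refine mul_le_mul_of_nonneg_left ?_ t.2
            have := Finset.mem_range.1 hi
            exact_mod_cast this
          · push_cast; ring
      _ = b N := by
          rw [Finset.sum_const, Finset.card_range, nsmul_eq_mul]
          field_simp
  rw [← ofReal_measureReal (measure_ne_top μ _)]
  exact ENNReal.ofReal_le_ofReal hreal

/-- The pattern `v` can be turned into `v'` by an exchange. -/
def IsExchange (S : Finset ℤ) (v v' : S → Bool) : Prop :=
  v = v' ∨ ∃ (ξ : Config) (x : ℤ), (∀ y : S, ξ y = v y) ∧ ∀ y : S, exchange x ξ y = v' y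

/-- Such a jump needs at least two exchanges: the window must leave v before v' can be reached.
Seeing v and then v' across a grid cell of length t/N thus has probability at most K'K(t/N)^2, and N
cells contribute O(1/N). -/
theorem IsASEP.measure_exists_jumpsAt_eq_zero [IsProbabilityMeasure μ] (hη : IsASEP p q μ ℱ η)
    (S : Finset ℤ) (v v' : S → Bool) (hbad : ¬ IsExchange S v v') (t : ℝ≥0) :
    μ {ω | ∃ s ≤ t, JumpsAt (fun r => η r ω) S v v' s} = 0 := by
  rw [IsExchange, not_or] at hbad
  obtain ⟨hne, hex⟩ := hbad
  obtain ⟨T, hT⟩ := generator_dependsOn p q (pattern_dependsOn S v)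
  obtain ⟨T', hT'⟩ := generator_dependsOn p q (pattern_dependsOn S v')
  obtain ⟨K, hK⟩ := DependsOn.exists_bound hT
  obtain ⟨K', hK'⟩ := DependsOn.exists_bound hT'
  have hK0 : 0 ≤ K := (abs_nonneg _).trans (hK fun _ => false)
  have hK0' : 0 ≤ K' := (abs_nonneg _).trans (hK' fun _ => false)
  -- the rate at which `v'` is reached vanishes on `v`
  have hgen : ∀ ζ, generator p q (pattern S v') ζ ≤ K' * (1 - pattern S v ζ) := by
    intro ζ
    by_cases hζ : ∀ y : S, ζ y = v y
    · have h1 : ∀ x, pattern S v' (exchange x ζ) = 0 := fun x =>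
        if_neg fun h => hex ⟨ζ, x, hζ, h⟩
      have h2 : pattern S v' ζ = 0 := if_neg fun h => hne (funext fun y => by rw [← hζ, h])
      rw [generator_eq_sum p q (pattern_dependsOn S v')]
      simp [h1, h2, show pattern S v ζ = 1 from if_pos hζ]
    · have h1 : pattern S v ζ = 0 := if_neg hζ
      rw [h1, sub_zero, mul_one]
      exact (le_abs_self _).trans (hK' ζ)
  have hlim : Tendsto (fun N : ℕ => K' * K * t ^ 2 / (N : ℝ)) atTop (𝓝 0) :=
    tendsto_const_div_atTop_nhds_zero_nat _
  refine le_antisymm ((hη.measure_exists_jumpsAt_le S v v' t hlim ?_).trans (by simp))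
    zero_le
  intro s u hsu hut N hN hdiff
  set F : Set Ω := {ω | ∀ y : S, η s ω y = v y} with hF
  have hFm : MeasurableSet[ℱ s] F := (hη.adapted s) (measurableSet_pattern S v)
  have hFm' : MeasurableSet F := ℱ.le s _ hFm
  have hi : ∀ r, Integrable (fun ω => pattern S v (η r ω)) (μ.restrict F) := fun r =>
    (hη.integrable_comp (pattern_dependsOn S v) r).integrableOn
  have hs1 : ∫ ω in F, pattern S v (η s ω) ∂μ = ∫ ω in F, 1 ∂μ :=
    setIntegral_congr_fun hFm' fun ω hω => if_pos hω
  have hs0 : ∫ ω in F, pattern S v' (η s ω) ∂μ = 0 :=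
    setIntegral_eq_zero_of_forall_eq_zero fun ω hω =>
      if_neg fun h => hne (funext fun y => by rw [← hω y, h y])
  -- leaving `v` takes time
  have hstay : ∀ r : ℝ, (s : ℝ) ≤ r → ∫ ω in F, (1 - pattern S v (η r.toNNReal ω)) ∂μ ≤
      K * (r - s) := by
    intro r hr
    have hr0 : 0 ≤ r := s.2.trans hr
    have hD := hη.setIntegral_sub (pattern_dependsOn S v)
      (show s ≤ r.toNNReal from NNReal.le_toNNReal_of_coe_le hr) hFm
    rw [integral_sub (integrable_const _) (hi _), ← hs1]
    rw [Real.coe_toNNReal r hr0] at hD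
    have hbd := intervalIntegral.norm_integral_le_of_norm_le_const (a := (s : ℝ)) (b := r) (C := K)
      (f := fun u => ∫ ω in F, generator p q (pattern S v) (η u.toNNReal ω) ∂μ) fun u _ => by
        refine (norm_setIntegral_le_of_norm_le_const (measure_lt_top μ F) fun ω _ => hK _).trans ?_
        exact mul_le_of_le_one_right hK0 measureReal_le_one
    rw [← hD, Real.norm_eq_abs, abs_of_nonneg (sub_nonneg.2 hr)] at hbd
    linarith [neg_abs_le (∫ ω in F, pattern S v (η r.toNNReal ω) ∂μ -
      ∫ ω in F, pattern S v (η s ω) ∂μ)]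
  rw [hη.measureReal_pattern_pattern]
  have hD := hη.setIntegral_sub (pattern_dependsOn S v') hsu hFm
  rw [hs0, sub_zero] at hD
  have hsu' : (s : ℝ) ≤ u := hsu
  calc ∫ ω in F, pattern S v' (η u ω) ∂μ
      = ∫ r in (s : ℝ)..u, ∫ ω in F, generator p q (pattern S v') (η r.toNNReal ω) ∂μ := hD
    _ ≤ ∫ r in (s : ℝ)..u, K' * (K * (u - s)) := by
        refine intervalIntegral.integral_mono_on hsu'
          (hη.intervalIntegrable_setIntegral hT' _ _ F) intervalIntegrable_const fun r hr => ?_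
        calc ∫ ω in F, generator p q (pattern S v') (η r.toNNReal ω) ∂μ
            ≤ ∫ ω in F, K' * (1 - pattern S v (η r.toNNReal ω)) ∂μ :=
              integral_mono (hη.integrable_comp hT' _).integrableOn
                (((integrable_const _).sub (hi _)).const_mul _) fun ω => hgen _
          _ = K' * ∫ ω in F, (1 - pattern S v (η r.toNNReal ω)) ∂μ := integral_const_mul _ _
          _ ≤ K' * (K * (r - s)) := mul_le_mul_of_nonneg_left (hstay r hr.1) hK0'
          _ ≤ K' * (K * (u - s)) := by
              have := hr.2
              gcongr
    _ = K' * K * t ^ 2 / N / N := by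
        rw [intervalIntegral.integral_const, smul_eq_mul, hdiff]
        field_simp

theorem IsASEP.ae_isExchange [IsProbabilityMeasure μ] (hη : IsASEP p q μ ℱ η)
    (S : Finset ℤ) (t : ℝ≥0) :
    ∀ᵐ ω ∂μ, ∀ v v', ∀ s ≤ t, JumpsAt (fun r => η r ω) S v v' s → IsExchange S v v' := by
  rw [ae_all_iff]
  intro v
  rw [ae_all_iff]
  intro v'
  by_cases h : IsExchange S v v'
  · exact Eventually.of_forall fun ω s _ _ => h
  · have := hη.measure_exists_jumpsAt_eq_zero S v v' h t
    rw [← compl_mem_ae_iff] at this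
    filter_upwards [this] with ω hω s hs hj
    exact absurd ⟨s, hs, hj⟩ hω

/-- With probability one there are sites arbitrarily far to the left where no particle arrives
before time `t`. -/
theorem IsASEP.ae_exists_le_not_jumpsAt [IsProbabilityMeasure μ] (hη : IsASEP p q μ ℱ η)
    (hp : 0 ≤ p) (hq : 0 ≤ q)
    (hsum : p + q = 1) (hleft : ∀ᵐ ω ∂μ, ∃ a : ℤ, ∀ y < a, η 0 ω y = false) (t : ℝ≥0) :
    ∀ᵐ ω ∂μ, ∀ k : ℤ, ∃ a ≤ k, ∀ s ≤ t,
      ¬ JumpsAt (fun r => η r ω) {a} (fun _ => false) (fun _ => true) s := by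
  rw [ae_all_iff]
  intro k
  rw [ae_iff]
  have key : ∀ ε : ℝ, 0 < ε → μ {ω | ¬ ∃ a ≤ k, ∀ s ≤ t,
      ¬ JumpsAt (fun r => η r ω) {a} (fun _ => false) (fun _ => true) s} ≤
      ENNReal.ofReal (ε * t) := by
    intro ε hε
    have hev := hη.eventually_integral_occ_le hp hq hsum hleft t hε
    -- A particle can arrive at a only from a - 1 or a + 1. With both occupied with probability at
    -- most ε, arrivals have rate at most pε + qε = ε.
    obtain ⟨a, ⟨ha1, ha2⟩, hak⟩ := ((((tendsto_atBot_add_const_right atBot (-1 : ℤ)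
      tendsto_id).eventually hev).and ((tendsto_atBot_add_const_right atBot (1 : ℤ)
      tendsto_id).eventually hev)).and (eventually_le_atBot k)).exists
    refine (measure_mono (t := {ω | ∃ s ≤ t, JumpsAt (fun r => η r ω) {a} (fun _ => false)
      (fun _ => true) s}) fun ω hω => ?_).trans (hη.measure_exists_jumpsAt_le {a} _ _ t
        (b := fun _ => ε * t) tendsto_const_nhds ?_)
    · by_contra h
      refine hω ⟨a, hak, fun s hs hj => h ⟨s, hs, hj⟩⟩
    · intro s u hsu hut N hN hdiff
      rw [hη.measureReal_pattern_pattern]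
      set F : Set Ω := {ω | ∀ y : ({a} : Finset ℤ), η s ω y = false} with hF
      have hFm : MeasurableSet[ℱ s] F :=
        (hη.adapted s) (measurableSet_pattern {a} fun _ => false)
      have hpo : ∀ ζ, pattern {a} (fun _ => true) ζ = occ a ζ := fun ζ => by
        simp [pattern, occ]
      simp only [hpo]
      have hs0 : ∫ ω in F, occ a (η s ω) ∂μ = 0 := by
        rw [setIntegral_congr_fun (g := fun _ => (0 : ℝ)) (ℱ.le s _ hFm)]
        · simp
        · intro ω hω
          have := hω ⟨a, by simp⟩
          simp only at this
          simp [occ, this]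
      have hD := hη.setIntegral_sub (occ_dependsOn a) hsu hFm
      rw [hs0, sub_zero] at hD
      obtain ⟨T, hT⟩ := generator_dependsOn p q (occ_dependsOn a)
      have io : ∀ a r, Integrable (fun ω => occ a (η r ω)) μ := fun a r =>
        hη.integrable_comp (occ_dependsOn a) _
      have hle : ∀ a r, ∫ ω in F, occ a (η r ω) ∂μ ≤ ∫ ω, occ a (η r ω) ∂μ := fun a r =>
        setIntegral_le_integral (io a r) (Eventually.of_forall fun ω => occ_nonneg a _)
      calc ∫ ω in F, occ a (η u ω) ∂μ
          = ∫ r in (s : ℝ)..u, ∫ ω in F, generator p q (occ a) (η r.toNNReal ω) ∂μ := hD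
        _ ≤ ∫ r in (s : ℝ)..u, ε := by
            refine intervalIntegral.integral_mono_on hsu
              (hη.intervalIntegrable_setIntegral hT _ _ F) intervalIntegrable_const fun r hr => ?_
            have hr' : r.toNNReal ≤ t := by
              rw [Real.toNNReal_le_iff_le_coe]
              exact hr.2.trans (by exact_mod_cast hut)
            calc ∫ ω in F, generator p q (occ a) (η r.toNNReal ω) ∂μ
                ≤ ∫ ω in F, (p * occ (a - 1) (η r.toNNReal ω) +
                    q * occ (a + 1) (η r.toNNReal ω)) ∂μ :=
                  integral_mono (hη.integrable_comp hT _).integrableOn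
                    (((io _ _).integrableOn.const_mul p).add ((io _ _).integrableOn.const_mul q))
                    fun ω => generator_occ_le hp hq a _
              _ = p * ∫ ω in F, occ (a - 1) (η r.toNNReal ω) ∂μ +
                    q * ∫ ω in F, occ (a + 1) (η r.toNNReal ω) ∂μ := by
                  rw [integral_add ((io _ _).integrableOn.const_mul p)
                    ((io _ _).integrableOn.const_mul q), integral_const_mul, integral_const_mul]
              _ ≤ p * ε + q * ε := by
                  have h1 := (hle (a - 1) r.toNNReal).trans (ha1 _ hr')
                  have h2 := (hle (a + 1) r.toNNReal).trans (ha2 _ hr')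
                  gcongr
              _ = ε := by rw [← add_mul, hsum, one_mul]
        _ = ε * t / N := by
            rw [intervalIntegral.integral_const, smul_eq_mul, hdiff]
            ring
  have hlim : Tendsto (fun ε : ℝ => ENNReal.ofReal (ε * t)) (𝓝[>] 0) (𝓝 0) := by
    have h : Tendsto (fun ε : ℝ => ENNReal.ofReal (ε * t)) (𝓝 0) (𝓝 (ENNReal.ofReal (0 * t))) :=
      ENNReal.tendsto_ofReal ((continuous_id.mul continuous_const).tendsto 0)
    rw [zero_mul, ENNReal.ofReal_zero] at h
    exact h.mono_left nhdsWithin_le_nhds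
  exact le_antisymm (ge_of_tendsto hlim (by
    filter_upwards [self_mem_nhdsWithin] with ε hε using key ε hε)) zero_le

end Trajectories

/-! ### The integrated current along a path -/

/-- Real induction: at the infimum of the bad times P holds by `h0` or `hL`, and `hR` carries it
beyond, a contradiction. For càdlàg paths `hR` is right continuity and `hL` inspects a possible
jump. -/
theorem nnreal_induction {P : ℝ≥0 → Prop} {t : ℝ≥0} (h0 : P 0)
    (hR : ∀ r < t, P r → ∃ r' > r, ∀ u ∈ Set.Ioo r r', P u)
    (hL : ∀ s, 0 < s → s ≤ t → (∀ u < s, P u) → P s) : ∀ r ≤ t, P r := by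
  by_contra! hcon
  obtain ⟨r₁, hr₁, hPr₁⟩ := hcon
  set B : Set ℝ≥0 := {r | ¬ P r} with hB
  have hne : B.Nonempty := ⟨r₁, hPr₁⟩
  set s := sInf B with hs
  have hlt : ∀ u < s, P u := fun u hu => by
    by_contra h
    exact absurd (csInf_le' (s := B) h) (not_le.2 hu)
  have hst : s ≤ r₁ := csInf_le' (s := B) hPr₁
  have hPs : P s := by
    rcases eq_or_ne s 0 with h | h
    · rw [h]; exact h0
    · exact hL s (pos_iff_ne_zero.2 h) (hst.trans hr₁) hlt
  have hslt : s < r₁ := lt_of_le_of_ne hst fun h => hPr₁ (h ▸ hPs)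
  obtain ⟨r', hr', hP⟩ := hR s (hslt.trans_le hr₁) hPs
  obtain ⟨u, hu, hur⟩ := exists_lt_of_csInf_lt hne hr'
  have hsu : s ≤ u := csInf_le' (s := B) hu
  rcases eq_or_lt_of_le hsu with h | h
  · exact hu (h ▸ hPs)
  · exact hu (hP u ⟨h, hur⟩)

theorem forall_eq_false_of_not_jumpsAt {γ : ℝ≥0 → Config}
    (hrc : ∀ s, ContinuousWithinAt γ (Set.Ici s) s)
    (hll : ∀ s, ∃ ζ : Config, Tendsto γ (𝓝[<] s) (𝓝 ζ)) {a : ℤ} {t : ℝ≥0} (h0 : γ 0 a = false)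
    (hj : ∀ s ≤ t, ¬ JumpsAt γ {a} (fun _ => false) (fun _ => true) s) :
    ∀ s ≤ t, γ s a = false := by
  refine nnreal_induction h0 (fun r _ hr => ?_) fun s hs hst hP => ?_
  · obtain ⟨r', hr', h⟩ := exists_gt_forall_Ico (hrc r) {a}
    exact ⟨r', hr', fun u hu => (h u ⟨hu.1.le, hu.2⟩ a (by simp)).trans hr⟩
  · obtain ⟨ζ, hζ⟩ := hll s
    obtain ⟨l, hl, hl'⟩ := exists_lt_forall_Ioo hs hζ {a}
    obtain ⟨u, hu⟩ := exists_between hl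
    have hζa : ζ a = false := by
      rw [← hl' u hu a (by simp)]; exact hP u hu.2
    by_contra hne
    refine hj s hst ⟨hs, ⟨ζ, hζ, fun y => ?_⟩, fun y => ?_⟩
    · rw [Finset.mem_singleton.1 y.2, hζa]
    · rw [Finset.mem_singleton.1 y.2]; simpa using hne

/-- The number of particles in `[a, x]`. -/
noncomputable def countIcc (a x : ℤ) (ζ : Config) : ℤ := ∑ y ∈ Finset.Icc a x, if ζ y = true then 1 else 0

theorem countIcc_congr {a x : ℤ} {ζ ζ' : Config} (h : ∀ y ∈ Finset.Icc a x, ζ y = ζ' y) :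
    countIcc a x ζ = countIcc a x ζ' :=
  Finset.sum_congr rfl fun y hy => by rw [h y hy]

/-- The signed number of particles that hop from `x + 1` to `x` if `ζ` turns into `ζ'`. -/
def hopSign (x : ℤ) (ζ ζ' : Config) : ℤ :=
  (if (ζ (x + 1) = true ∧ ζ x = false) ∧ ζ' (x + 1) = false ∧ ζ' x = true then 1 else 0) -
  (if (ζ x = true ∧ ζ (x + 1) = false) ∧ ζ' x = false ∧ ζ' (x + 1) = true then 1 else 0)

theorem hopSign_congr {x : ℤ} {ζ ζ' ξ ξ' : Config} (h0 : ζ x = ξ x) (h1 : ζ (x + 1) = ξ (x + 1))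
    (h2 : ζ' x = ξ' x) (h3 : ζ' (x + 1) = ξ' (x + 1)) : hopSign x ζ ζ' = hopSign x ξ ξ' := by
  simp only [hopSign, h0, h1, h2, h3]

theorem hopSign_of_eq {x : ℤ} {ζ ζ' : Config} (h : ζ' x = ζ x ∨ ζ' (x + 1) = ζ (x + 1)) :
    hopSign x ζ ζ' = 0 := by
  unfold hopSign
  rcases h with h | h <;> rw [h] <;> cases ζ x <;> cases ζ (x + 1) <;> simp

/-- An exchange inside [a, x] permutes its sites and one at the bond of x is the hop being counted.
The only other bond meeting the interval is that between a - 1 and a, which `ha` renders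
ineffective. -/
theorem countIcc_exchange {a x : ℤ} (hax : a ≤ x) (ξ : Config) (z : ℤ)
    (ha : exchange z ξ a = ξ a) :
    countIcc a x (exchange z ξ) - countIcc a x ξ = hopSign x ξ (exchange z ξ) := by
  by_cases hzx : z = x
  · subst hzx
    have hI : Finset.Icc a z = insert z (Finset.Icc a (z - 1)) := by
      ext y; simp only [Finset.mem_Icc, Finset.mem_insert]; omega
    have hn : z ∉ Finset.Icc a (z - 1) := by simp
    have hr : countIcc a (z - 1) (exchange z ξ) = countIcc a (z - 1) ξ :=
      countIcc_congr fun y hy => by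
        rw [Finset.mem_Icc] at hy
        exact exchange_apply_of_ne (by omega) (by omega) ξ
    unfold countIcc at hr ⊢
    rw [hI, Finset.sum_insert hn, Finset.sum_insert hn, hr, hopSign, exchange_apply_left,
      exchange_apply_right]
    cases ξ z <;> cases ξ (z + 1) <;> simp
  · have hh : hopSign x ξ (exchange z ξ) = 0 := by
      apply hopSign_of_eq
      by_cases h : z = x + 1
      · exact Or.inl (exchange_apply_of_ne (by omega) (by omega) ξ)
      · exact Or.inr (exchange_apply_of_ne (by omega) (by omega) ξ)
    rw [hh, sub_eq_zero]
    by_cases hin : a ≤ z ∧ z < x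
    · unfold countIcc exchange
      refine Finset.sum_equiv (Equiv.swap z (z + 1)) (fun y => ?_) fun y _ => rfl
      rw [Equiv.swap_apply_def]
      simp only [Finset.mem_Icc]
      split_ifs <;> omega
    · refine countIcc_congr fun y hy => ?_
      rw [Finset.mem_Icc] at hy
      by_cases hya : y = a
      · rw [hya, ha]
      · exact exchange_apply_of_ne (by omega) (by omega) ξ

theorem hopsAt_iff {γ : ℝ≥0 → Config} {s : ℝ≥0} {ζ : Config} (hs : 0 < s)
    (hζ : Tendsto γ (𝓝[<] s) (𝓝 ζ)) (b c : ℤ) :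
    HopsAt γ b c s ↔ (ζ b = true ∧ ζ c = false) ∧ γ s b = false ∧ γ s c = true := by
  have hev := eventually_forall_mem_eq hζ {b, c}
  have : NeBot (𝓝[<] s) := nhdsLT_neBot_of_exists_lt ⟨0, hs⟩
  rw [HopsAt]
  refine ⟨fun h => ⟨?_, h.2.2⟩, fun h => ⟨hs, ?_, h.2⟩⟩
  · obtain ⟨r, h1, h2⟩ := (hev.and h.2.1).exists
    rwa [h1 b (by simp), h1 c (by simp)] at h2
  · filter_upwards [hev] with r hr
    rw [hr b (by simp), hr c (by simp)]
    exact h.1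

/-- The hops from `b` to `c` up to time `t`. -/
def hopTimes (γ : ℝ≥0 → Config) (b c : ℤ) (t : ℝ≥0) : Set ℝ≥0 := {s | s ≤ t ∧ HopsAt γ b c s}

theorem hopTimes_zero (γ : ℝ≥0 → Config) (b c : ℤ) : hopTimes γ b c 0 = ∅ := by
  ext s
  simp only [hopTimes, Set.mem_ofPred_eq, Set.mem_empty_iff_false, iff_false, not_and]
  intro h h'
  exact absurd h'.1 (not_lt.2 h)

theorem not_hopsAt_of_forall_Ioo {γ : ℝ≥0 → Config} {l r : ℝ≥0} {ζ : Config} {b c : ℤ}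
    (h : ∀ u ∈ Set.Ioo l r, γ u b = ζ b) {s : ℝ≥0} (hs : s ∈ Set.Ioo l r) :
    ¬ HopsAt γ b c s := by
  intro hh
  have : NeBot (𝓝[<] s) := nhdsLT_neBot_of_exists_lt ⟨l, hs.1⟩
  obtain ⟨u, hu, hu'⟩ := (hh.2.1.and (Ioo_mem_nhdsLT hs.1)).exists
  have h1 := h u ⟨hu'.1, hu'.2.trans hs.2⟩
  have h2 := h s hs
  have h3 := hh.2.2.1
  rw [h2, ← h1, hu.1] at h3
  simp at h3

theorem hopTimes_eq_of_forall_Ioc {γ : ℝ≥0 → Config} {r u : ℝ≥0} {b c : ℤ} (hru : r ≤ u)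
    (h : ∀ s ∈ Set.Ioc r u, ¬ HopsAt γ b c s) : hopTimes γ b c u = hopTimes γ b c r := by
  ext s
  simp only [hopTimes, Set.mem_ofPred_eq]
  refine and_congr_left fun hs => ⟨fun hsu => ?_, fun hsr => hsr.trans hru⟩
  by_contra hsr
  exact h s ⟨not_le.1 hsr, hsu⟩ hs

theorem hopTimes_eq_union {γ : ℝ≥0 → Config} {u s : ℝ≥0} {b c : ℤ} (hus : u < s)
    (h : ∀ r ∈ Set.Ioo u s, ¬ HopsAt γ b c r) :
    hopTimes γ b c s = hopTimes γ b c u ∪ {r | r = s ∧ HopsAt γ b c s} := by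
  ext r
  simp only [hopTimes, Set.mem_ofPred_eq, Set.mem_union]
  constructor
  · rintro ⟨h1, h2⟩
    rcases eq_or_lt_of_le h1 with h3 | h3
    · exact Or.inr ⟨h3, h3 ▸ h2⟩
    · refine Or.inl ⟨?_, h2⟩
      by_contra h4
      exact h r ⟨not_le.1 h4, h3⟩ h2
  · rintro (⟨h1, h2⟩ | ⟨h1, h2⟩)
    · exact ⟨h1.trans hus.le, h2⟩
    · exact ⟨h1.le, h1 ▸ h2⟩

open Classical in
theorem finite_and_ncard_hopTimes {γ : ℝ≥0 → Config} {u s : ℝ≥0} {b c : ℤ} (hus : u < s)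
    (h : ∀ r ∈ Set.Ioo u s, ¬ HopsAt γ b c r) (hf : (hopTimes γ b c u).Finite) :
    (hopTimes γ b c s).Finite ∧ ((hopTimes γ b c s).ncard : ℤ) =
      (hopTimes γ b c u).ncard + if HopsAt γ b c s then 1 else 0 := by
  rw [hopTimes_eq_union hus h]
  split_ifs with hh
  · have : {r | r = s ∧ HopsAt γ b c s} = {s} := by ext r; simp [hh]
    rw [this, Set.union_singleton, Set.ncard_insert_of_notMem _ hf]
    · exact ⟨hf.insert s, by push_cast; ring⟩
    · exact fun hs => absurd hs.1 (not_le.2 hus)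
  · have : {r | r = s ∧ HopsAt γ b c s} = ∅ := by ext r; simp [hh]
    rw [this, Set.union_empty]
    exact ⟨hf, by simp⟩

theorem countIcc_sub_eq_hopSign {a x : ℤ} (hax : a ≤ x) {ζ ζ' : Config} (hζ : ζ a = false)
    (hζ' : ζ' a = false)
    (hex : IsExchange (Finset.Icc a (x + 1)) (fun y => ζ y) (fun y => ζ' y)) :
    countIcc a x ζ' - countIcc a x ζ = hopSign x ζ ζ' := by
  have hI : ∀ {y}, y ∈ Finset.Icc a x → y ∈ Finset.Icc a (x + 1) := fun {y} hy => by
    rw [Finset.mem_Icc] at hy ⊢; omega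
  have ha : a ∈ Finset.Icc a (x + 1) := by rw [Finset.mem_Icc]; omega
  have hx : x ∈ Finset.Icc a (x + 1) := by rw [Finset.mem_Icc]; omega
  have hx1 : x + 1 ∈ Finset.Icc a (x + 1) := by rw [Finset.mem_Icc]; omega
  rcases hex with h | ⟨ξ, z, h1, h2⟩
  · have h' : ∀ y ∈ Finset.Icc a (x + 1), ζ y = ζ' y := fun y hy => congrFun h ⟨y, hy⟩
    rw [countIcc_congr fun y hy => h' y (hI hy), sub_self,
      hopSign_of_eq (Or.inl (h' x hx).symm)]
  · have h1' : ∀ y ∈ Finset.Icc a (x + 1), ξ y = ζ y := fun y hy => h1 ⟨y, hy⟩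
    have h2' : ∀ y ∈ Finset.Icc a (x + 1), exchange z ξ y = ζ' y := fun y hy => h2 ⟨y, hy⟩
    rw [← countIcc_congr fun y hy => h1' y (hI hy), ← countIcc_congr fun y hy => h2' y (hI hy),
      countIcc_exchange hax ξ z (by rw [h2' a ha, h1' a ha, hζ, hζ'])]
    exact hopSign_congr (h1' x hx) (h1' _ hx1) (h2' x hx) (h2' _ hx1)

/-- Conservation of particles in [a, x]: the site a remains empty, so nothing crosses the left end.
The observed window includes x + 1, so that hops across the right end are visible. -/
theorem current_eq_countIcc {γ : ℝ≥0 → Config}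
    (hrc : ∀ s, ContinuousWithinAt γ (Set.Ici s) s)
    (hll : ∀ s, ∃ ζ : Config, Tendsto γ (𝓝[<] s) (𝓝 ζ)) {a x : ℤ} (hax : a ≤ x) {t : ℝ≥0}
    (hA : ∀ s ≤ t, γ s a = false)
    (hex : ∀ v v', ∀ s ≤ t, JumpsAt γ (Finset.Icc a (x + 1)) v v' s →
      IsExchange (Finset.Icc a (x + 1)) v v')
    (h0 : ∀ y ∈ Finset.Icc a x, γ 0 y = false) :
    current γ t x = countIcc a x (γ t) := by
  classical
  -- Finiteness of the hop times is carried along because `ncard` of an infinite set is 0.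
  let P : ℝ≥0 → Prop := fun r => r ≤ t → (hopTimes γ (x + 1) x r).Finite ∧
    (hopTimes γ x (x + 1) r).Finite ∧ countIcc a x (γ r) =
      (hopTimes γ (x + 1) x r).ncard - (hopTimes γ x (x + 1) r).ncard
  have hI : ∀ {y}, y ∈ Finset.Icc a x → y ∈ Finset.Icc a (x + 1) := fun {y} hy => by
    rw [Finset.mem_Icc] at hy ⊢; omega
  have ha : a ∈ Finset.Icc a (x + 1) := by rw [Finset.mem_Icc]; omega
  have hx : x ∈ Finset.Icc a (x + 1) := by rw [Finset.mem_Icc]; omega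
  have hx1 : x + 1 ∈ Finset.Icc a (x + 1) := by rw [Finset.mem_Icc]; omega
  suffices h : ∀ r ≤ t, P r from ((h t le_rfl le_rfl).2.2).symm
  refine nnreal_induction (fun _ => ?_) (fun r _ hr => ?_) fun s hs hst hP _ => ?_
  · rw [hopTimes_zero, hopTimes_zero]
    refine ⟨Set.finite_empty, Set.finite_empty, ?_⟩
    rw [Set.ncard_empty, sub_self]
    exact Finset.sum_eq_zero fun y hy => by simp [h0 y hy]
  · obtain ⟨r', hr', h⟩ := exists_gt_forall_Ico (hrc r) (Finset.Icc a (x + 1))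
    refine ⟨r', hr', fun u hu hut => ?_⟩
    have hno : ∀ b c, b ∈ Finset.Icc a (x + 1) → ∀ s ∈ Set.Ioc r u, ¬ HopsAt γ b c s :=
      fun b c hb s hs => not_hopsAt_of_forall_Ioo (ζ := γ r)
        (fun w hw => h w ⟨hw.1.le, hw.2⟩ b hb) ⟨hs.1, hs.2.trans_lt hu.2⟩
    rw [hopTimes_eq_of_forall_Ioc hu.1.le (hno _ _ hx1), hopTimes_eq_of_forall_Ioc hu.1.le
      (hno _ _ hx), countIcc_congr fun y hy => h u ⟨hu.1.le, hu.2⟩ y (hI hy)]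
    exact hr (hu.1.le.trans hut)
  · obtain ⟨ζ, hζ⟩ := hll s
    obtain ⟨l, hl, h⟩ := exists_lt_forall_Ioo hs hζ (Finset.Icc a (x + 1))
    obtain ⟨u, hlu, hus⟩ := exists_between hl
    have hno : ∀ b c, b ∈ Finset.Icc a (x + 1) → ∀ r ∈ Set.Ioo u s, ¬ HopsAt γ b c r :=
      fun b c hb r hr => not_hopsAt_of_forall_Ioo (ζ := ζ) (fun w hw => h w hw b hb)
        ⟨hlu.trans hr.1, hr.2⟩
    obtain ⟨f1, f2, hc⟩ := hP u hus (hus.le.trans hst)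
    obtain ⟨g1, n1⟩ := finite_and_ncard_hopTimes hus (hno _ _ hx1) f1
    obtain ⟨g2, n2⟩ := finite_and_ncard_hopTimes hus (hno _ _ hx) f2
    refine ⟨g1, g2, ?_⟩
    have hζa : ζ a = false := by
      rw [← h u ⟨hlu, hus⟩ a ha]; exact hA u (hus.le.trans hst)
    have hjump := countIcc_sub_eq_hopSign hax hζa (hA s hst)
      (hex _ _ s hst ⟨hs, ⟨ζ, hζ, fun _ => rfl⟩, fun _ => rfl⟩)
    rw [countIcc_congr fun y hy => h u ⟨hlu, hus⟩ y (hI hy)] at hc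
    have hsign : hopSign x ζ (γ s) = (if HopsAt γ (x + 1) x s then 1 else 0) -
        if HopsAt γ x (x + 1) s then 1 else 0 := by
      rw [hopSign]
      congr 1
      · exact if_congr (hopsAt_iff hs hζ _ _).symm rfl rfl
      · exact if_congr (hopsAt_iff hs hζ _ _).symm rfl rfl
    rw [n1, n2]
    rw [hsign] at hjump
    linarith

theorem countIcc_eq_leftCount {a x : ℤ} {ζ : Config} (h : ∀ y < a, ζ y = false) :
    countIcc a x ζ = leftCount x ζ := by
  have : leftParticles x ζ = ((Finset.Icc a x).filter fun y => ζ y = true : Finset ℤ) := by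
    ext y
    simp only [leftParticles, Set.mem_ofPred_eq, Finset.coe_filter, Finset.mem_Icc]
    refine ⟨fun h' => ⟨⟨?_, h'.1⟩, h'.2⟩, fun h' => ⟨h'.1.2, h'.2⟩⟩
    by_contra hy
    have := h y (not_le.1 hy)
    simp [this] at h'
  rw [countIcc, leftCount, this, Set.ncard_coe_finset, Finset.card_filter]
  push_cast
  rfl

/-! ### The current of the process and the conclusion -/

section Trajectories

variable {Ω : Type*} {m : MeasurableSpace Ω} {μ : Measure Ω} {p q : ℝ}
  {ℱ : Filtration ℝ≥0 m} {η : ℝ≥0 → Ω → Config}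

theorem IsASEP.ae_current_eq [IsProbabilityMeasure μ] (hη : IsASEP p q μ ℱ η)
    (hp : 0 ≤ p) (hq : 0 ≤ q) (hsum : p + q = 1)
    (h0 : ∀ᵐ ω ∂μ, ∀ y ≤ 0, η 0 ω y = false) {x : ℤ} (hx : x ≤ 0) (t : ℝ≥0) :
    ∀ᵐ ω ∂μ, current (fun s => η s ω) t x = (leftCount x (η t ω) : ℤ) := by
  have hleft : ∀ᵐ ω ∂μ, ∃ a : ℤ, ∀ y < a, η 0 ω y = false := by
    filter_upwards [h0] with ω hω using ⟨0, fun y hy => hω y hy.le⟩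
  have hex := ae_all_iff.2 fun a : ℤ => hη.ae_isExchange (Finset.Icc a (x + 1)) t
  filter_upwards [h0, hη.ae_exists_forall_lt hp hq hsum hleft t, hex,
    hη.ae_exists_le_not_jumpsAt hp hq hsum hleft t] with ω hω ⟨a₀, ha₀⟩ hexω hj
  -- With a ≤ a₀ the count in [a, x] at time t is all of N_x, and a ≤ x ≤ 0 makes the interval empty
  -- at time 0.
  obtain ⟨a, ha, hja⟩ := hj (min a₀ x)
  have hax : a ≤ x := ha.trans (min_le_right _ _)
  have haa : a ≤ a₀ := ha.trans (min_le_left _ _)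
  rw [current_eq_countIcc (a := a) (hη.right_continuous ω) (hη.left_limits ω) hax
    (forall_eq_false_of_not_jumpsAt (hη.right_continuous ω) (hη.left_limits ω)
      (hω a (hax.trans hx)) hja) (hexω a) fun y hy => hω y ((Finset.mem_Icc.1 hy).2.trans hx)]
  exact countIcc_eq_leftCount fun y hy => ha₀ y (hy.trans_le haa)

end Trajectories

end ASEP

theorem proposition3 {Ω : Type*} {m : MeasurableSpace Ω} (μ : Measure Ω) [IsProbabilityMeasure μ]
    (p q : ℝ) (hp : 0 ≤ p) (hpq : p < q) (hsum : p + q = 1)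
    (ℱ : Filtration ℝ≥0 m) (η : ℝ≥0 → Ω → ASEP.Config) (hη : ASEP.IsASEP p q μ ℱ η)
    (hleft : ∀ᵐ ω ∂μ, ∃ a : ℤ, ∀ y < a, η 0 ω y = false)
    (t : ℝ≥0) (x : ℤ) (n : ℕ) :
    -- the quantities and series in the identity are well defined
    (∀ᵐ ω ∂μ, (ASEP.leftParticles x (η t ω)).Finite) ∧
    Integrable (fun ω => ASEP.Q (p / q) x (η t ω) ^ n) μ ∧
    (∀ B : Finset ℤ, Integrable (fun ω => ∏ y ∈ B, ASEP.Qtilde (p / q) y (η 0 ω)) μ) ∧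
    (∀ k : ℕ, Summable (fun AB : ASEP.PositionsLE k x × ASEP.Positions k =>
      ASEP.transProb p q Set.univ t AB.1.1 AB.2.1 *
        ASEP.initialCorr (p / q) μ (η 0) AB.2.1)) ∧
    -- the moment is the limit of the moments of the reflecting systems on `{-L, …, L}`
    Tendsto (fun L : ℕ => ASEP.boxMoment p q μ (η 0) L t x n) atTop
      (𝓝 (∫ ω, ASEP.Q (p / q) x (η t ω) ^ n ∂μ)) ∧
    -- the moment formula
    ∫ ω, ASEP.Q (p / q) x (η t ω) ^ n ∂μ =
      ASEP.dualitySum (p / q) n (ASEP.coeff p q μ (η 0) t x) ∧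
    -- exponential moments of the integrated current
    ((∀ᵐ ω ∂μ, ∀ y ≤ 0, η 0 ω y = false) → x ≤ 0 →
      (∀ᵐ ω ∂μ, ASEP.current (fun s => η s ω) t x = (ASEP.leftCount x (η t ω) : ℤ)) ∧
      ∫ ω, (p / q) ^ ((n : ℤ) * ASEP.current (fun s => η s ω) t x) ∂μ =
        ASEP.dualitySum (p / q) n (ASEP.coeff p q μ (η 0) t x)) := by
  have hq : 0 < q := hp.trans_lt hpq
  have h0 : 0 ≤ p / q := div_nonneg hp hq.le
  have h1 : p / q < 1 := (div_lt_one hq).2 hpq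
  have hleft_t := hη.ae_exists_forall_lt hp hq.le hsum hleft t
  have hmoment := ASEP.tendsto_integral_dual_momentKernel (hη.measurable t) hleft_t h0 h1.le n x
  have hbox : Tendsto (fun L : ℕ => ASEP.boxMoment p q μ (η 0) L t x n) atTop
      (𝓝 (∫ ω, ASEP.Q (p / q) x (η t ω) ^ n ∂μ)) := by
    -- Subtracting from the restricted moment its difference to the box series leaves that series,
    -- which is the box moment.
    have h := hmoment.sub (hη.tendsto_moment_sub_tsum hp hpq hsum hleft n x t)
    rw [sub_zero] at h
    refine h.congr fun L => ?_
    rw [sub_sub_cancel, ASEP.boxMoment_eq_tsum hp hpq hsum (hη.measurable 0)]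
  have hformula : ∫ ω, ASEP.Q (p / q) x (η t ω) ^ n ∂μ =
      ASEP.dualitySum (p / q) n (ASEP.coeff p q μ (η 0) t x) := by
    refine tendsto_nhds_unique hbox ?_
    simp only [ASEP.boxMoment_eq_tsum hp hpq hsum (hη.measurable 0)]
    exact ASEP.tendsto_tsum_boxTaylor (hη.measurable 0) hleft hp hpq hsum n x t
  refine ⟨?_, ?_, fun B => ASEP.integrable_prod_Qtilde (hη.measurable 0) hleft h0 h1 B,
    fun k => (ASEP.summable_coeff_and_eq_tsum (hη.measurable 0) hleft hp hpq hsum k x t).1,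
    hbox, hformula, fun hempty hx => ?_⟩
  · filter_upwards [hleft_t] with ω hω using ASEP.finite_leftParticles hω x
  · exact Integrable.of_bound
      ((ASEP.aemeasurable_Q (hη.measurable t) hleft_t _ x).pow_const n).aestronglyMeasurable 1
      (Eventually.of_forall fun ω =>
        (Real.norm_eq_abs _).trans_le (ASEP.abs_Q_pow_le h0 h1.le x (η t ω) n))
  · have hcur := hη.ae_current_eq hp hq.le hsum hempty hx t
    refine ⟨hcur, ?_⟩
    rw [← hformula]
    refine integral_congr_ae ?_
    filter_upwards [hcur] with ω hω
    rw [hω, ASEP.Q, mul_comm, ← Nat.cast_mul, zpow_natCast, pow_mul]
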